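/- Consider a planar map $D$, that is, a finite connected graph properly embedded in the plane, and suppose that $D$ is a dissection of the hexagon by quadrangular faces: its outer face is bounded by a simple cycle of length $6$ and all its other faces have degree $4$. Suppose that $D$ is irreducible: it has at least $4$ faces, counting the outer one, and every $4$-cycle of $D$ is the boundary of a face. A vertex or an edge is called outer if it is incident to the outer face, and inner otherwise; each edge consists of two half-edges, one at each of its ends. A tri-orientation of $D$ is an orientation of each half-edge of each inner edge, either outward (out of the vertex to which it is attached) or inward (toward that vertex), such that every outer vertex has no outward half-edge, every inner vertex has exactly $3$ outward half-edges, and the two halves of an inner edge are never both inward. An inner edge is bi-oriented if both its halves are outward, and simply oriented if one half is outward and the other is inward; in the second case it is directed from the vertex of its outward half to the vertex of its inward half. A clockwise circuit is a simple cycle $\mathcal{C}$ of inner edges each of which is either bi-oriented or simply oriented with the interior of $\mathcal{C}$ on its right. Theorem. Every irreducible dissection $D$ of the hexagon by quadrangular faces has exactly one tri-orientation without clockwise circuit. -/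

import Mathlib

/-- A planar map (a connected graph properly embedded in the plane, up to deformation), given
by its rotation system. The elements of `H` are the half-edges. Each half-edge is attached to a
vertex, its origin, and is also regarded as its edge directed away from that origin.
`rot` sends a half-edge to the next one in counterclockwise order around its origin, `opp` sends
it to the other half of its edge. Vertices, edges and faces are the orbits of `rot`, `opp` and
`rot * opp`. The last permutation follows the boundary of a face keeping the face on the right,
so that the face attached to a half-edge is the one on its right. Planarity is Euler's relation
for a connected map, and `outer` is the unbounded face. -/
structure PlanarMap (H : Type*) where
  finite : Finite H
  rot : Equiv.Perm H
  opp : Equiv.Perm H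
  opp_opp : ∀ h, opp (opp h) = h
  opp_ne : ∀ h, opp h ≠ h
  connected : ∀ h k, Relation.ReflTransGen (fun a b => b = rot a ∨ b = opp a) h k
  euler : (Nat.card (Quotient (Equiv.Perm.SameCycle.setoid rot)) : ℤ)
      - Nat.card (Quotient (Equiv.Perm.SameCycle.setoid opp))
      + Nat.card (Quotient (Equiv.Perm.SameCycle.setoid (rot * opp))) = 2
  outer : Quotient (Equiv.Perm.SameCycle.setoid (rot * opp))

namespace PlanarMap

variable {H : Type*} (M : PlanarMap H)

/-- Vertices of the map. -/
abbrev Vertex : Type _ := Quotient (Equiv.Perm.SameCycle.setoid M.rot)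

/-- Faces of the map, including the outer one. -/
abbrev Face : Type _ := Quotient (Equiv.Perm.SameCycle.setoid (M.rot * M.opp))

/-- The vertex to which a half-edge is attached. -/
def origin (h : H) : M.Vertex := Quotient.mk _ h

/-- The face on the right of a half-edge. -/
def face (h : H) : M.Face := Quotient.mk _ h

/-- The degree of a face: the number of edge sides on its boundary. -/
noncomputable def faceDegree (f : M.Face) : ℕ := Nat.card {h : H // M.face h = f}

/-- A vertex is outer if it is incident to the outer face. -/
def IsOuterVertex (v : M.Vertex) : Prop := ∃ h, M.origin h = v ∧ M.face h = M.outer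

/-- A half-edge is inner if its edge is not incident to the outer face. -/
def IsInner (h : H) : Prop := M.face h ≠ M.outer ∧ M.face (M.opp h) ≠ M.outer

theorem IsInner.opp {M : PlanarMap H} {h : H} (hh : M.IsInner h) : M.IsInner (M.opp h) :=
  ⟨hh.2, by rw [M.opp_opp]; exact hh.1⟩

/-- The inner half-edges. -/
abbrev InnerHalfEdge : Type _ := {h : H // M.IsInner h}

/-- The other half of an inner edge. -/
def innerOpp (h : M.InnerHalfEdge) : M.InnerHalfEdge := ⟨M.opp h.1, h.2.opp⟩

/-- A simple cycle of length `n`, traversed along `c 0, c 1, …, c (n - 1)` (indices modulo `n`):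
consecutive edges, pairwise distinct vertices, pairwise distinct edges. -/
structure IsSimpleCycle {n : ℕ} [NeZero n] (c : Fin n → H) : Prop where
  chain : ∀ i, M.origin (M.opp (c i)) = M.origin (c (i + 1))
  vertices_distinct : Function.Injective fun i => M.origin (c i)
  edges_distinct : ∀ i j, c j ≠ M.opp (c i)

/-- The cycle `c` delimits a face: it is the boundary of some face, traversed in one of the two
directions. -/
def DelimitsFace {n : ℕ} (c : Fin n → H) : Prop :=
  ∃ f : M.Face, (∀ h, M.face h = f ↔ h ∈ Set.range c) ∨
    (∀ h, M.face h = f ↔ M.opp h ∈ Set.range c)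

/-- Two faces are adjacent across an edge that does not belong to `c`. -/
def AdjacentOff {n : ℕ} (c : Fin n → H) (f g : M.Face) : Prop :=
  ∃ h, h ∉ Set.range c ∧ M.opp h ∉ Set.range c ∧ M.face h = f ∧ M.face (M.opp h) = g

/-- A face lies in the interior of the cycle `c` if it cannot be reached from the outer face
without crossing `c`. -/
def InInterior {n : ℕ} (c : Fin n → H) (f : M.Face) : Prop :=
  ¬ Relation.ReflTransGen (M.AdjacentOff c) M.outer f

/-- A dissection of the hexagon by quadrangular faces: the outer face is bounded by a hexagon
(degree 6, with six distinct vertices), and all other faces have degree 4. -/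
structure IsHexagonDissection : Prop where
  outer_degree : M.faceDegree M.outer = 6
  outer_simple : ∀ h k, M.face h = M.outer → M.face k = M.outer → M.origin h = M.origin k → h = k
  inner_degree : ∀ f, f ≠ M.outer → M.faceDegree f = 4

/-- Irreducible: at least 4 faces (counting the outer one), and no separating 4-cycle, that is,
every 4-cycle delimits a face. -/
structure IsIrreducible : Prop where
  four_le_faces : 4 ≤ Nat.card M.Face
  no_separating : ∀ c : Fin 4 → H, M.IsSimpleCycle c → M.DelimitsFace c

/-- The orientation of a half-edge: toward its origin, or out of its origin. -/
inductive Direction : Type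
  | inward
  | outward

/-- An orientation of the inner half-edges. -/
abbrev InnerOrientation : Type _ := M.InnerHalfEdge → Direction

variable {M}

namespace InnerOrientation

/-- The number of half-edges at `v` that are oriented outward. -/
noncomputable def outdegree (X : M.InnerOrientation) (v : M.Vertex) : ℕ :=
  Nat.card {h : M.InnerHalfEdge // M.origin h.1 = v ∧ X h = Direction.outward}

/-- Outer vertices have outdegree 0, inner vertices have outdegree 3, and the two halves of an
inner edge are not both inward. -/
structure IsTriOrientation (X : M.InnerOrientation) : Prop where
  outer_vertex : ∀ v, M.IsOuterVertex v → outdegree X v = 0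
  inner_vertex : ∀ v, ¬ M.IsOuterVertex v → outdegree X v = 3
  not_both_inward : ∀ h, ¬ (X h = Direction.inward ∧ X (M.innerOpp h) = Direction.inward)

/-- Both halves of the edge are oriented outward. -/
def BiOriented (X : M.InnerOrientation) (h : M.InnerHalfEdge) : Prop :=
  X h = Direction.outward ∧ X (M.innerOpp h) = Direction.outward

/-- The edge is simply oriented, in the direction from the origin of `h` to its other end. -/
def SimplyOriented (X : M.InnerOrientation) (h : M.InnerHalfEdge) : Prop :=
  X h = Direction.outward ∧ X (M.innerOpp h) = Direction.inward

/-- A clockwise circuit: a simple cycle, traversed with its interior on the right, whose edges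
are inner edges that are bi-oriented or simply oriented in the direction of traversal. -/
structure IsClockwiseCircuit (X : M.InnerOrientation) {n : ℕ} [NeZero n] (c : Fin n → H) :
    Prop where
  simple : M.IsSimpleCycle c
  interior_right : ∀ i, M.InInterior c (M.face (c i))
  oriented : ∀ i, ∃ hi : M.IsInner (c i), BiOriented X ⟨c i, hi⟩ ∨ SimplyOriented X ⟨c i, hi⟩

/-- The orientation has no clockwise circuit. -/
def NoClockwiseCircuit (X : M.InnerOrientation) : Prop :=
  ∀ (n : ℕ) [NeZero n] (c : Fin n → H), ¬ IsClockwiseCircuit X c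

end InnerOrientation

end PlanarMap

/-! An orientation is recorded by the set `S` of its outward half-edges. A half-edge `h` also stands
for the corner of `face h` at `origin h`, between `rot.symm h` and `h`. Corners are the edges of the
vertex-face incidence graph, a quadrangulation of the sphere whose faces are the edges of the map. A
`Balanced` set prescribes degrees in that graph: three members at each inner vertex, none at an
outer one, one inner non-member in each inner face. Such sets behave like the orientations of a
planar graph with given outdegrees, exactly one of which has no clockwise circuit.

Uniqueness: two balanced sets differ by a function with zero sums at vertices and faces, hence by
the gradient of an edge potential, and the extremal level set of the potential is a clockwise set of
edges (`EdgeRegion`) for one of them. Existence: turning the boundary of an edge region raises the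
potential by an indicator function, so the process ends at a balanced set without edge region. That
some balanced set exists is Hall's theorem; its condition `card_facesInside_le` combines Euler-type
inequalities with irreducibility, in the form that a contour of at most four edges encloses a single
face.

It remains to pass between balanced sets without edge region and tri-orientations without clockwise
circuit. For the latter, Euler's relation makes inward half-edges as numerous as inner faces, and
each inner face has one, since otherwise its contour is clockwise; so the set is balanced. Clockwise
circuits amount to clockwise sets of faces (`FaceRegion`), and the faces along an edge region form a
face region. An inner edge with two inward halves would by itself be an edge region, so without edge
regions a balanced set is a tri-orientation.

The hard step is `FaceRegion.exists_edgeRegion`: the edges interior to a minimal face region without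
holes form an edge region, because no outward half-edge leads from its contour to its inside.
Suppose that one does. The outward walks that start with it never meet the contour at another
vertex, for this would cut out a smaller region. So they reach a set `Y` of vertices with at least
`3|Y| - 2` outward half-edges on at most `2|Y| - 2` edges. At least `|Y|` edges are bi-oriented and
contain a cycle; traversed in the right direction, it contradicts minimality. -/

/-! ### Exactness by dimension count -/

/-- A complex `X → Y → Z` of finite-dimensional spaces is exact in the middle if the kernel on the
left and the cokernel on the right have dimension at most one and the dimensions fit. -/
theorem LinearMap.exact_of_finrank_le {K X Y Z : Type*} [Field K] [AddCommGroup X] [Module K X]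
    [AddCommGroup Y] [Module K Y] [AddCommGroup Z] [Module K Z] [FiniteDimensional K X]
    [FiniteDimensional K Y] [FiniteDimensional K Z] (A : X →ₗ[K] Y) (B : Y →ₗ[K] Z)
    (hBA : ∀ x, B (A x) = 0) (l : X →ₗ[K] K) (hl : ∀ x, A x = 0 → l x = 0 → x = 0) (w : Z)
    (hw : ∀ m : Z →ₗ[K] K, (∀ y, m (B y) = 0) → m w = 0 → m = 0)
    (hdim : Module.finrank K Y + 2 ≤ Module.finrank K X + Module.finrank K Z)
    {y : Y} (hy : B y = 0) : ∃ x, A x = y := by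
  have hker : Module.finrank K (LinearMap.ker A) ≤ 1 := by
    have hinj : Function.Injective (l.comp (LinearMap.ker A).subtype) := by
      rw [← LinearMap.ker_eq_bot, LinearMap.ker_eq_bot']
      rintro ⟨x, hx⟩ h
      exact Subtype.ext (hl x hx h)
    simpa using LinearMap.finrank_le_finrank_of_injective hinj
  have hrange : Module.finrank K Z ≤ Module.finrank K (LinearMap.range B) + 1 := by
    have htop : LinearMap.range B ⊔ Submodule.span K {w} = ⊤ := by
      by_contra hne
      obtain ⟨m, hm, hle⟩ := Submodule.exists_le_ker_of_lt_top _ (lt_top_iff_ne_top.mpr hne)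
      refine hm (hw m (fun y => hle (Submodule.mem_sup_left ⟨y, rfl⟩)) (hle ?_))
      exact Submodule.mem_sup_right (Submodule.mem_span_singleton_self w)
    have h1 := Submodule.finrank_add_le_finrank_add_finrank (LinearMap.range B)
      (Submodule.span K {w})
    rw [htop, finrank_top] at h1
    have h2 := finrank_span_le_card (R := K) ({w} : Set Z)
    simp only [Set.toFinset_singleton, Finset.card_singleton] at h2
    omega
  have h1 := LinearMap.finrank_range_add_finrank_ker A
  have h2 := LinearMap.finrank_range_add_finrank_ker B
  have hle : LinearMap.range A ≤ LinearMap.ker B := by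
    rintro _ ⟨x, rfl⟩
    exact hBA x
  have heq := Submodule.eq_of_le_of_finrank_le hle (by omega)
  have : y ∈ LinearMap.range A := by rw [heq]; exact hy
  exact this

/-! ### Abstract homology of the sphere: face potentials and edge potentials -/

section FiberSum

open scoped Classical

variable {H V F E K : Type*} [Fintype H] [Field K]

/-- The sum of `z` over the fibre of `o` above `v`. -/
noncomputable def fiberSum {A : Type*} [AddCommMonoid A] (o : H → V) (z : H → A) (v : V) : A :=
  ∑ h, if o h = v then z h else 0

theorem fiberSum_add {A : Type*} [AddCommMonoid A] (o : H → V) (z z' : H → A) (v : V) :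
    fiberSum o (fun h => z h + z' h) v = fiberSum o z v + fiberSum o z' v := by
  simp only [fiberSum, ← Finset.sum_add_distrib]
  exact Finset.sum_congr rfl fun h _ => by split_ifs <;> simp

theorem fiberSum_sub {A : Type*} [AddCommGroup A] (o : H → V) (z z' : H → A) (v : V) :
    fiberSum o (fun h => z h - z' h) v = fiberSum o z v - fiberSum o z' v := by
  simp only [fiberSum, ← Finset.sum_sub_distrib]
  exact Finset.sum_congr rfl fun h _ => by split_ifs <;> simp

theorem fiberSum_smul (o : H → V) (c : K) (z : H → K) (v : V) :
    fiberSum o (fun h => c * z h) v = c * fiberSum o z v := by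
  simp only [fiberSum, Finset.mul_sum]
  exact Finset.sum_congr rfl fun h _ => by split_ifs <;> simp

theorem fiberSum_comp_perm {A : Type*} [AddCommMonoid A] (o : H → V) (σ : Equiv.Perm H)
    (hσ : ∀ h, o (σ h) = o h) (z : H → A) (v : V) :
    fiberSum o (fun h => z (σ h)) v = fiberSum o z v := by
  unfold fiberSum
  rw [← Equiv.sum_comp σ (fun h => if o h = v then z h else 0)]
  simp only [hσ]

theorem fiberSum_congr {A : Type*} [AddCommMonoid A] {o : H → V} {z z' : H → A} {v : V}
    (h : ∀ k, o k = v → z k = z' k) : fiberSum o z v = fiberSum o z' v :=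
  Finset.sum_congr rfl fun k _ => by
    split_ifs with hk
    · exact h k hk
    · rfl

theorem sum_fiberSum [Fintype V] {A : Type*} [AddCommMonoid A] (o : H → V) (z : H → A) :
    ∑ v, fiberSum o z v = ∑ h, z h := by
  unfold fiberSum
  rw [Finset.sum_comm]
  simp

theorem fiberSum_single (o : H → V) (a : H) (v : V) :
    fiberSum o (fun h => if h = a then (1 : K) else 0) v = if o a = v then 1 else 0 := by
  unfold fiberSum
  rw [Finset.sum_eq_single a]
  · simp
  · intro b _ hb
    simp [hb]
  · simp

/-- `fiberSum` as a linear map. -/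
noncomputable def fiberSumLinear (o : H → V) : (H → K) →ₗ[K] (V → K) where
  toFun z v := fiberSum o z v
  map_add' z z' := funext fun v => fiberSum_add o z z' v
  map_smul' c z := funext fun v => by
    simp only [Pi.smul_apply, smul_eq_mul, RingHom.id_apply]
    exact fiberSum_smul o c z v

variable [Fintype V] [Fintype F] [Fintype E]

/-- Vanishing of the first homology of a sphere: a chain without boundary is the boundary of a
combination of faces. -/
theorem exists_face_potential (opp : Equiv.Perm H) (hopp : ∀ h, opp (opp h) = h)
    (o : H → V) (r : H → F) (e : H → E) (he : ∀ h, e (opp h) = e h)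
    (hesurj : Function.Surjective e) (h₀ : H)
    (hV : ∀ g : V → K, (∀ h, g (o (opp h)) = g (o h)) → ∀ v, g v = g (o h₀))
    (hF : ∀ g : F → K, (∀ h, g (r (opp h)) = g (r h)) → ∀ f, g f = g (r h₀))
    (hbd : ∀ (g : F → K) (v : V),
      fiberSum o (fun h => g (r h)) v = fiberSum o (fun h => g (r (opp h))) v)
    (hcard : Fintype.card H + 2 ≤ Fintype.card F + Fintype.card E + Fintype.card V)
    (z : H → K) (hz : ∀ v, fiberSum o (fun h => z h - z (opp h)) v = 0) :
    ∃ g : F → K, ∀ h, z h - z (opp h) = g (r h) - g (r (opp h)) := by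
  -- The second factor supplies the functions invariant under `opp`, so that no orientation of the
  -- edges has to be chosen and characteristic two is allowed.
  let A : ((F → K) × (E → K)) →ₗ[K] (H → K) :=
    { toFun := fun x h => x.1 (r h) + x.2 (e h)
      map_add' := fun x y => funext fun h => by
        simp only [Prod.fst_add, Prod.snd_add, Pi.add_apply]; ring
      map_smul' := fun c x => funext fun h => by
        simp only [Prod.smul_fst, Prod.smul_snd, Pi.smul_apply, smul_eq_mul, RingHom.id_apply]
        ring }
  let D : (H → K) →ₗ[K] (H → K) :=
    { toFun := fun x h => x h - x (opp h)
      map_add' := fun x y => funext fun h => by simp only [Pi.add_apply]; ring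
      map_smul' := fun c x => funext fun h => by
        simp only [Pi.smul_apply, smul_eq_mul, RingHom.id_apply]; ring }
  let B : (H → K) →ₗ[K] (V → K) := (fiberSumLinear o).comp D
  have hB : ∀ y v, B y v = fiberSum o (fun h => y h - y (opp h)) v := fun y v => rfl
  obtain ⟨x, hx⟩ := LinearMap.exact_of_finrank_le A B (y := z)
    (fun x => funext fun v => by
      rw [hB]
      have : (fun h => A x h - A x (opp h)) = fun h => x.1 (r h) - x.1 (r (opp h)) := by
        funext h
        change x.1 (r h) + x.2 (e h) - (x.1 (r (opp h)) + x.2 (e (opp h))) = _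
        rw [he]; ring
      rw [this, fiberSum_sub, hbd x.1 v, sub_self]; rfl)
    ((LinearMap.proj (r h₀)).comp (LinearMap.fst K (F → K) (E → K)))
    (fun x hx hl => by
      have hx' : ∀ h, x.1 (r h) + x.2 (e h) = 0 := fun h => congrFun hx h
      have h1 : ∀ f, x.1 f = x.1 (r h₀) := hF x.1 fun h => by
        have := hx' h; have h2 := hx' (opp h); rw [he] at h2
        exact add_right_cancel (h2.trans this.symm)
      have hl' : x.1 (r h₀) = 0 := hl
      refine Prod.ext (funext fun f => (h1 f).trans hl') (funext fun ε => ?_)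
      obtain ⟨h, rfl⟩ := hesurj ε
      have := hx' h
      rw [h1, hl', zero_add] at this
      exact this)
    (Pi.single (o h₀) 1)
    (fun m hm hm0 => by
      have key : ∀ h, m (Pi.single (o (opp h)) 1) = m (Pi.single (o h) 1) := fun h => by
        have h1 : B (fun k => if k = h then 1 else 0) =
            (Pi.single (o h) 1 : V → K) - Pi.single (o (opp h)) 1 := by
          funext v
          rw [hB, fiberSum_sub, fiberSum_single]
          have h2 : (fun k => if opp k = h then (1 : K) else 0) =
              fun k => if k = opp h then 1 else 0 := by
            funext k
            have : opp k = h ↔ k = opp h :=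
              ⟨fun hh => by rw [← hh, hopp], fun hh => by rw [hh, hopp]⟩
            simp only [this]
          rw [h2, fiberSum_single]
          simp only [Pi.sub_apply, Pi.single_apply, eq_comm]
        have h2 := hm (fun k => if k = h then 1 else 0)
        rw [h1, map_sub, sub_eq_zero] at h2
        exact h2.symm
      have h3 := hV (fun v => m (Pi.single v 1)) key
      refine LinearMap.pi_ext' fun v => LinearMap.ext_ring ?_
      simpa [hm0] using h3 v)
    (by simpa [Module.finrank_prod] using hcard)
    (funext fun v => by rw [hB, hz]; rfl)
  refine ⟨x.1, fun h => ?_⟩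
  have h1 : ∀ h, x.1 (r h) + x.2 (e h) = z h := fun h => congrFun hx h
  rw [← h1 h, ← h1 (opp h), he]; ring

/-- A function on half-edges whose sums around vertices and around faces vanish is the difference
of a potential on the edges. -/
theorem exists_edge_potential (σ : Equiv.Perm H)
    (o : H → V) (r : H → F) (e : H → E) (h₀ : H)
    (hoσ : ∀ h, o (σ h) = o h) (hrσ : ∀ g : E → K, ∀ f,
      fiberSum r (fun h => g (e (σ h))) f = fiberSum r (fun h => g (e h)) f)
    (hV : ∀ (g : V → K) (g' : F → K), (∀ h, g (o h) + g' (r h) = 0) →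
      (∀ v, g v = g (o h₀)) ∧ ∀ f, g' f = g' (r h₀))
    (hE : ∀ g : E → K, (∀ h, g (e (σ h)) = g (e h)) → ∀ ε, g ε = g (e h₀))
    (hcard : Fintype.card H + 2 ≤ Fintype.card E + (Fintype.card V + Fintype.card F))
    (y : H → K) (hy : ∀ v, fiberSum o y v = 0) (hy' : ∀ f, fiberSum r y f = 0) :
    ∃ g : E → K, ∀ h, y h = g (e h) - g (e (σ h)) := by
  -- The cellular complex of the vertex-face incidence graph: half-edges are its edges and `E` its
  -- faces. The graph is bipartite, so the boundary `B` can be taken without signs.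
  let A : (E → K) →ₗ[K] (H → K) :=
    { toFun := fun x h => x (e h) - x (e (σ h))
      map_add' := fun x y => funext fun h => by simp only [Pi.add_apply]; ring
      map_smul' := fun c x => funext fun h => by
        simp only [Pi.smul_apply, smul_eq_mul, RingHom.id_apply]; ring }
  let B : (H → K) →ₗ[K] ((V → K) × (F → K)) := (fiberSumLinear o).prod (fiberSumLinear r)
  have hB1 : ∀ y v, (B y).1 v = fiberSum o y v := fun y v => rfl
  have hB2 : ∀ y v, (B y).2 v = fiberSum r y v := fun y v => rfl
  obtain ⟨x, hx⟩ := LinearMap.exact_of_finrank_le A B (y := y)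
    (fun x => by
      have hA : A x = fun h => x (e h) - x (e (σ h)) := rfl
      refine Prod.ext (funext fun v => ?_) (funext fun f => ?_)
      · rw [hB1, hA, fiberSum_sub, fiberSum_comp_perm o σ hoσ (fun h => x (e h)), sub_self]; rfl
      · rw [hB2, hA, fiberSum_sub, hrσ, sub_self]; rfl)
    (LinearMap.proj (e h₀))
    (fun x hx hl => by
      have h1 := hE x fun h => by
        have : x (e h) - x (e (σ h)) = 0 := congrFun hx h
        exact (sub_eq_zero.mp this).symm
      have hl' : x (e h₀) = 0 := hl
      exact funext fun ε => (h1 ε).trans hl')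
    (Pi.single (o h₀) 1, 0)
    (fun m hm hm0 => by
      have key : ∀ h, m (Pi.single (o h) 1, 0) + m (0, Pi.single (r h) 1) = 0 := fun h => by
        have h1 : B (fun k => if k = h then 1 else 0) =
            ((Pi.single (o h) 1, 0) : (V → K) × (F → K)) + (0, Pi.single (r h) 1) := by
          refine Prod.ext (funext fun v => ?_) (funext fun f => ?_)
          · rw [hB1, fiberSum_single]; simp [Pi.single_apply, eq_comm]
          · rw [hB2, fiberSum_single]; simp [Pi.single_apply, eq_comm]
        have h2 := hm (fun k => if k = h then 1 else 0)
        rwa [h1, map_add] at h2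
      obtain ⟨h3, h4⟩ := hV (fun v => m (Pi.single v 1, 0)) (fun f => m (0, Pi.single f 1)) key
      have h5 : ∀ f, m (0, Pi.single f 1) = 0 := fun f => by
        have := key h₀
        rw [hm0, zero_add] at this
        exact (h4 f).trans this
      refine LinearMap.prod_ext (LinearMap.pi_ext' fun v => LinearMap.ext_ring ?_)
        (LinearMap.pi_ext' fun v => LinearMap.ext_ring ?_)
      · simpa [hm0] using h3 v
      · simpa using h5 v)
    (by simpa [Module.finrank_prod] using hcard)
    (Prod.ext (funext fun v => by rw [hB1, hy]; rfl) (funext fun v => by rw [hB2, hy']; rfl))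
  exact ⟨x, fun h => (congrFun hx h).symm⟩

end FiberSum

namespace PlanarMap

/-! ### Vertices, edges and faces as orbits -/

section Orbits

open scoped Classical

variable {H : Type*} (M : PlanarMap H)

theorem origin_rot (h : H) : M.origin (M.rot h) = M.origin h :=
  Quotient.sound (Equiv.Perm.sameCycle_apply_left.mpr (Equiv.Perm.SameCycle.refl _ _))

theorem origin_rot_symm (h : H) : M.origin (M.rot.symm h) = M.origin h := by
  rw [← M.origin_rot (M.rot.symm h), Equiv.apply_symm_apply]

theorem face_rot_opp (h : H) : M.face (M.rot (M.opp h)) = M.face h :=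
  Quotient.sound ((Equiv.Perm.sameCycle_apply_left (f := M.rot * M.opp)).mpr
    (Equiv.Perm.SameCycle.refl _ _))

theorem face_rot (h : H) : M.face (M.rot h) = M.face (M.opp h) := by
  rw [← M.face_rot_opp (M.opp h), M.opp_opp]

theorem face_opp_rot_symm (h : H) : M.face (M.opp (M.rot.symm h)) = M.face h := by
  rw [← M.face_rot, Equiv.apply_symm_apply]

theorem origin_eq_iff {h k : H} : M.origin h = M.origin k ↔ M.rot.SameCycle h k :=
  Quotient.eq (r := Equiv.Perm.SameCycle.setoid M.rot)

theorem face_eq_iff {h k : H} : M.face h = M.face k ↔ (M.rot * M.opp).SameCycle h k :=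
  Quotient.eq (r := Equiv.Perm.SameCycle.setoid (M.rot * M.opp))

theorem origin_surjective : Function.Surjective M.origin := Quotient.mk_surjective

theorem face_surjective : Function.Surjective M.face := Quotient.mk_surjective

theorem opp_injective : Function.Injective M.opp := M.opp.injective

theorem opp_eq_iff {h k : H} : M.opp h = k ↔ h = M.opp k :=
  ⟨fun hh => by rw [← hh, M.opp_opp], fun hh => by rw [hh, M.opp_opp]⟩

/-- A property that holds at one place of a cycle of a permutation and fails at another one is
lost somewhere in one step. -/
theorem exists_step_of_sameCycle [Finite H] {σ : Equiv.Perm H} {a b : H} (hab : σ.SameCycle a b)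
    {P : H → Prop} (ha : P a) (hb : ¬ P b) : ∃ c, σ.SameCycle a c ∧ P c ∧ ¬ P (σ c) := by
  by_contra hcon
  push Not at hcon
  obtain ⟨n, rfl⟩ := hab.exists_nat_pow_eq
  apply hb
  clear hb hab
  induction n with
  | zero => simpa using ha
  | succ n ih =>
    rw [pow_succ']
    exact hcon _ (Equiv.Perm.SameCycle.symm ⟨-n, by simp⟩) ih

theorem exists_rot_step [Finite H] {a b : H} (hab : M.origin a = M.origin b)
    {P : H → Prop} (ha : P a) (hb : ¬ P b) : ∃ c, M.origin c = M.origin a ∧ P c ∧ ¬ P (M.rot c) := by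
  obtain ⟨c, h1, h2⟩ := exists_step_of_sameCycle (M.origin_eq_iff.mp hab) ha hb
  exact ⟨c, (M.origin_eq_iff.mpr h1).symm, h2⟩

theorem exists_face_step [Finite H] {a b : H} (hab : M.face a = M.face b)
    {P : H → Prop} (ha : P a) (hb : ¬ P b) :
    ∃ c, M.face c = M.face a ∧ P c ∧ ¬ P (M.rot (M.opp c)) := by
  obtain ⟨c, h1, h2⟩ := exists_step_of_sameCycle (M.face_eq_iff.mp hab) ha hb
  exact ⟨c, (M.face_eq_iff.mpr h1).symm, h2⟩

theorem const_of_rot_of_opp {α : Type*} (p : H → α) (hr : ∀ h, p (M.rot h) = p h)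
    (ho : ∀ h, p (M.opp h) = p h) (h k : H) : p h = p k := by
  induction M.connected h k with
  | refl => rfl
  | tail _ hbc ih =>
    rcases hbc with rfl | rfl
    · rw [ih, hr]
    · rw [ih, ho]

theorem vertex_const {α : Type*} (g : M.Vertex → α)
    (hg : ∀ h, g (M.origin (M.opp h)) = g (M.origin h)) (u v : M.Vertex) : g u = g v := by
  obtain ⟨h, rfl⟩ := M.origin_surjective u
  obtain ⟨k, rfl⟩ := M.origin_surjective v
  exact M.const_of_rot_of_opp (fun h => g (M.origin h)) (fun h => by rw [M.origin_rot]) hg h k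

theorem face_const {α : Type*} (g : M.Face → α)
    (hg : ∀ h, g (M.face (M.opp h)) = g (M.face h)) (u v : M.Face) : g u = g v := by
  obtain ⟨h, rfl⟩ := M.face_surjective u
  obtain ⟨k, rfl⟩ := M.face_surjective v
  exact M.const_of_rot_of_opp (fun h => g (M.face h)) (fun h => by rw [M.face_rot, hg]) hg h k

/-- If a set of faces is neither empty nor everything, some edge leaves it. -/
theorem exists_boundary {R : Set M.Face} {f g : M.Face} (hf : f ∈ R) (hg : g ∉ R) :
    ∃ h, M.face h ∈ R ∧ M.face (M.opp h) ∉ R := by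
  by_contra hcon
  push Not at hcon
  have := M.face_const (fun f => f ∈ R) (fun h => propext
    ⟨fun hh => by have := hcon _ hh; rwa [M.opp_opp] at this, hcon h⟩) f g
  exact hg (this ▸ hf)

/-- The edges of the map. -/
abbrev Edge : Type _ := Quotient (Equiv.Perm.SameCycle.setoid M.opp)

/-- The edge of a half-edge. -/
def edge (h : H) : M.Edge := Quotient.mk _ h

theorem edge_opp (h : H) : M.edge (M.opp h) = M.edge h :=
  Quotient.sound (Equiv.Perm.sameCycle_apply_left.mpr (Equiv.Perm.SameCycle.refl _ _))

theorem edge_surjective : Function.Surjective M.edge := Quotient.mk_surjective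

theorem edge_eq_iff {h k : H} : M.edge h = M.edge k ↔ h = k ∨ h = M.opp k := by
  constructor
  · intro hh
    obtain ⟨n, hn⟩ := (Quotient.eq (r := Equiv.Perm.SameCycle.setoid M.opp)).mp hh.symm
    have h2 : M.opp ^ (2 : ℤ) = 1 := Equiv.ext fun x => by
      change M.opp (M.opp x) = x
      exact M.opp_opp x
    rcases Int.even_or_odd' n with ⟨m, rfl | rfl⟩
    · rw [zpow_mul, h2, one_zpow] at hn
      exact Or.inl hn.symm
    · rw [zpow_add, zpow_mul, h2, one_zpow] at hn
      exact Or.inr hn.symm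
  · rintro (rfl | rfl)
    · rfl
    · exact M.edge_opp k

/-- A choice of one half of each edge. -/
noncomputable def chosen : Set H := {h | (M.edge h).out = h}

theorem mem_chosen_iff (h : H) : h ∈ M.chosen ↔ M.opp h ∉ M.chosen := by
  have h1 : M.edge (M.edge h).out = M.edge h := Quotient.out_eq _
  simp only [chosen, Set.mem_ofPred_eq, M.edge_opp]
  rcases M.edge_eq_iff.mp h1 with h2 | h2
  · rw [h2]
    simp [(M.opp_ne h).symm]
  · rw [h2]
    simp [M.opp_ne h]

theorem nonempty (M : PlanarMap H) : Nonempty H := by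
  obtain ⟨h, _⟩ := M.face_surjective M.outer
  exact ⟨h⟩

variable [Fintype H]

theorem card_chosen_inter (S : Set H) (hS : ∀ h ∈ S, M.opp h ∈ S) :
    (Finset.univ.filter (· ∈ S)).card =
      2 * (Finset.univ.filter fun h => h ∈ S ∧ h ∈ M.chosen).card := by
  have h1 := Finset.card_filter_add_card_filter_not (s := Finset.univ.filter (· ∈ S))
    (fun h => h ∈ M.chosen)
  rw [Finset.filter_filter, Finset.filter_filter] at h1
  have h2 : (Finset.univ.filter fun h => h ∈ S ∧ h ∉ M.chosen).card =
      (Finset.univ.filter fun h => h ∈ S ∧ h ∈ M.chosen).card := by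
    refine Finset.card_bij (fun h _ => M.opp h) ?_ (fun _ _ _ _ h => M.opp_injective h) ?_
    · intro h hh
      simp only [Finset.mem_filter, Finset.mem_univ, true_and] at hh ⊢
      refine ⟨hS _ hh.1, ?_⟩
      rw [M.mem_chosen_iff, M.opp_opp]
      exact hh.2
    · intro h hh
      simp only [Finset.mem_filter, Finset.mem_univ, true_and] at hh ⊢
      exact ⟨M.opp h, ⟨hS _ hh.1, (M.mem_chosen_iff h).mp hh.2⟩, M.opp_opp h⟩
  omega

theorem card_eq_two_mul_card_edge : Fintype.card H = 2 * Fintype.card M.Edge := by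
  have h1 := M.card_chosen_inter Set.univ (fun _ _ => trivial)
  simp only [Set.mem_univ, Finset.filter_true, Finset.card_univ, true_and] at h1
  rw [h1]
  congr 1
  refine Finset.card_bij (fun h _ => M.edge h) (fun _ _ => Finset.mem_univ _) ?_ ?_
  · intro h hh k hk hhk
    have h1 : (M.edge h).out = h := (Finset.mem_filter.mp hh).2
    have h2 : (M.edge k).out = k := (Finset.mem_filter.mp hk).2
    rw [← h1, ← h2]
    exact congrArg Quotient.out hhk
  · intro ε _
    exact ⟨ε.out, Finset.mem_filter.mpr ⟨Finset.mem_univ _,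
      congrArg Quotient.out (Quotient.out_eq ε)⟩, Quotient.out_eq _⟩

theorem euler_card :
    Fintype.card M.Vertex + Fintype.card M.Face = Fintype.card M.Edge + 2 := by
  have := M.euler
  simp only [Nat.card_eq_fintype_card] at this
  have h2 : (Fintype.card M.Vertex : ℤ) - Fintype.card M.Edge + Fintype.card M.Face = 2 := this
  omega

/-- Turning around `v`, the face on the left of a half-edge is the face on the right of the next
one. Thus the boundary of a face has no boundary. -/
theorem fiberSum_origin_face {A : Type*} [AddCommMonoid A] (g : M.Face → A) (v : M.Vertex) :
    fiberSum M.origin (fun h => g (M.face h)) v =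
      fiberSum M.origin (fun h => g (M.face (M.opp h))) v := by
  rw [← fiberSum_comp_perm M.origin M.rot M.origin_rot]
  simp only [M.face_rot]

theorem fiberSum_face_origin {A : Type*} [AddCommMonoid A] (g : M.Vertex → A) (f : M.Face) :
    fiberSum M.face (fun h => g (M.origin h)) f =
      fiberSum M.face (fun h => g (M.origin (M.opp h))) f := by
  rw [← fiberSum_comp_perm M.face (M.rot * M.opp) M.face_rot_opp]
  simp only [Equiv.Perm.mul_apply, M.origin_rot]

theorem fiberSum_face_rot_symm {A : Type*} [AddCommMonoid A] (p : H → A)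
    (hp : ∀ h, p (M.opp h) = p h) (f : M.Face) :
    fiberSum M.face (fun h => p (M.rot.symm h)) f = fiberSum M.face p f := by
  rw [← fiberSum_comp_perm M.face (M.rot * M.opp) M.face_rot_opp]
  simp only [Equiv.Perm.mul_apply, Equiv.symm_apply_apply, hp]

/-! ### Potentials on a planar map -/

/-- A chain without boundary bounds a combination of faces. -/
theorem exists_potential_of_boundary_eq_zero {K : Type*} [Field K] (z : H → K)
    (hz : ∀ v, fiberSum M.origin (fun h => z h - z (M.opp h)) v = 0) :
    ∃ g : M.Face → K, g M.outer = 0 ∧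
      ∀ h, z h - z (M.opp h) = g (M.face h) - g (M.face (M.opp h)) := by
  obtain ⟨h₀⟩ := M.nonempty
  obtain ⟨g, hg⟩ := exists_face_potential M.opp M.opp_opp M.origin M.face M.edge M.edge_opp
    M.edge_surjective h₀ (fun g hg v => M.vertex_const g hg v _)
    (fun g hg v => M.face_const g hg v _) (fun g v => M.fiberSum_origin_face g v)
    (by have := M.euler_card; have := M.card_eq_two_mul_card_edge; omega) z hz
  exact ⟨fun f => g f - g M.outer, sub_self _, fun h => by rw [hg]; ring⟩

/-- If all faces have even degree, the vertices can be coloured with two colours. -/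
theorem exists_coloring (heven : ∀ f, Even (M.faceDegree f)) :
    ∃ c : M.Vertex → ZMod 2, ∀ h, c (M.origin h) ≠ c (M.origin (M.opp h)) := by
  obtain ⟨h₀⟩ := M.nonempty
  have hdiff : ∀ h, ((if h ∈ M.chosen then 1 else 0) - (if M.opp h ∈ M.chosen then 1 else 0) :
      ZMod 2) = 1 := fun h => by
    have := M.mem_chosen_iff h
    by_cases h1 : M.opp h ∈ M.chosen
    · have h2 : h ∉ M.chosen := fun h2 => this.mp h2 h1
      simp only [h1, h2, if_true, if_false]; decide
    · have h2 : h ∈ M.chosen := this.mpr h1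
      simp only [h1, h2, if_true, if_false]; decide
  -- The roles of vertices and faces are exchanged. Modulo two the constant 1 sums to the degree
  -- around a face, so it is the coboundary of a function on vertices.
  obtain ⟨g, hg⟩ := exists_face_potential (K := ZMod 2) M.opp M.opp_opp M.face M.origin M.edge
    M.edge_opp M.edge_surjective h₀ (fun g hg v => M.face_const g hg v _)
    (fun g hg v => M.vertex_const g hg v _) (fun g v => M.fiberSum_face_origin g v)
    (by have := M.euler_card; have := M.card_eq_two_mul_card_edge; omega)
    (fun h => if h ∈ M.chosen then 1 else 0) (fun f => by
      have : fiberSum M.face (fun h => ((if h ∈ M.chosen then 1 else 0) -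
          (if M.opp h ∈ M.chosen then 1 else 0) : ZMod 2)) f = (M.faceDegree f : ZMod 2) := by
        simp only [hdiff, fiberSum, faceDegree, Nat.card_eq_fintype_card, Fintype.card_subtype,
          Finset.sum_boole]
      rw [this]
      exact (ZMod.natCast_eq_zero_iff_even).mpr (heven f))
  refine ⟨g, fun h heq => ?_⟩
  have h1 := hg h
  rw [hdiff, heq, sub_self] at h1
  exact one_ne_zero h1

/-- A function with zero sums around vertices and faces has a potential on the edges. -/
theorem exists_potential_of_sums_eq_zero (y : H → ℚ) (hy : ∀ v, fiberSum M.origin y v = 0)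
    (hy' : ∀ f, fiberSum M.face y f = 0) :
    ∃ p : H → ℚ, (∀ h, p (M.opp h) = p h) ∧ ∀ h, y h = p h - p (M.rot.symm h) := by
  obtain ⟨h₀⟩ := M.nonempty
  obtain ⟨g, hg⟩ := exists_edge_potential (K := ℚ) M.rot.symm M.origin M.face M.edge h₀
    M.origin_rot_symm
    (fun g f => M.fiberSum_face_rot_symm (fun h => g (M.edge h)) (fun h => by rw [M.edge_opp]) f)
    (fun g g' h => by
      have h1 : ∀ k, g (M.origin k) = - g' (M.face k) := fun k => eq_neg_of_add_eq_zero_left (h k)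
      have h2 : ∀ k, g (M.origin (M.opp k)) = g (M.origin k) := fun k => by
        rw [← M.origin_rot, h1, h1, M.face_rot_opp]
      have h3 : ∀ k, g' (M.face (M.opp k)) = g' (M.face k) := fun k => by
        have h4 := h1 (M.opp k)
        rw [h2, h1] at h4
        linarith
      exact ⟨fun v => M.vertex_const g h2 v _, fun f => M.face_const g' h3 f _⟩)
    (fun g hg ε => by
      obtain ⟨k, rfl⟩ := M.edge_surjective ε
      exact M.const_of_rot_of_opp (fun h => g (M.edge h))
        (fun h => by have := hg (M.rot h); rw [Equiv.symm_apply_apply] at this; exact this.symm)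
        (fun h => by rw [M.edge_opp]) k h₀)
    (by have := M.euler_card; have := M.card_eq_two_mul_card_edge; omega) y hy hy'
  exact ⟨fun h => g (M.edge h), fun h => congrArg g (M.edge_opp h), hg⟩

end Orbits

section Development

open scoped Classical

set_option linter.unusedSectionVars false

variable {H : Type*} [Fintype H] {M : PlanarMap H}

/-! ### Contours of sets of faces -/

/-- The half-edges that leave a set of faces on their right. -/
noncomputable def cut (M : PlanarMap H) (R : Set M.Face) : Finset H :=
  Finset.univ.filter fun h => M.face h ∈ R ∧ M.face (M.opp h) ∉ R

theorem mem_cut {R : Set M.Face} {h : H} :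
    h ∈ M.cut R ↔ M.face h ∈ R ∧ M.face (M.opp h) ∉ R := by simp [cut]

theorem opp_notMem_cut {R : Set M.Face} {h : H} (hh : h ∈ M.cut R) : M.opp h ∉ M.cut R :=
  fun h' => (mem_cut.mp hh).2 (mem_cut.mp h').1

/-- At a vertex incident to a face in `R` and to a face not in `R`, an arc of the boundary of `R`
starts. -/
theorem exists_mem_cut_of_origin_eq {R : Set M.Face} {a b : H} (hab : M.origin a = M.origin b)
    (ha : M.face a ∈ R) (hb : M.face b ∉ R) : ∃ k ∈ M.cut R, M.origin k = M.origin a := by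
  obtain ⟨c, h1, h2, h3⟩ := M.exists_rot_step hab (P := fun h => M.face h ∈ R) ha hb
  rw [M.face_rot] at h3
  exact ⟨c, mem_cut.mpr ⟨h2, h3⟩, h1⟩

theorem exists_cut_succ {R : Set M.Face} {h : H} (hh : h ∈ M.cut R) :
    ∃ k ∈ M.cut R, M.origin k = M.origin (M.opp h) := by
  obtain ⟨h1, h2⟩ := mem_cut.mp hh
  have h3 : M.origin (M.rot (M.opp h)) = M.origin (M.opp h) := M.origin_rot _
  obtain ⟨k, hk, hk'⟩ := exists_mem_cut_of_origin_eq (R := R) h3 (by rwa [M.face_rot_opp]) h2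
  exact ⟨k, hk, hk'.trans h3⟩

theorem cut_nonempty {R : Set M.Face} (hne : R.Nonempty) (hout : M.outer ∉ R) :
    (M.cut R).Nonempty := by
  obtain ⟨f, hf⟩ := hne
  obtain ⟨h, hh⟩ := M.exists_boundary hf hout
  exact ⟨h, mem_cut.mpr hh⟩

/-- Submodularity, which holds half-edge by half-edge. It serves to uncross two regions with short
contours. -/
theorem card_cut_union_add_card_cut_inter_le (R P : Set M.Face) :
    (M.cut (R ∪ P)).card + (M.cut (R ∩ P)).card ≤ (M.cut R).card + (M.cut P).card := by
  simp only [cut, Finset.card_filter, ← Finset.sum_add_distrib]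
  refine Finset.sum_le_sum fun h _ => ?_
  by_cases h1 : M.face h ∈ R <;> by_cases h2 : M.face h ∈ P <;>
    by_cases h3 : M.face (M.opp h) ∈ R <;> by_cases h4 : M.face (M.opp h) ∈ P <;>
    simp [h1, h2, h3, h4]

/-- The indicator function of a set of faces. -/
noncomputable def ind (R : Set M.Face) (f : M.Face) : ℚ := if f ∈ R then 1 else 0

theorem ind_of_mem {R : Set M.Face} {f : M.Face} (h : f ∈ R) : ind R f = 1 := if_pos h

theorem ind_of_notMem {R : Set M.Face} {f : M.Face} (h : f ∉ R) : ind R f = 0 := if_neg h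

theorem ind_sub_ind (R : Set M.Face) (h : H) :
    ind R (M.face h) - ind R (M.face (M.opp h)) =
      (if h ∈ M.cut R then 1 else 0) - (if M.opp h ∈ M.cut R then 1 else 0) := by
  simp only [mem_cut, M.opp_opp, ind]
  by_cases h1 : M.face h ∈ R <;> by_cases h3 : M.face (M.opp h) ∈ R <;> simp [h1, h3]

/-- The number of times that a finite sequence of half-edges goes through a given one. -/
noncomputable def passes {n : ℕ} (c : Fin n → H) (h : H) : ℚ := ∑ i, if h = c i then 1 else 0

theorem passes_of_injective {n : ℕ} {c : Fin n → H} (hc : Function.Injective c) (h : H) :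
    passes c h = if h ∈ Set.range c then 1 else 0 := by
  unfold passes
  split_ifs with hh
  · obtain ⟨i, rfl⟩ := hh
    rw [Finset.sum_eq_single i] <;> simp
    intro j hj h'
    exact hj (hc h'.symm)
  · refine Finset.sum_eq_zero fun i _ => if_neg fun h' => hh ⟨i, h'.symm⟩

theorem IsSimpleCycle.injective {n : ℕ} [NeZero n] {c : Fin n → H} (hc : M.IsSimpleCycle c) :
    Function.Injective c := fun _ _ hij => hc.vertices_distinct (congrArg M.origin hij)

/-! ### Four-cycles and quadrangular faces -/

theorem faceDegree_eq_card (f : M.Face) :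
    M.faceDegree f = (Finset.univ.filter fun h => M.face h = f).card := by
  rw [faceDegree, Nat.card_eq_fintype_card, Fintype.card_subtype]

theorem IsHexagonDissection.even_faceDegree (hD : M.IsHexagonDissection) (f : M.Face) :
    Even (M.faceDegree f) := by
  by_cases hf : f = M.outer
  · rw [hf, hD.outer_degree]; decide
  · rw [hD.inner_degree f hf]; decide

theorem IsHexagonDissection.origin_opp_ne (hD : M.IsHexagonDissection) (h : H) :
    M.origin (M.opp h) ≠ M.origin h := by
  obtain ⟨c, hc⟩ := M.exists_coloring hD.even_faceDegree
  exact fun hh => hc h (by rw [hh])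

theorem IsHexagonDissection.origin_ne_of_two_steps (hD : M.IsHexagonDissection) {h k l : H}
    (hk : M.origin k = M.origin (M.opp h)) (hl : M.origin l = M.origin (M.opp k)) :
    M.origin (M.opp l) ≠ M.origin h := by
  obtain ⟨c, hc⟩ := M.exists_coloring hD.even_faceDegree
  intro hh
  have h1 := hc h; have h2 := hc k; have h3 := hc l
  rw [hh, hl] at h3
  rw [hk] at h2
  revert h1 h2 h3
  generalize c (M.origin h) = x, c (M.origin (M.opp h)) = y, c (M.origin (M.opp k)) = w
  revert x y w
  decide

/-- A cycle of length 4 bounds a face, up to orientation. -/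
theorem IsIrreducible.exists_face_of_isSimpleCycle (hI : M.IsIrreducible)
    (hD : M.IsHexagonDissection) {c : Fin 4 → H} (hc : M.IsSimpleCycle c) :
    ∃ f, f ≠ M.outer ∧ ∃ s : ℚ, s ≠ 0 ∧ ∀ h, passes c h - passes c (M.opp h) =
      s * (ind {f} (M.face h) - ind {f} (M.face (M.opp h))) := by
  -- The four half-edges of `c` cannot account for the six of the outer face; `φ` is the identity or
  -- `opp` according to the direction of traversal.
  have hcard : ∀ f, ∀ φ : Equiv.Perm H, (∀ h, M.face h = f ↔ φ h ∈ Set.range c) → f ≠ M.outer := by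
    rintro f φ hf rfl
    have h1 := hD.outer_degree
    rw [faceDegree_eq_card] at h1
    have h2 : (Finset.univ.filter fun h => M.face h = M.outer).card ≤
        (Finset.univ.image c).card := by
      refine Finset.card_le_card_of_injOn φ (fun h hh => ?_) φ.injective.injOn
      simp only [Finset.coe_filter, Finset.mem_univ, true_and, Set.mem_ofPred_eq] at hh
      simpa using (hf h).mp hh
    have h3 : (Finset.univ.image c).card ≤ 4 := Finset.card_image_le.trans (by simp)
    omega
  obtain ⟨f, hf | hf⟩ := hI.no_separating c hc
  · refine ⟨f, hcard f 1 hf, 1, one_ne_zero, fun h => ?_⟩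
    rw [passes_of_injective hc.injective, passes_of_injective hc.injective]
    simp only [← hf, ind, Set.mem_singleton_iff, one_mul]
  · refine ⟨f, hcard f M.opp hf, -1, by norm_num, fun h => ?_⟩
    rw [passes_of_injective hc.injective, passes_of_injective hc.injective]
    have h3 := hf (M.opp h)
    rw [M.opp_opp] at h3
    simp only [← hf, ← h3, ind, Set.mem_singleton_iff]
    ring

/-- A set of faces that is bounded by a simple cycle of length 4 is a single face. -/
theorem IsIrreducible.eq_singleton (hI : M.IsIrreducible) (hD : M.IsHexagonDissection)
    {c : Fin 4 → H} (hc : M.IsSimpleCycle c) {R : Set M.Face} (hout : M.outer ∉ R)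
    (hR : ∀ h, ind R (M.face h) - ind R (M.face (M.opp h)) = passes c h - passes c (M.opp h)) :
    ∃ f, R = {f} := by
  obtain ⟨f, hf, s, hs0, hs⟩ := hI.exists_face_of_isSimpleCycle hD hc
  have h1 := M.face_const (fun g => ind R g - s * ind {f} g) (fun h => by
    have h2 := hR h
    rw [hs] at h2
    linarith)
  refine ⟨f, Set.ext fun g => ?_⟩
  have h3 := h1 g M.outer
  simp only [ind_of_notMem hout, ind_of_notMem (Set.notMem_singleton_iff.mpr hf.symm)] at h3
  by_cases hg : g ∈ R <;> by_cases hg' : g ∈ ({f} : Set M.Face)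
  · exact iff_of_true hg hg'
  · simp [ind_of_mem hg, ind_of_notMem hg'] at h3
  · simp [ind_of_notMem hg, ind_of_mem hg', hs0] at h3
  · exact iff_of_false hg hg'

/-- The cyclic structure of a face of known degree. -/
theorem iterate_next_of_faceDegree {h : H} {d : ℕ} (hd : M.faceDegree (M.face h) = d) :
    ((M.rot * M.opp) ^ d) h = h ∧
      (∀ i j, i < d → j < d → ((M.rot * M.opp) ^ i) h = ((M.rot * M.opp) ^ j) h → i = j) ∧
      ∀ k, M.face k = M.face h → ∃ i < d, k = ((M.rot * M.opp) ^ i) h := by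
  set σ := M.rot * M.opp with hσ
  have hmem : h ∈ Function.periodicPts σ := by
    refine ⟨orderOf σ, orderOf_pos σ, ?_⟩
    rw [Function.IsPeriodicPt, Function.IsFixedPt, ← Equiv.Perm.coe_pow, pow_orderOf_eq_one]
    rfl
  have hpos := Function.minimalPeriod_pos_of_mem_periodicPts hmem
  have hcyc : ∀ k, M.face k = M.face h → ∃ i < Function.minimalPeriod σ h, k = (σ ^ i) h := by
    intro k hk
    obtain ⟨n, hn⟩ := (M.face_eq_iff.mp hk.symm).exists_nat_pow_eq
    refine ⟨n % Function.minimalPeriod σ h, Nat.mod_lt _ hpos, ?_⟩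
    rw [← hn, Equiv.Perm.coe_pow, Equiv.Perm.coe_pow, Function.iterate_mod_minimalPeriod_eq]
  have hinj : ∀ i j, i < Function.minimalPeriod σ h → j < Function.minimalPeriod σ h →
      (σ ^ i) h = (σ ^ j) h → i = j := by
    intro i j hi hj hij
    rw [Equiv.Perm.coe_pow, Equiv.Perm.coe_pow] at hij
    exact Function.iterate_injOn_Iio_minimalPeriod hi hj hij
  have hface : ∀ i, M.face ((σ ^ i) h) = M.face h := by
    intro i
    induction i with
    | zero => rfl
    | succ n ih =>
      rw [pow_succ', ← ih]
      exact M.face_rot_opp _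
  have hcard : M.faceDegree (M.face h) = Function.minimalPeriod σ h := by
    rw [faceDegree_eq_card, ← Finset.card_range (Function.minimalPeriod σ h)]
    symm
    refine Finset.card_bij (fun i _ => (σ ^ i) h) ?_ ?_ ?_
    · intro i _
      simp [hface]
    · intro i hi j hj
      exact hinj i j (Finset.mem_range.mp hi) (Finset.mem_range.mp hj)
    · intro k hk
      obtain ⟨i, hi, rfl⟩ := hcyc k (by simpa using hk)
      exact ⟨i, Finset.mem_range.mpr hi, rfl⟩
  rw [hd] at hcard
  subst hcard
  exact ⟨by rw [Equiv.Perm.coe_pow]; exact Function.iterate_minimalPeriod, hinj, hcyc⟩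

theorem IsHexagonDissection.quad (hD : M.IsHexagonDissection) {h : H} (hh : M.face h ≠ M.outer) :
    ∃ k₁ k₂ k₃ : H, k₁ = M.rot (M.opp h) ∧ k₂ = M.rot (M.opp k₁) ∧ k₃ = M.rot (M.opp k₂) ∧
      h = M.rot (M.opp k₃) ∧ h ≠ k₁ ∧ h ≠ k₂ ∧ h ≠ k₃ ∧ k₁ ≠ k₂ ∧ k₁ ≠ k₃ ∧ k₂ ≠ k₃ ∧
      ∀ k, M.face k = M.face h ↔ k = h ∨ k = k₁ ∨ k = k₂ ∨ k = k₃ := by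
  obtain ⟨h1, h2, h3⟩ := iterate_next_of_faceDegree (hD.inner_degree _ hh)
  have e1 : ((M.rot * M.opp) ^ 1) h = M.rot (M.opp h) := rfl
  have e2 : ((M.rot * M.opp) ^ 2) h = M.rot (M.opp (M.rot (M.opp h))) := rfl
  have e3 : ((M.rot * M.opp) ^ 3) h = M.rot (M.opp (M.rot (M.opp (M.rot (M.opp h))))) := rfl
  have ne : ∀ i j, i < 4 → j < 4 → i ≠ j →
      ((M.rot * M.opp) ^ i) h ≠ ((M.rot * M.opp) ^ j) h := fun i j hi hj hij hh =>
    hij (h2 i j hi hj hh)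
  refine ⟨_, _, _, rfl, rfl, rfl, ?_, ?_, ?_, ?_, ?_, ?_, ?_, fun k => ⟨fun hk => ?_, ?_⟩⟩
  · exact h1.symm
  · exact ne 0 1 (by omega) (by omega) (by omega)
  · exact ne 0 2 (by omega) (by omega) (by omega)
  · exact ne 0 3 (by omega) (by omega) (by omega)
  · exact ne 1 2 (by omega) (by omega) (by omega)
  · exact ne 1 3 (by omega) (by omega) (by omega)
  · exact ne 2 3 (by omega) (by omega) (by omega)
  · obtain ⟨i, hi, rfl⟩ := h3 k hk
    interval_cases i
    · exact Or.inl rfl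
    · exact Or.inr (Or.inl rfl)
    · exact Or.inr (Or.inr (Or.inl rfl))
    · exact Or.inr (Or.inr (Or.inr rfl))
  · rintro (rfl | rfl | rfl | rfl) <;> simp only [M.face_rot_opp]

/-! ### Short contours in an irreducible dissection -/

/-- A function on faces that changes only across two edges has small level sets. -/
theorem card_cut_le_two_of_support {φ : M.Face → ℚ} {a b : H}
    (hφ : ∀ h, φ (M.face h) ≠ φ (M.face (M.opp h)) →
      h = a ∨ h = M.opp a ∨ h = b ∨ h = M.opp b) (P : ℚ → Prop) :
    (M.cut {f | P (φ f)}).card ≤ 2 := by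
  have hsub : M.cut {f | P (φ f)} ⊆ {if a ∈ M.cut {f | P (φ f)} then a else M.opp a,
      if b ∈ M.cut {f | P (φ f)} then b else M.opp b} := by
    intro h hh
    have h1 : φ (M.face h) ≠ φ (M.face (M.opp h)) := fun heq => by
      have h2 := mem_cut.mp hh
      simp only [Set.mem_ofPred_eq, heq] at h2
      exact h2.2 h2.1
    have key : ∀ a, h = M.opp a → a ∉ M.cut {f | P (φ f)} := by
      rintro a rfl ha
      exact opp_notMem_cut ha hh
    rw [Finset.mem_insert, Finset.mem_singleton]
    rcases hφ h h1 with rfl | h2 | rfl | h2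
    · left; rw [if_pos hh]
    · left; rw [if_neg (key a h2)]; exact h2
    · right; rw [if_pos hh]
    · right; rw [if_neg (key b h2)]; exact h2
  exact (Finset.card_le_card hsub).trans Finset.card_le_two

theorem isSimpleCycle_of_four (hD : M.IsHexagonDissection) {a b c d : H}
    (hab : M.origin (M.opp a) = M.origin b) (hbc : M.origin (M.opp b) = M.origin c)
    (hcd : M.origin (M.opp c) = M.origin d) (hda : M.origin (M.opp d) = M.origin a)
    (hac : M.origin a ≠ M.origin c) (hbd : M.origin b ≠ M.origin d) :
    M.IsSimpleCycle ![a, b, c, d] := by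
  have n1 : M.origin b ≠ M.origin a := hab ▸ hD.origin_opp_ne a
  have n2 : M.origin c ≠ M.origin b := hbc ▸ hD.origin_opp_ne b
  have n3 : M.origin d ≠ M.origin c := hcd ▸ hD.origin_opp_ne c
  have n4 : M.origin a ≠ M.origin d := hda ▸ hD.origin_opp_ne d
  have chain : ∀ i, M.origin (M.opp (![a, b, c, d] i)) = M.origin (![a, b, c, d] (i + 1)) := by
    intro i
    fin_cases i
    · exact hab
    · exact hbc
    · exact hcd
    · exact hda
  have inj : Function.Injective fun i => M.origin (![a, b, c, d] i) := by
    intro i j hij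
    fin_cases i <;> fin_cases j <;> 
      first
      | rfl
      | (exfalso; revert hij
         simp [n1, n2, n3, n4, hac, hbd, n1.symm, n2.symm, n3.symm, n4.symm, hac.symm, hbd.symm])
  -- Two opposite half-edges in the cycle would give `j = i + 1` and `i = j + 1`, impossible modulo
  -- four.
  refine ⟨chain, inj, fun i j hij => ?_⟩
  have h1 : j = i + 1 := inj (by
    change M.origin (![a, b, c, d] j) = M.origin (![a, b, c, d] (i + 1))
    rw [hij, chain])
  have h2 : i = j + 1 := inj (by
    change M.origin (![a, b, c, d] i) = M.origin (![a, b, c, d] (j + 1))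
    rw [← chain, hij, M.opp_opp])
  rw [h1] at h2
  revert h2
  fin_cases i <;> decide

theorem passes_four (a b c d h : H) : passes ![a, b, c, d] h =
    (if h = a then 1 else 0) + (if h = b then 1 else 0) + (if h = c then 1 else 0) +
      (if h = d then 1 else 0) := by
  rw [passes, Fin.sum_univ_four]
  rfl

theorem fiberSum_two_cycle {a b : H} (hab : M.origin (M.opp a) = M.origin b)
    (hba : M.origin (M.opp b) = M.origin a) (v : M.Vertex) :
    fiberSum M.origin (fun h => ((if h = a then 1 else 0) + (if h = b then 1 else 0) : ℚ) -
      ((if M.opp h = a then 1 else 0) + (if M.opp h = b then 1 else 0))) v = 0 := by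
  simp only [M.opp_eq_iff]
  rw [fiberSum_sub, fiberSum_add, fiberSum_add, fiberSum_single, fiberSum_single, fiberSum_single,
    fiberSum_single, hab, hba]
  ring

/-- Adding to `R` the face across `h₁` replaces `h₁` by the three other sides of that face and
leaves a closed walk of length four. If the walk is a simple cycle, irreducibility allows a single
face inside, but both sides of `h₁` are there. If it is pinched, it splits into two closed walks of
length two, and `hmax` prevents either from enclosing the added face. -/
theorem false_of_maximal_two_cut (hD : M.IsHexagonDissection) (hI : M.IsIrreducible)
    {R : Set M.Face} (hout : M.outer ∉ R) {h₁ h₂ : H} (hne : h₁ ≠ h₂)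
    (hcut : ∀ h, h ∈ M.cut R ↔ h = h₁ ∨ h = h₂)
    (h12 : M.origin (M.opp h₁) = M.origin h₂) (h21 : M.origin (M.opp h₂) = M.origin h₁)
    (hmax : ∀ P : Set M.Face, M.outer ∉ P → (M.cut P).card ≤ 2 → (P ∩ R).Nonempty → P ⊆ R)
    (hf : M.face (M.opp h₁) ≠ M.outer) : False := by
  have hm1 := mem_cut.mp ((hcut h₁).mpr (Or.inl rfl))
  have hm2 := mem_cut.mp ((hcut h₂).mpr (Or.inr rfl))
  obtain ⟨k₁, k₂, k₃, e1, e2, e3, e0, n01, n02, n03, n12, n13, n23, hk⟩ := hD.quad hf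
  rw [M.opp_opp] at e1
  have fk1 : M.face k₁ = M.face (M.opp h₁) := (hk k₁).mpr (by simp)
  have o1 : M.origin k₁ = M.origin h₁ := by rw [e1, M.origin_rot]
  have o2 : M.origin k₂ = M.origin (M.opp k₁) := by rw [e2, M.origin_rot]
  have o3 : M.origin k₃ = M.origin (M.opp k₂) := by rw [e3, M.origin_rot]
  have o0 : M.origin h₂ = M.origin (M.opp k₃) := by rw [← h12, e0, M.origin_rot]
  set R₁ : Set M.Face := R ∪ {M.face (M.opp h₁)} with hR₁
  have hout1 : M.outer ∉ R₁ := by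
    rintro (h | h)
    · exact hout h
    · exact hf h.symm
  have hind : ∀ g, ind R₁ g = ind R g + ind {M.face (M.opp h₁)} g := by
    intro g
    by_cases hg : g = M.face (M.opp h₁)
    · subst hg
      simp [ind, hR₁, hm1.2]
    · simp [ind, hR₁, hg]
  have hδ : ∀ h, ind R₁ (M.face h) - ind R₁ (M.face (M.opp h)) =
      passes ![h₂, k₁, k₂, k₃] h - passes ![h₂, k₁, k₂, k₃] (M.opp h) := by
    intro h
    have h1 := ind_sub_ind R h
    simp only [hcut] at h1
    have h2 : ∀ h, ind {M.face (M.opp h₁)} (M.face h) = (if h = M.opp h₁ then 1 else 0) +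
        (if h = k₁ then 1 else 0) + (if h = k₂ then 1 else 0) + (if h = k₃ then (1 : ℚ) else 0) := by
      intro h
      simp only [ind, Set.mem_singleton_iff, hk]
      by_cases a0 : h = M.opp h₁
      · subst a0; simp [n01, n02, n03]
      by_cases a1 : h = k₁
      · subst a1; simp [n01.symm, n12, n13]
      by_cases a2 : h = k₂
      · subst a2; simp [n02.symm, n12.symm, n23]
      simp [a0, a1, a2]
    have h3 : ∀ h, (if h = h₁ ∨ h = h₂ then (1 : ℚ) else 0) =
        (if h = h₁ then 1 else 0) + (if h = h₂ then 1 else 0) := by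
      intro h
      by_cases a0 : h = h₁
      · subst a0; simp [hne]
      · simp [a0]
    have h4 : (if M.opp h = M.opp h₁ then (1 : ℚ) else 0) = if h = h₁ then 1 else 0 := by
      simp only [M.opp_injective.eq_iff]
    have h5 : (if M.opp h = h₁ then (1 : ℚ) else 0) = if h = M.opp h₁ then 1 else 0 := by
      simp only [M.opp_eq_iff]
    rw [h3, h3] at h1
    rw [hind, hind, h2, h2, passes_four, passes_four]
    linarith
  -- a function that changes only across two edges, other than that of `h₁`, vanishes there
  have hsmall : ∀ (φ : M.Face → ℚ) (a b : H), φ M.outer = 0 →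
      (∀ h, φ (M.face h) ≠ φ (M.face (M.opp h)) → h = a ∨ h = M.opp a ∨ h = b ∨ h = M.opp b) →
      φ (M.face h₁) = φ (M.face (M.opp h₁)) → φ (M.face (M.opp h₁)) = 0 := by
    intro φ a b hφ0 hφ heq
    rcases lt_trichotomy (φ (M.face (M.opp h₁))) 0 with hlt | h0 | hgt
    · exfalso
      refine hm1.2 (hmax {f | φ f < 0} (by simp [hφ0])
        (card_cut_le_two_of_support hφ (fun q => q < 0)) ⟨M.face h₁, ?_, hm1.1⟩ hlt)
      change φ (M.face h₁) < 0
      rwa [heq]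
    · exact h0
    · exfalso
      refine hm1.2 (hmax {f | 0 < φ f} (by simp [hφ0])
        (card_cut_le_two_of_support hφ (fun q => 0 < q)) ⟨M.face h₁, ?_, hm1.1⟩ hgt)
      change 0 < φ (M.face h₁)
      rwa [heq]
  have n1k1 : h₁ ≠ k₁ := fun h => hm1.2 (by rw [← fk1, ← h]; exact hm1.1)
  have n1k2 : h₁ ≠ k₂ := fun h => hm1.2 (by
    rw [← (hk k₂).mpr (by simp), ← h]; exact hm1.1)
  have n1k3 : h₁ ≠ k₃ := fun h => hm1.2 (by
    rw [← (hk k₃).mpr (by simp), ← h]; exact hm1.1)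
  have n1h2 : M.opp h₁ ≠ h₂ := fun h => hm1.2 (by rw [h]; exact hm2.1)
  -- a decomposition of the boundary of `R₁` into two closed walks of length two is impossible
  have hsplit : ∀ a b c d : H, M.origin (M.opp a) = M.origin b → M.origin (M.opp b) = M.origin a →
      (∀ h, passes ![h₂, k₁, k₂, k₃] h = passes ![a, b, c, d] h) → False := by
    intro a b c d hab hba hp
    obtain ⟨φ, hφ0, hφ⟩ := M.exists_potential_of_boundary_eq_zero (K := ℚ)
      (fun h => (if h = a then 1 else 0) + (if h = b then 1 else 0)) (fiberSum_two_cycle hab hba)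
    have hz : ∀ h, h = h₁ ∨ h = M.opp h₁ → h ≠ a ∧ h ≠ b ∧ h ≠ c ∧ h ≠ d := by
      intro h hh
      have h1 := hp h
      have h2 : passes ![h₂, k₁, k₂, k₃] h = 0 := by
        rw [passes_four]
        rcases hh with rfl | rfl
        · simp [hne, n1k1, n1k2, n1k3]
        · simp [n1h2, n01, n02, n03]
      rw [h2, passes_four] at h1
      refine ⟨?_, ?_, ?_, ?_⟩ <;>
      · intro hh
        rw [if_pos hh] at h1
        have p1 : ∀ x y : H, (0 : ℚ) ≤ if x = y then 1 else 0 := fun x y => by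
          split_ifs <;> norm_num
        linarith [p1 h a, p1 h b, p1 h c, p1 h d]
    obtain ⟨ha, hb, hc, hd⟩ := hz h₁ (Or.inl rfl)
    obtain ⟨ha', hb', hc', hd'⟩ := hz (M.opp h₁) (Or.inr rfl)
    have h1 : φ (M.face (M.opp h₁)) = 0 := by
      refine hsmall φ a b hφ0 (fun h hh => ?_) ?_
      · by_contra hcon
        push Not at hcon
        have h2 := hφ h
        have h3 : M.opp h ≠ a := fun h' => hcon.2.1 (M.opp_eq_iff.mp h')
        have h4 : M.opp h ≠ b := fun h' => hcon.2.2.2 (M.opp_eq_iff.mp h')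
        simp only [hcon.1, hcon.2.2.1, h3, h4, if_false] at h2
        exact hh (by linarith)
      · have h2 := hφ h₁
        simp only [ha, hb, ha', hb', if_false] at h2
        linarith
    -- The indicator of `R₁` minus `φ` is a potential of the other closed walk. Both potentials
    -- vanish at the added face, where their sum is 1.
    have hφ' : ∀ h, (ind R₁ (M.face h) - φ (M.face h)) -
        (ind R₁ (M.face (M.opp h)) - φ (M.face (M.opp h))) =
        ((if h = c then 1 else 0) + (if h = d then 1 else 0)) -
        ((if M.opp h = c then 1 else 0) + (if M.opp h = d then 1 else 0)) := by
      intro h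
      have h2 := hδ h
      rw [hp, hp, passes_four, passes_four] at h2
      have h3 := hφ h
      linarith
    have h2 : ind R₁ (M.face (M.opp h₁)) - φ (M.face (M.opp h₁)) = 0 := by
      refine hsmall (fun f => ind R₁ f - φ f) c d ?_ (fun h hh => ?_) ?_
      · simp only [hφ0, ind_of_notMem hout1, sub_self]
      · by_contra hcon
        push Not at hcon
        have h2 := hφ' h
        have h3 : M.opp h ≠ c := fun h' => hcon.2.1 (M.opp_eq_iff.mp h')
        have h4 : M.opp h ≠ d := fun h' => hcon.2.2.2 (M.opp_eq_iff.mp h')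
        simp only [hcon.1, hcon.2.2.1, h3, h4, if_false] at h2
        exact hh (by linarith)
      · have h2 := hφ' h₁
        simp only [hc, hd, hc', hd', if_false] at h2
        linarith
    rw [h1, ind_of_mem (Or.inr rfl)] at h2
    norm_num at h2
  by_cases hx : M.origin k₂ = M.origin h₂
  · exact hsplit h₂ k₁ k₂ k₃ (h21.trans o1.symm) (by rw [← o2, hx]) (fun _ => rfl)
  by_cases hy : M.origin k₃ = M.origin k₁
  · refine hsplit h₂ k₃ k₁ k₂ (by rw [h21, hy, o1]) o0.symm (fun h => ?_)
    rw [passes_four, passes_four]; ring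
  obtain ⟨f, hf'⟩ := hI.eq_singleton hD (isSimpleCycle_of_four hD (h21.trans o1.symm) o2.symm
    o3.symm o0.symm (Ne.symm hx) (Ne.symm hy)) hout1 hδ
  have a1 : M.face h₁ ∈ R₁ := Or.inl hm1.1
  have a2 : M.face (M.opp h₁) ∈ R₁ := Or.inr rfl
  rw [hf'] at a1 a2
  exact hm1.2 (by rw [Set.mem_singleton_iff.mp a2, ← Set.mem_singleton_iff.mp a1]; exact hm1.1)

/-- The boundary of a set of inner faces has more than two edges. -/
theorem two_lt_card_cut (hD : M.IsHexagonDissection) (hI : M.IsIrreducible)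
    {R : Set M.Face} (hne : R.Nonempty) (hout : M.outer ∉ R) : 2 < (M.cut R).card := by
  by_contra hcon
  push Not at hcon
  obtain ⟨R₁, hR₁⟩ := (Set.toFinite {R : Set M.Face | R.Nonempty ∧ M.outer ∉ R ∧
    (M.cut R).card ≤ 2}).exists_maximal ⟨R, hne, hout, hcon⟩
  clear hcon hout hne R
  obtain ⟨⟨hne, hout, hcard⟩, hmax'⟩ := hR₁
  generalize R₁ = R at *
  have hmax : ∀ P : Set M.Face, M.outer ∉ P → (M.cut P).card ≤ 2 → (P ∩ R).Nonempty → P ⊆ R := by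
    intro P hP hPc hPR
    by_contra hsub
    -- By maximality the union has at least three boundary arcs, so the intersection has at most
    -- one, which would be a loop.
    have h1 : ¬ (M.cut (R ∪ P)).card ≤ 2 := fun h1 =>
      hsub (Set.subset_union_right.trans (hmax' (y := R ∪ P)
        ⟨hne.mono Set.subset_union_left, fun h => h.elim hout hP, h1⟩ Set.subset_union_left))
    have h2 := card_cut_union_add_card_cut_inter_le R P
    have h3 : (M.cut (R ∩ P)).card ≤ 1 := by omega
    obtain ⟨h, hh⟩ := cut_nonempty (R := R ∩ P) (by rwa [Set.inter_comm]) (fun h => hout h.1)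
    obtain ⟨k, hk, hk'⟩ := exists_cut_succ hh
    rw [Finset.card_le_one.mp h3 k hk h hh] at hk'
    exact hD.origin_opp_ne h hk'.symm
  obtain ⟨h₁, hh₁⟩ := cut_nonempty hne hout
  obtain ⟨h₂, hh₂, h12⟩ := exists_cut_succ hh₁
  have hne12 : h₁ ≠ h₂ := fun h => hD.origin_opp_ne h₁ (by rw [← h12, h])
  have hcut : ∀ h, h ∈ M.cut R ↔ h = h₁ ∨ h = h₂ := by
    have h1 : ({h₁, h₂} : Finset H) = M.cut R := Finset.eq_of_subset_of_card_le
      (by simp [Finset.insert_subset_iff, hh₁, hh₂]) (by rwa [Finset.card_pair hne12])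
    intro h
    simp [← h1]
  obtain ⟨h₃, hh₃, h21⟩ := exists_cut_succ hh₂
  have h3 : h₃ = h₁ := ((hcut h₃).mp hh₃).resolve_right fun h =>
    hD.origin_opp_ne h₂ (by rw [← h21, h])
  rw [h3] at h21
  by_cases hf : M.face (M.opp h₁) = M.outer
  · by_cases hf' : M.face (M.opp h₂) = M.outer
    -- When both arcs border the outer face, the outer contour closes up after two steps.
    · have r1 : M.rot h₁ = M.opp h₂ := hD.outer_simple _ _ (by rw [M.face_rot, hf]) hf'
        (by rw [M.origin_rot, h21])
      have r2 : M.rot h₂ = M.opp h₁ := hD.outer_simple _ _ (by rw [M.face_rot, hf']) hf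
        (by rw [M.origin_rot, h12])
      have hsub : (Finset.univ.filter fun h => M.face h = M.outer) ⊆ {M.opp h₁, M.opp h₂} := by
        intro h hh
        by_contra hcon
        obtain ⟨c, hc, hc1, hc2⟩ := M.exists_face_step (a := M.opp h₁) (b := h)
          (P := fun h => h ∈ ({M.opp h₁, M.opp h₂} : Finset H))
          (by rw [hf]; simpa using (Finset.mem_filter.mp hh).2.symm) (by simp) hcon
        apply hc2
        rcases Finset.mem_insert.mp hc1 with rfl | hc1
        · simp [M.opp_opp, r1]
        · rw [Finset.mem_singleton.mp hc1]
          simp [M.opp_opp, r2]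
      have h1 := hD.outer_degree
      rw [faceDegree_eq_card] at h1
      have h2 := (Finset.card_le_card hsub).trans Finset.card_le_two
      omega
    · exact false_of_maximal_two_cut hD hI hout hne12.symm (fun h => by rw [hcut, or_comm])
        h21.symm h12.symm hmax hf'
  · exact false_of_maximal_two_cut hD hI hout hne12 hcut h12.symm h21.symm hmax hf

/-- There are no multiple edges. -/
theorem eq_of_parallel (hD : M.IsHexagonDissection) (hI : M.IsIrreducible) {a b : H}
    (ho : M.origin a = M.origin b) (ho' : M.origin (M.opp a) = M.origin (M.opp b)) : a = b := by
  by_contra hne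
  obtain ⟨φ, hφ0, hφ⟩ := M.exists_potential_of_boundary_eq_zero (K := ℚ)
    (fun h => (if h = a then 1 else 0) + (if h = M.opp b then 1 else 0))
    (fiberSum_two_cycle ho' (by rw [M.opp_opp, ho]))
  have hsupp : ∀ h, φ (M.face h) ≠ φ (M.face (M.opp h)) →
      h = a ∨ h = M.opp a ∨ h = M.opp b ∨ h = M.opp (M.opp b) := by
    intro h hh
    by_contra hcon
    push Not at hcon
    have h2 := hφ h
    have h3 : M.opp h ≠ a := fun h' => hcon.2.1 (M.opp_eq_iff.mp h')
    have h4 : M.opp h ≠ M.opp b := fun h' => hcon.2.2.2 (M.opp_eq_iff.mp h')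
    simp only [hcon.1, hcon.2.2.1, h3, h4, if_false] at h2
    exact hh (by linarith)
  have h0 : ∀ f, φ f = 0 := by
    intro f
    rcases lt_trichotomy (φ f) 0 with hlt | h0 | hgt
    · exact absurd (card_cut_le_two_of_support hsupp (fun q => q < 0))
        (not_le.mpr (two_lt_card_cut hD hI ⟨f, hlt⟩ (by simp [hφ0])))
    · exact h0
    · exact absurd (card_cut_le_two_of_support hsupp (fun q => 0 < q))
        (not_le.mpr (two_lt_card_cut hD hI ⟨f, hgt⟩ (by simp [hφ0])))
  have h1 := hφ a
  have h2 : a ≠ M.opp b := fun h => hD.origin_opp_ne b (by rw [← h, ho])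
  simp only [h0, if_true, h2, if_false, M.opp_ne a, M.opp_injective.eq_iff, hne] at h1
  norm_num at h1

/-- A set of inner faces whose boundary has at most four edges is a single face. -/
theorem eq_singleton_of_card_cut_le_four (hD : M.IsHexagonDissection) (hI : M.IsIrreducible)
    {R : Set M.Face} (hne : R.Nonempty) (hout : M.outer ∉ R) (hcard : (M.cut R).card ≤ 4) :
    ∃ f, R = {f} := by
  obtain ⟨a, ha⟩ := cut_nonempty hne hout
  obtain ⟨b, hb, hab⟩ := exists_cut_succ ha
  obtain ⟨c, hc, hbc⟩ := exists_cut_succ hb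
  obtain ⟨d, hd, hcd⟩ := exists_cut_succ hc
  obtain ⟨e, he, hde⟩ := exists_cut_succ hd
  -- In the absence of parallel edges, two successive arcs that return to their start are the two
  -- halves of one edge, which cannot both leave `R`.
  have two : ∀ {h k l : H}, h ∈ M.cut R → k ∈ M.cut R → M.origin k = M.origin (M.opp h) →
      M.origin l = M.origin (M.opp k) → M.origin l ≠ M.origin h := by
    intro h k l hh hk h1 h2 h3
    have : k = M.opp h := eq_of_parallel hD hI h1 (by rw [← h2, h3, M.opp_opp])
    exact opp_notMem_cut hh (this ▸ hk)
  have nac := two ha hb hab hbc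
  have nbd := two hb hc hbc hcd
  have nce := two hc hd hcd hde
  have nab : M.origin b ≠ M.origin a := hab ▸ hD.origin_opp_ne a
  have nbc : M.origin c ≠ M.origin b := hbc ▸ hD.origin_opp_ne b
  have ncd : M.origin d ≠ M.origin c := hcd ▸ hD.origin_opp_ne c
  have nde : M.origin e ≠ M.origin d := hde ▸ hD.origin_opp_ne d
  have nad : M.origin d ≠ M.origin a := hcd ▸ hD.origin_ne_of_two_steps hab hbc
  have nbe : M.origin e ≠ M.origin b := hde ▸ hD.origin_ne_of_two_steps hbc hcd
  have ne : ∀ {x y : H}, M.origin x ≠ M.origin y → x ≠ y := fun h h' => h (congrArg _ h')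
  have hset : ({a, b, c, d} : Finset H) = M.cut R := by
    refine Finset.eq_of_subset_of_card_le (by simp [Finset.insert_subset_iff, ha, hb, hc, hd]) ?_
    rw [Finset.card_insert_of_notMem, Finset.card_insert_of_notMem, Finset.card_pair]
    · exact hcard
    · exact (ne ncd).symm
    · simp [(ne nbc).symm, (ne nbd).symm]
    · simp [(ne nab).symm, (ne nac).symm, (ne nad).symm]
  -- The four arcs exhaust the contour, so the fifth repeats one of them; comparing origins leaves
  -- only `a`.
  have hea : e = a := by
    have h1 : e ∈ ({a, b, c, d} : Finset H) := hset ▸ he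
    simpa [ne nbe, ne nce, ne nde] using h1
  rw [hea] at hde
  have hcyc := isSimpleCycle_of_four hD hab.symm hbc.symm hcd.symm hde.symm nac.symm nbd.symm
  refine hI.eq_singleton hD hcyc hout fun h => ?_
  rw [ind_sub_ind, passes_of_injective hcyc.injective, passes_of_injective hcyc.injective]
  have h1 : ∀ h, h ∈ M.cut R ↔ h ∈ Set.range ![a, b, c, d] := by
    intro h
    rw [← hset]
    simp only [Finset.mem_insert, Finset.mem_singleton, Set.mem_range, Fin.exists_fin_succ,
      Matrix.cons_val_zero, Matrix.cons_val_succ, eq_comm]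
    simp
  simp only [h1]

/-! ### Around the outer hexagon -/

theorem six_le_card_of_closed (hD : M.IsHexagonDissection) {A : Finset H} {a : H} (ha : a ∈ A)
    (haf : M.face a = M.outer) (hA : ∀ h ∈ A, M.rot (M.opp h) ∈ A) : 6 ≤ A.card := by
  rw [← hD.outer_degree, faceDegree_eq_card]
  refine Finset.card_le_card fun h hh => ?_
  by_contra hcon
  obtain ⟨c, _, hc1, hc2⟩ := M.exists_face_step (a := a) (b := h) (P := fun h => h ∈ A)
    (by rw [haf]; simpa using (Finset.mem_filter.mp hh).2.symm) ha hcon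
  exact hc2 (hA c hc1)

/-- Otherwise `outer_simple` makes both ends of the edge have degree one, and the outer contour
would be reduced to this edge. -/
theorem face_opp_ne_outer (hD : M.IsHexagonDissection) {h : H} (hh : M.face h = M.outer) :
    M.face (M.opp h) ≠ M.outer := by
  intro hh'
  have h1 : M.rot (M.opp h) = M.opp h :=
    hD.outer_simple _ _ (by rw [M.face_rot_opp, hh]) hh' (M.origin_rot _)
  have h2 : M.rot h = h := hD.outer_simple _ _ (by rw [M.face_rot, hh']) hh (M.origin_rot _)
  have h3 := six_le_card_of_closed hD (A := {h, M.opp h}) (a := h) (by simp) hh (by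
    intro k hk
    rcases Finset.mem_insert.mp hk with rfl | hk
    · simp [h1]
    · rw [Finset.mem_singleton.mp hk, M.opp_opp, h2]; simp)
  have h4 : ({h, M.opp h} : Finset H).card ≤ 2 := Finset.card_le_two
  omega

theorem isOuterVertex_of_face {h : H} (hh : M.face h = M.outer) : M.IsOuterVertex (M.origin h) :=
  ⟨h, rfl, hh⟩

theorem isOuterVertex_of_face_opp {h : H} (hh : M.face (M.opp h) = M.outer) :
    M.IsOuterVertex (M.origin h) := ⟨M.rot h, M.origin_rot h, by rw [M.face_rot, hh]⟩

theorem isInner_of_not_isOuterVertex {h : H} (hh : ¬ M.IsOuterVertex (M.origin h)) :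
    M.IsInner h :=
  ⟨fun h' => hh (isOuterVertex_of_face h'), fun h' => hh (isOuterVertex_of_face_opp h')⟩

/-- A face that meets the outer boundary has an inner half-edge attached to it. -/
theorem exists_isInner_of_isOuterVertex (hD : M.IsHexagonDissection) {h : H}
    (hf : M.face h ≠ M.outer) (hh : M.IsOuterVertex (M.origin h)) :
    ∃ k, M.face k = M.face h ∧ M.IsInner k ∧ M.IsOuterVertex (M.origin k) := by
  by_contra hcon
  push Not at hcon
  have key : ∀ k, M.face k = M.face h → M.IsOuterVertex (M.origin k) →
      M.face (M.opp k) = M.outer := by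
    intro k hk hk'
    by_contra h'
    exact hcon k hk ⟨hk ▸ hf, h'⟩ hk'
  have hall : ∀ k, M.face k = M.face h → M.face (M.opp k) = M.outer := by
    intro k hk
    refine key k hk ?_
    by_contra h'
    obtain ⟨c, hc1, hc2, hc3⟩ := M.exists_face_step (P := fun k => M.IsOuterVertex (M.origin k))
      hk.symm hh h'
    refine hc3 ?_
    rw [M.origin_rot]
    exact isOuterVertex_of_face (key c hc1 hc2)
  -- Every side of the face borders the outer one, and `outer_simple` makes the reverses of its four
  -- sides closed under the outer contour, which has length six.
  have h1 := six_le_card_of_closed hD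
    (A := (Finset.univ.filter fun k => M.face k = M.face h).image M.opp) (a := M.opp h)
    (Finset.mem_image_of_mem _ (by simp)) (hall h rfl) (by
      intro g hg
      obtain ⟨k, hk, rfl⟩ := Finset.mem_image.mp hg
      have hk' : M.face k = M.face h := by simpa using hk
      have h2 : M.face (M.opp (M.rot.symm k)) = M.face h := by rw [M.face_opp_rot_symm, hk']
      have h3 : M.rot k = M.rot.symm k := hD.outer_simple _ _ (by rw [M.face_rot, hall k hk'])
        (by have := hall _ h2; rwa [M.opp_opp] at this)
        (by rw [M.origin_rot, M.origin_rot_symm])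
      rw [M.opp_opp, h3]
      exact Finset.mem_image.mpr ⟨_, by simpa using h2, M.opp_opp _⟩)
  have h2 : ((Finset.univ.filter fun k => M.face k = M.face h).image M.opp).card ≤ 4 := by
    refine Finset.card_image_le.trans ?_
    rw [← faceDegree_eq_card, hD.inner_degree _ hf]
  omega

/-- No inner edge joins two outer vertices. -/
theorem not_isOuterVertex_opp (hD : M.IsHexagonDissection) (hI : M.IsIrreducible) {h : H}
    (hin : M.IsInner h) (hh : M.IsOuterVertex (M.origin h)) :
    ¬ M.IsOuterVertex (M.origin (M.opp h)) := by
  rintro ⟨b, hb, hbf⟩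
  obtain ⟨a, ha, haf⟩ := hh
  obtain ⟨p1, p2, p3⟩ := iterate_next_of_faceDegree (h := a) (d := 6) (by rw [haf]; exact hD.outer_degree)
  set σ := M.rot * M.opp with hσ
  have hface : ∀ i, M.face ((σ ^ i) a) = M.outer := by
    intro i
    induction i with
    | zero => exact haf
    | succ n ih =>
      rw [pow_succ', ← ih]
      exact M.face_rot_opp _
  have hstep : ∀ i, M.origin (M.opp ((σ ^ i) a)) = M.origin ((σ ^ (i + 1)) a) := by
    intro i
    rw [pow_succ', ← M.origin_rot]
    rfl
  have hne : ∀ i j, i < 6 → j < 6 → i ≠ j → M.origin ((σ ^ i) a) ≠ M.origin ((σ ^ j) a) :=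
    fun i j hi hj hij h' => hij (p2 i j hi hj (hD.outer_simple _ _ (hface i) (hface j) h'))
  have h6 : M.origin ((σ ^ 6) a) = M.origin h := by rw [p1, ha]
  have h0 : M.origin ((σ ^ 0) a) = M.origin h := ha
  obtain ⟨j, hj, rfl⟩ := p3 b (by rw [hbf, haf])
  -- `j` is the distance along the hexagon between the ends of the chord. Even values contradict the
  -- two-colouring, 1 and 5 give a parallel edge. For 3 the chord cuts the hexagon into two
  -- quadrangles, which are faces and would be the only ones besides the outer face.
  interval_cases j
  · exact hD.origin_opp_ne h (by rw [← hb, h0])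
  · have h1 : h = (σ ^ 0) a := eq_of_parallel hD hI h0.symm (by rw [hstep, hb])
    exact hin.1 (by rw [h1, hface])
  · refine hD.origin_ne_of_two_steps (h := (σ ^ 0) a) (k := (σ ^ 1) a) (l := M.opp h)
      (hstep 0).symm ?_ ?_
    · rw [hstep 1, ← hb]
    · rw [M.opp_opp, h0]
  · have c1 := isSimpleCycle_of_four hD (a := (σ ^ 0) a) (b := (σ ^ 1) a) (c := (σ ^ 2) a)
      (d := M.opp h) (hstep 0) (hstep 1) (by rw [hstep 2, hb]) (by rw [M.opp_opp, h0])
      (hne 0 2 (by omega) (by omega) (by omega)) 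
      (by rw [← hb]; exact hne 1 3 (by omega) (by omega) (by omega))
    have c2 := isSimpleCycle_of_four hD (a := (σ ^ 3) a) (b := (σ ^ 4) a) (c := (σ ^ 5) a)
      (d := h) (hstep 3) (hstep 4) (by rw [hstep 5, h6]) (by rw [hb])
      (hne 3 5 (by omega) (by omega) (by omega)) 
      (by rw [← h0]; exact hne 4 0 (by omega) (by omega) (by omega))
    obtain ⟨f, hf, s, _, hs⟩ := hI.exists_face_of_isSimpleCycle hD c1
    obtain ⟨f', hf', s', _, hs'⟩ := hI.exists_face_of_isSimpleCycle hD c2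
    have hout : ∀ k, ind {M.outer} (M.face k) = (if k = (σ ^ 0) a then 1 else 0) +
        (if k = (σ ^ 1) a then 1 else 0) + (if k = (σ ^ 2) a then 1 else 0) +
        (if k = (σ ^ 3) a then 1 else 0) + (if k = (σ ^ 4) a then 1 else 0) +
        (if k = (σ ^ 5) a then 1 else 0) := by
      intro k
      have h2 : ∀ i j, i < 6 → j < 6 → ((σ ^ i) a = (σ ^ j) a ↔ i = j) := fun i j hi hj =>
        ⟨p2 i j hi hj, fun h' => by rw [h']⟩
      by_cases hk : M.face k = M.outer
      · rw [ind_of_mem (Set.mem_singleton_iff.mpr hk)]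
        obtain ⟨i, hi, rfl⟩ := p3 k (by rw [hk, haf])
        rw [h2 i 0 hi (by omega), h2 i 1 hi (by omega), h2 i 2 hi (by omega), h2 i 3 hi (by omega),
          h2 i 4 hi (by omega), h2 i 5 hi (by omega)]
        interval_cases i <;> norm_num
      · rw [ind_of_notMem (Set.notMem_singleton_iff.mpr hk)]
        have h3 : ∀ i, k ≠ (σ ^ i) a := fun i h' => hk (by rw [h', hface])
        simp only [h3, if_false]
        norm_num
    have hconst := M.face_const
      (fun g => ind {M.outer} g - s * ind {f} g - s' * ind {f'} g) (fun k => by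
        have e1 := hs k
        have e2 := hs' k
        rw [passes_four, passes_four] at e1 e2
        have e3 : (if M.opp k = M.opp h then (1 : ℚ) else 0) = if k = h then 1 else 0 := by
          simp only [M.opp_injective.eq_iff]
        have e4 : (if M.opp k = h then (1 : ℚ) else 0) = if k = M.opp h then 1 else 0 := by
          simp only [M.opp_eq_iff]
        have e5 := hout k
        have e6 := hout (M.opp k)
        linarith)
    obtain ⟨g, hg⟩ : ∃ g, g ∉ ({M.outer, f, f'} : Finset M.Face) := by
      by_contra hcon
      push Not at hcon
      have h1 := hI.four_le_faces
      rw [Nat.card_eq_fintype_card, ← Finset.card_univ] at h1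
      have h2 : (Finset.univ : Finset M.Face).card ≤ _ :=
        Finset.card_le_card (fun g _ => hcon g)
      have h3 : ({M.outer, f, f'} : Finset M.Face).card ≤ 3 := Finset.card_le_three
      omega
    simp only [Finset.mem_insert, Finset.mem_singleton, not_or] at hg
    have := hconst g M.outer
    simp only [ind, Set.mem_singleton_iff, hg.1, hg.2.1, hg.2.2, hf.symm, hf'.symm, if_true,
      if_false] at this
    norm_num at this
  · refine hD.origin_ne_of_two_steps (h := (σ ^ 4) a) (k := (σ ^ 5) a) (l := h)
      (hstep 4).symm ?_ ?_
    · rw [hstep 5, h6]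
    · rw [hb]
  · have h1 : h = M.opp ((σ ^ 5) a) := eq_of_parallel hD hI (by rw [hstep 5, h6])
      (by rw [M.opp_opp, hb])
    exact hin.2 (by rw [h1, M.opp_opp, hface])

/-! ### Counting consequences of Euler's relation -/

theorem card_halfEdge (hD : M.IsHexagonDissection) :
    Fintype.card H = 4 * Fintype.card M.Face + 2 := by
  have h1 : Fintype.card H = ∑ f : M.Face, M.faceDegree f := by
    simp only [faceDegree_eq_card]
    rw [← Finset.card_univ]
    exact Finset.card_eq_sum_card_fiberwise (fun _ _ => Finset.mem_univ _)
  have h2 : ∀ f : M.Face, M.faceDegree f = 4 + if f = M.outer then 2 else 0 := by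
    intro f
    split_ifs with hf
    · rw [hf, hD.outer_degree]
    · rw [hD.inner_degree f hf]
  rw [h1, Finset.sum_congr rfl fun f _ => h2 f, Finset.sum_add_distrib]
  simp
  ring

theorem card_vertex (hD : M.IsHexagonDissection) :
    Fintype.card M.Vertex = Fintype.card M.Face + 3 := by
  have h1 := card_halfEdge hD
  have h2 := M.euler_card
  have h3 := M.card_eq_two_mul_card_edge
  omega

theorem card_isOuterVertex (hD : M.IsHexagonDissection) :
    (Finset.univ.filter fun v => M.IsOuterVertex v).card = 6 := by
  rw [← hD.outer_degree, faceDegree_eq_card]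
  symm
  refine Finset.card_bij (fun h _ => M.origin h) ?_ ?_ ?_
  · intro h hh
    simpa using isOuterVertex_of_face (by simpa using hh)
  · intro h hh k hk hhk
    exact hD.outer_simple h k (by simpa using hh) (by simpa using hk) hhk
  · intro v hv
    obtain ⟨h, hh, hh'⟩ : M.IsOuterVertex v := by simpa using hv
    exact ⟨h, by simpa using hh', hh⟩

theorem card_isInner (hD : M.IsHexagonDissection) :
    (Finset.univ.filter fun h => M.IsInner h).card + 12 = Fintype.card H := by
  have h1 := hD.outer_degree
  rw [faceDegree_eq_card] at h1
  have h2 : (Finset.univ.filter fun h => M.face (M.opp h) = M.outer).card = 6 := by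
    rw [← h1]
    refine Finset.card_bij (fun h _ => M.opp h) ?_ (fun _ _ _ _ h => M.opp_injective h) ?_
    · intro h hh
      simpa using hh
    · intro h hh
      exact ⟨M.opp h, by simpa [M.opp_opp] using hh, M.opp_opp h⟩
  have h3 : (Finset.univ.filter fun h => ¬ M.IsInner h) =
      (Finset.univ.filter fun h => M.face h = M.outer) ∪
        (Finset.univ.filter fun h => M.face (M.opp h) = M.outer) := by
    ext h
    simp only [Finset.mem_filter, Finset.mem_univ, true_and, Finset.mem_union]
    unfold IsInner
    tauto
  have h4 : Disjoint (Finset.univ.filter fun h => M.face h = M.outer)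
      (Finset.univ.filter fun h => M.face (M.opp h) = M.outer) := by
    rw [Finset.disjoint_left]
    intro h hh hh'
    exact face_opp_ne_outer hD (by simpa using hh) (by simpa using hh')
  have h5 := Finset.card_filter_add_card_filter_not (s := (Finset.univ : Finset H)) M.IsInner
  rw [h3, Finset.card_union_of_disjoint h4, h1, h2, Finset.card_univ] at h5
  omega

/-! ### Euler-type inequalities for sets of vertices -/

/-- Differences of functions on vertices are orthogonal to differences of functions on faces. -/
theorem sum_vertex_diff_mul_face_diff (g : M.Vertex → ℚ) (q : M.Face → ℚ) :
    ∑ h, (g (M.origin h) - g (M.origin (M.opp h))) * (q (M.face h) - q (M.face (M.opp h))) = 0 := by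
  have h1 : ∑ h, g (M.origin h) * (q (M.face h) - q (M.face (M.opp h))) = 0 := by
    rw [← sum_fiberSum M.origin]
    refine Finset.sum_eq_zero fun v _ => ?_
    have h2 : fiberSum M.origin (fun h => g (M.origin h) * (q (M.face h) - q (M.face (M.opp h)))) v
        = fiberSum M.origin (fun h => g v * (q (M.face h) - q (M.face (M.opp h)))) v :=
      fiberSum_congr fun k hk => by rw [hk]
    rw [h2, fiberSum_smul, fiberSum_sub, M.fiberSum_origin_face, sub_self, mul_zero]
  have h2 : ∑ h, g (M.origin (M.opp h)) * (q (M.face h) - q (M.face (M.opp h))) = 0 := by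
    rw [← Equiv.sum_comp M.opp]
    simp only [M.opp_opp]
    rw [← neg_eq_zero, ← Finset.sum_neg_distrib, ← h1]
    exact Finset.sum_congr rfl fun h _ => by ring
  simp only [sub_mul, Finset.sum_sub_distrib]
  rw [h1, h2, sub_zero]

/-- A dimension count: functions on a set `A` of vertices and on a set `B` of faces, mapped to their
differences along a set `S` of edges. -/
theorem card_add_card_le {S : Finset H} (hS : ∀ h ∈ S, M.opp h ∈ S) (A : Finset M.Vertex)
    (B : Finset M.Face)
    (hAB : ∀ h, h ∉ S → (M.origin h ∉ A ∧ M.origin (M.opp h) ∉ A) ∨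
      (M.face h ∉ B ∧ M.face (M.opp h) ∉ B))
    (l : ((M.Vertex → ℚ) × (M.Face → ℚ)) →ₗ[ℚ] ℚ)
    (hl : ∀ (g : M.Vertex → ℚ) (q : M.Face → ℚ), (∀ v, v ∉ A → g v = 0) → (∀ f, f ∉ B → q f = 0) →
      (∀ h ∈ S, g (M.origin (M.opp h)) = g (M.origin h)) →
      (∀ h ∈ S, q (M.face (M.opp h)) = q (M.face h)) → l (g, q) = 0 → g = 0 ∧ q = 0) :
    2 * (A.card + B.card) ≤ S.card + 2 := by
  let extA : (A → ℚ) →ₗ[ℚ] (M.Vertex → ℚ) := Function.ExtendByZero.linearMap ℚ Subtype.val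
  let extB : (B → ℚ) →ₗ[ℚ] (M.Face → ℚ) := Function.ExtendByZero.linearMap ℚ Subtype.val
  have hA0 : ∀ g v, v ∉ A → extA g v = 0 := fun g v hv =>
    Function.extend_apply' (f := (Subtype.val : A → M.Vertex)) g (0 : M.Vertex → ℚ) v
      (by rintro ⟨a, rfl⟩; exact hv a.2)
  have hB0 : ∀ g v, v ∉ B → extB g v = 0 := fun g v hv =>
    Function.extend_apply' (f := (Subtype.val : B → M.Face)) g (0 : M.Face → ℚ) v
      (by rintro ⟨a, rfl⟩; exact hv a.2)
  have hA1 : ∀ g (a : A), extA g a = g a := fun g a =>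
    Subtype.val_injective.extend_apply g 0 a
  have hB1 : ∀ g (a : B), extB g a = g a := fun g a =>
    Subtype.val_injective.extend_apply g 0 a
  let ext : ((A → ℚ) × (B → ℚ)) →ₗ[ℚ] ((M.Vertex → ℚ) × (M.Face → ℚ)) := extA.prodMap extB
  let D : ((M.Vertex → ℚ) × (M.Face → ℚ)) →ₗ[ℚ] ({h // h ∈ S ∧ h ∈ M.chosen} → ℚ) :=
    { toFun := fun x h => (x.1 (M.origin h.1) - x.1 (M.origin (M.opp h.1))) +
        (x.2 (M.face h.1) - x.2 (M.face (M.opp h.1)))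
      map_add' := fun x y => funext fun h => by
        simp only [Prod.fst_add, Prod.snd_add, Pi.add_apply]; ring
      map_smul' := fun c x => funext fun h => by
        simp only [Prod.smul_fst, Prod.smul_snd, Pi.smul_apply, smul_eq_mul, RingHom.id_apply]
        ring }
  -- The extra functional `l` removes the constants that may survive in the kernel of `D`; it
  -- accounts for the term 2 in the bound.
  have hinj : Function.Injective ((D.prod l).comp ext) := by
    rw [← LinearMap.ker_eq_bot, LinearMap.ker_eq_bot']
    rintro ⟨g, q⟩ hgq
    have hD : ∀ h, h ∈ S → h ∈ M.chosen →
        (extA g (M.origin h) - extA g (M.origin (M.opp h))) +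
        (extB q (M.face h) - extB q (M.face (M.opp h))) = 0 := fun h hh hh' =>
      congrFun (congrArg Prod.fst hgq) ⟨h, hh, hh'⟩
    have hl0 : l (extA g, extB q) = 0 := congrArg Prod.snd hgq
    have hD' : ∀ h ∈ S, (extA g (M.origin h) - extA g (M.origin (M.opp h))) +
        (extB q (M.face h) - extB q (M.face (M.opp h))) = 0 := by
      intro h hh
      by_cases hc : h ∈ M.chosen
      · exact hD h hh hc
      · have h1 := hD (M.opp h) (hS h hh) (by rw [M.mem_chosen_iff, M.opp_opp]; exact hc)
        rw [M.opp_opp] at h1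
        linarith
    -- On `S` the two differences are opposite, off `S` one of them vanishes. Orthogonality
    -- therefore states that a sum of squares is zero.
    have hsum := sum_vertex_diff_mul_face_diff (M := M) (extA g) (extB q)
    have hsq : ∑ h, (if h ∈ S then (extA g (M.origin h) - extA g (M.origin (M.opp h))) ^ 2 else 0)
        = 0 := by
      rw [← neg_eq_zero, ← Finset.sum_neg_distrib]
      refine Eq.trans (Finset.sum_congr rfl fun h _ => ?_) hsum
      split_ifs with hh
      · have h1 := hD' h hh
        have h2 : extB q (M.face h) - extB q (M.face (M.opp h)) =
          -(extA g (M.origin h) - extA g (M.origin (M.opp h))) := by linarith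
        rw [h2]; ring
      · rcases hAB h hh with ⟨h1, h2⟩ | ⟨h1, h2⟩
        · rw [hA0 g _ h1, hA0 g _ h2]; ring
        · rw [hB0 q _ h1, hB0 q _ h2]; ring
    rw [Finset.sum_eq_zero_iff_of_nonneg (fun h _ => by split_ifs <;> positivity)] at hsq
    have hz : ∀ h ∈ S, extA g (M.origin (M.opp h)) = extA g (M.origin h) := by
      intro h hh
      have h1 := hsq h (Finset.mem_univ h)
      rw [if_pos hh] at h1
      have := pow_eq_zero_iff (two_ne_zero) |>.mp h1
      linarith
    obtain ⟨e1, e2⟩ := hl (extA g) (extB q) (hA0 g) (hB0 q) hz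
      (fun h hh => by have := hD' h hh; have := hz h hh; linarith) hl0
    refine Prod.ext (funext fun a => ?_) (funext fun b => ?_)
    · exact (hA1 g a).symm.trans (congrFun e1 a)
    · exact (hB1 q b).symm.trans (congrFun e2 b)
  have hle := LinearMap.finrank_le_finrank_of_injective hinj
  have hc := M.card_chosen_inter (S : Set H) hS
  simp only [Finset.mem_coe, Finset.filter_univ_mem] at hc
  simp only [Module.finrank_prod, Module.finrank_fintype_fun_eq_card, Fintype.card_coe,
    Module.finrank_self] at hle
  rw [Fintype.card_subtype] at hle
  omega

/-- A set of vertices that cannot be split without cutting an edge. -/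
def VertexConnected (M : PlanarMap H) (W : Finset M.Vertex) : Prop :=
  ∀ W₁ ⊆ W, W₁.Nonempty → W₁ ≠ W → ∃ h, M.origin h ∈ W₁ ∧ M.origin (M.opp h) ∈ W ∧
    M.origin (M.opp h) ∉ W₁

theorem exists_split {W : Finset M.Vertex} (hW : ¬ M.VertexConnected W) :
    ∃ W₁ W₂ : Finset M.Vertex, W₁.Nonempty ∧ W₂.Nonempty ∧ Disjoint W₁ W₂ ∧ W = W₁ ∪ W₂ ∧
      ∀ h, ¬ (M.origin h ∈ W₁ ∧ M.origin (M.opp h) ∈ W₂) := by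
  unfold VertexConnected at hW
  push Not at hW
  obtain ⟨W₁, hsub, hne, hne', h⟩ := hW
  refine ⟨W₁, W \ W₁, hne, ?_, Finset.disjoint_sdiff, (Finset.union_sdiff_of_subset hsub).symm, ?_⟩
  · rw [Finset.sdiff_nonempty]
    exact fun h' => hne' (hsub.antisymm h')
  · rintro k ⟨h1, h2⟩
    rw [Finset.mem_sdiff] at h2
    exact h2.2 (h k h1 h2.1)

theorem VertexConnected.eq_of_step {W : Finset M.Vertex} (hW : M.VertexConnected W)
    (P : M.Vertex → Prop) {w₀ : M.Vertex} (hw₀ : w₀ ∈ W) (h₀ : P w₀)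
    (hP : ∀ h, M.origin h ∈ W → M.origin (M.opp h) ∈ W → P (M.origin h) → P (M.origin (M.opp h))) :
    ∀ w ∈ W, P w := by
  by_contra hcon
  push Not at hcon
  obtain ⟨w, hw, hPw⟩ := hcon
  obtain ⟨h, h1, h2, h3⟩ := hW (W.filter P) (Finset.filter_subset _ _)
    ⟨w₀, Finset.mem_filter.mpr ⟨hw₀, h₀⟩⟩
    (fun h => hPw (Finset.filter_eq_self.mp h w hw))
  rw [Finset.mem_filter] at h1
  exact h3 (Finset.mem_filter.mpr ⟨h2, hP h h1.1 h2 h1.2⟩)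

/-- The half-edges attached to a set of vertices. -/
noncomputable def halfEdgesAt (M : PlanarMap H) (W : Finset M.Vertex) : Finset H :=
  Finset.univ.filter fun h => M.origin h ∈ W

/-- The halves of the edges with an end in a set of vertices. -/
noncomputable def halfEdgesTouching (M : PlanarMap H) (W : Finset M.Vertex) : Finset H :=
  Finset.univ.filter fun h => M.origin h ∈ W ∨ M.origin (M.opp h) ∈ W

/-- The halves of the edges with both ends in a set of vertices. -/
noncomputable def halfEdgesInside (M : PlanarMap H) (W : Finset M.Vertex) : Finset H :=
  Finset.univ.filter fun h => M.origin h ∈ W ∧ M.origin (M.opp h) ∈ W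

/-- The faces incident to a set of vertices. -/
noncomputable def facesTouching (M : PlanarMap H) (W : Finset M.Vertex) : Finset M.Face :=
  Finset.univ.filter fun f => ∃ h, M.face h = f ∧ M.origin h ∈ W

/-- The faces all of whose vertices belong to a set of vertices. -/
noncomputable def facesInside (M : PlanarMap H) (W : Finset M.Vertex) : Finset M.Face :=
  Finset.univ.filter fun f => ∀ h, M.face h = f → M.origin h ∈ W

theorem mem_halfEdgesAt {W : Finset M.Vertex} {h : H} : h ∈ M.halfEdgesAt W ↔ M.origin h ∈ W := by
  simp [halfEdgesAt]

theorem mem_halfEdgesTouching {W : Finset M.Vertex} {h : H} :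
    h ∈ M.halfEdgesTouching W ↔ M.origin h ∈ W ∨ M.origin (M.opp h) ∈ W := by
  simp [halfEdgesTouching]

theorem mem_halfEdgesInside {W : Finset M.Vertex} {h : H} :
    h ∈ M.halfEdgesInside W ↔ M.origin h ∈ W ∧ M.origin (M.opp h) ∈ W := by
  simp [halfEdgesInside]

theorem mem_facesTouching {W : Finset M.Vertex} {f : M.Face} :
    f ∈ M.facesTouching W ↔ ∃ h, M.face h = f ∧ M.origin h ∈ W := by
  simp [facesTouching]

theorem mem_facesInside {W : Finset M.Vertex} {f : M.Face} :
    f ∈ M.facesInside W ↔ ∀ h, M.face h = f → M.origin h ∈ W := by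
  simp [facesInside]

theorem face_mem_facesTouching {W : Finset M.Vertex} {h : H} (hh : M.origin h ∈ W) :
    M.face h ∈ M.facesTouching W ∧ M.face (M.opp h) ∈ M.facesTouching W :=
  ⟨mem_facesTouching.mpr ⟨h, rfl, hh⟩,
    mem_facesTouching.mpr ⟨M.rot h, M.face_rot h, by rwa [M.origin_rot]⟩⟩

theorem card_touching_add_card_inside (W : Finset M.Vertex) :
    (M.halfEdgesTouching W).card + (M.halfEdgesInside W).card = 2 * (M.halfEdgesAt W).card := by
  have h1 : M.halfEdgesTouching W = M.halfEdgesAt W ∪ (M.halfEdgesAt W).image M.opp := by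
    ext h
    simp only [mem_halfEdgesTouching, Finset.mem_union, mem_halfEdgesAt, Finset.mem_image]
    refine or_congr_right ⟨fun hh => ⟨M.opp h, hh, M.opp_opp h⟩, ?_⟩
    rintro ⟨k, hk, rfl⟩
    rwa [M.opp_opp]
  have h2 : M.halfEdgesInside W = M.halfEdgesAt W ∩ (M.halfEdgesAt W).image M.opp := by
    ext h
    simp only [mem_halfEdgesInside, Finset.mem_inter, mem_halfEdgesAt, Finset.mem_image]
    refine and_congr_right fun _ => ⟨fun hh => ⟨M.opp h, hh, M.opp_opp h⟩, ?_⟩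
    rintro ⟨k, hk, rfl⟩
    rwa [M.opp_opp]
  rw [h1, h2, Finset.card_union_add_card_inter, Finset.card_image_of_injective _ M.opp_injective]
  ring

theorem card_touching_even (W : Finset M.Vertex) : Even (M.halfEdgesTouching W).card := by
  have hc := M.card_chosen_inter (M.halfEdgesTouching W : Set H) (fun h hh => by
    rw [Finset.mem_coe, mem_halfEdgesTouching] at hh ⊢
    rw [M.opp_opp]
    exact hh.symm)
  simp only [Finset.mem_coe, Finset.filter_univ_mem] at hc
  rw [hc]
  exact even_two_mul _

/-- Constants survive on the face side only. A face function with no jump across the touching edges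
is constant around each vertex of `W`, hence on all touching faces by connectedness; a vertex
function vanishes because some vertex lies outside `W`. -/
theorem card_add_card_facesTouching_le {W : Finset M.Vertex} (hW : M.VertexConnected W)
    (hne : W.Nonempty) (hne' : W ≠ Finset.univ) :
    2 * (W.card + (M.facesTouching W).card) ≤ (M.halfEdgesTouching W).card + 2 := by
  obtain ⟨w₀, hw₀⟩ := hne
  obtain ⟨h₀, rfl⟩ := M.origin_surjective w₀
  obtain ⟨v, hv⟩ : ∃ v, v ∉ W := by
    by_contra hcon
    push Not at hcon
    exact hne' (Finset.eq_univ_iff_forall.mpr hcon)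
  refine card_add_card_le (fun h hh => ?_) W (M.facesTouching W) (fun h hh => Or.inl ?_)
    ((LinearMap.proj (M.face h₀)).comp (LinearMap.snd ℚ (M.Vertex → ℚ) (M.Face → ℚ))) ?_
  · rw [mem_halfEdgesTouching] at hh ⊢
    rw [M.opp_opp]
    exact hh.symm
  · rw [mem_halfEdgesTouching] at hh
    push Not at hh
    exact hh
  intro g q hg hq hgS hqS h0
  change q (M.face h₀) = 0 at h0
  constructor
  · have hconst : ∀ h, g (M.origin (M.opp h)) = g (M.origin h) := by
      intro h
      by_cases hh : h ∈ M.halfEdgesTouching W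
      · exact hgS h hh
      · rw [mem_halfEdgesTouching] at hh
        push Not at hh
        rw [hg _ hh.1, hg _ hh.2]
    exact funext fun u => (M.vertex_const g hconst u v).trans (hg v hv)
  · have key : ∀ h k, M.origin h = M.origin k → M.origin h ∈ W → q (M.face h) = 0 →
        q (M.face k) = 0 := by
      intro h k hhk hh hq0
      by_contra hcon
      obtain ⟨c, hc1, hc2, hc3⟩ := M.exists_rot_step (P := fun h => q (M.face h) = 0) hhk hq0 hcon
      refine hc3 ?_
      rw [M.face_rot, hqS c (mem_halfEdgesTouching.mpr (Or.inl (hc1 ▸ hh)))]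
      exact hc2
    have hall := hW.eq_of_step (fun w => ∀ h, M.origin h = w → q (M.face h) = 0) hw₀
      (fun h hh => key h₀ h hh.symm hw₀ h0) (fun h hh hh' hP k hk => by
        refine key (M.opp h) k hk.symm hh' ?_
        rw [hqS h (mem_halfEdgesTouching.mpr (Or.inl hh))]
        exact hP h rfl)
    funext f
    by_cases hf : f ∈ M.facesTouching W
    · obtain ⟨h, rfl, hh⟩ := mem_facesTouching.mp hf
      exact hall _ hh h rfl
    · exact hq f hf

/-- Here constants survive on the vertex side only: the face function vanishes because the outer
face is excluded. -/
theorem card_add_card_facesInside_le {W : Finset M.Vertex} (hW : M.VertexConnected W)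
    (hne : W.Nonempty) (hout : M.outer ∉ M.facesInside W) :
    2 * (W.card + (M.facesInside W).card) ≤ (M.halfEdgesInside W).card + 2 := by
  obtain ⟨w₀, hw₀⟩ := hne
  have hside : ∀ h, M.origin h ∉ W → M.face h ∉ M.facesInside W ∧
      M.face (M.opp h) ∉ M.facesInside W := by
    intro h hh
    refine ⟨fun h' => hh (mem_facesInside.mp h' h rfl), fun h' => hh ?_⟩
    rw [← M.origin_rot]
    exact mem_facesInside.mp h' _ (M.face_rot h)
  have hside' : ∀ h, h ∉ M.halfEdgesInside W → M.face h ∉ M.facesInside W ∧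
      M.face (M.opp h) ∉ M.facesInside W := by
    intro h hh
    rw [mem_halfEdgesInside, not_and_or] at hh
    rcases hh with hh | hh
    · exact hside h hh
    · have := hside _ hh
      rw [M.opp_opp] at this
      exact this.symm
  refine card_add_card_le (fun h hh => ?_) W (M.facesInside W) (fun h hh => Or.inr (hside' h hh))
    ((LinearMap.proj w₀).comp (LinearMap.fst ℚ (M.Vertex → ℚ) (M.Face → ℚ))) ?_
  · rw [mem_halfEdgesInside] at hh ⊢
    rw [M.opp_opp]
    exact hh.symm
  intro g q hg hq hgS hqS h0
  change g w₀ = 0 at h0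
  constructor
  · have hall := hW.eq_of_step (fun w => g w = 0) hw₀ h0 (fun h hh hh' hP => by
      rw [hgS h (mem_halfEdgesInside.mpr ⟨hh, hh'⟩)]
      exact hP)
    funext v
    by_cases hv : v ∈ W
    · exact hall v hv
    · exact hg v hv
  · have hconst : ∀ h, q (M.face (M.opp h)) = q (M.face h) := by
      intro h
      by_cases hh : h ∈ M.halfEdgesInside W
      · exact hqS h hh
      · rw [hq _ (hside' h hh).1, hq _ (hside' h hh).2]
    exact funext fun f => (M.face_const q hconst f M.outer).trans (hq _ hout)

theorem card_faces_mul (hD : M.IsHexagonDissection) (T : Finset M.Face) :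
    (Finset.univ.filter fun h => M.face h ∈ T).card =
      4 * T.card + if M.outer ∈ T then 2 else 0 := by
  have h1 : (Finset.univ.filter fun h => M.face h ∈ T).card = ∑ f ∈ T, M.faceDegree f := by
    rw [Finset.card_eq_sum_card_fiberwise (f := M.face) (t := T) (fun h hh => by simpa using hh)]
    refine Finset.sum_congr rfl fun f hf => ?_
    rw [faceDegree_eq_card, Finset.filter_filter]
    congr 1
    ext h
    simp only [Finset.mem_filter, Finset.mem_univ, true_and]
    exact ⟨fun h => h.2, fun h => ⟨h ▸ hf, h⟩⟩
  have h2 : ∀ f : M.Face, M.faceDegree f = 4 + if f = M.outer then 2 else 0 := by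
    intro f
    split_ifs with hf
    · rw [hf, hD.outer_degree]
    · rw [hD.inner_degree f hf]
  rw [h1, Finset.sum_congr rfl fun f _ => h2 f, Finset.sum_add_distrib]
  simp
  ring

/-- Let `e` half-edges and `f` faces touch `W`. The dimension count gives `2(|W| + f) ≤ e + 2`. The
`4f` sides of these faces include the `e` touching half-edges and at least five arcs of the contour,
so `4|W| + 1 ≤ e`. As `e` is even, one more unit is gained, and `card_facesInside_le` needs it. -/
theorem card_touching_of_connected (hD : M.IsHexagonDissection) (hI : M.IsIrreducible)
    {W : Finset M.Vertex} (hW : M.VertexConnected W) (hne : W.Nonempty)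
    (hin : ∀ w ∈ W, ¬ M.IsOuterVertex w) : 4 * W.card + 2 ≤ (M.halfEdgesTouching W).card := by
  obtain ⟨h₀, hh₀⟩ := M.face_surjective M.outer
  have hne' : W ≠ Finset.univ := fun h =>
    hin (M.origin h₀) (h ▸ Finset.mem_univ _) (isOuterVertex_of_face hh₀)
  have hout : M.outer ∉ M.facesTouching W := fun h => by
    obtain ⟨k, hk, hk'⟩ := mem_facesTouching.mp h
    exact hin _ hk' (isOuterVertex_of_face hk)
  have h1 := card_add_card_facesTouching_le hW hne hne'
  have h2 := card_faces_mul hD (M.facesTouching W)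
  rw [if_neg hout, add_zero] at h2
  have h3 : (M.halfEdgesTouching W).card + (M.cut (M.facesTouching W : Set M.Face)).card ≤
      (Finset.univ.filter fun h => M.face h ∈ M.facesTouching W).card := by
    rw [← Finset.card_union_of_disjoint]
    · refine Finset.card_le_card fun h hh => ?_
      rw [Finset.mem_filter]
      refine ⟨Finset.mem_univ _, ?_⟩
      rcases Finset.mem_union.mp hh with hh | hh
      · rcases mem_halfEdgesTouching.mp hh with hh | hh
        · exact (face_mem_facesTouching hh).1
        · have := (face_mem_facesTouching hh).2
          rwa [M.opp_opp] at this
      · exact (mem_cut.mp hh).1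
    · rw [Finset.disjoint_left]
      intro h hh hc
      refine (mem_cut.mp hc).2 ?_
      rcases mem_halfEdgesTouching.mp hh with hh | hh
      · exact (face_mem_facesTouching hh).2
      · exact (face_mem_facesTouching hh).1
  have hTne : (M.facesTouching W : Set M.Face).Nonempty := by
    obtain ⟨w, hw⟩ := hne
    obtain ⟨h, rfl⟩ := M.origin_surjective w
    exact ⟨_, (face_mem_facesTouching hw).1⟩
  -- A shorter contour would enclose a single face. Three or more of its four sides would lie on the
  -- contour, leaving no room for the two halves of an edge at `W`.
  have h4 : 5 ≤ (M.cut (M.facesTouching W : Set M.Face)).card := by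
    by_contra hcon
    obtain ⟨f, hf⟩ := eq_singleton_of_card_cut_le_four hD hI hTne hout (by omega)
    have h5 := two_lt_card_cut hD hI hTne hout
    have h6 : (M.facesTouching W).card = 1 := by
      rw [Finset.card_eq_one]
      exact ⟨f, by exact_mod_cast hf⟩
    obtain ⟨w, hw⟩ := hne
    obtain ⟨h, rfl⟩ := M.origin_surjective w
    have h7 : ({h, M.opp h} : Finset H) ⊆ M.halfEdgesTouching W := by
      intro k hk
      rw [mem_halfEdgesTouching]
      rcases Finset.mem_insert.mp hk with rfl | hk
      · exact Or.inl hw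
      · rw [Finset.mem_singleton.mp hk, M.opp_opp]
        exact Or.inr hw
    have h8 := Finset.card_le_card h7
    rw [Finset.card_pair (M.opp_ne h).symm] at h8
    omega
  obtain ⟨m, hm⟩ := card_touching_even W
  omega

theorem card_touching_union {W₁ W₂ : Finset M.Vertex} (hdis : Disjoint W₁ W₂)
    (hno : ∀ h, ¬ (M.origin h ∈ W₁ ∧ M.origin (M.opp h) ∈ W₂)) :
    (M.halfEdgesTouching (W₁ ∪ W₂)).card =
      (M.halfEdgesTouching W₁).card + (M.halfEdgesTouching W₂).card := by
  rw [← Finset.card_union_of_disjoint]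
  · congr 1
    ext h
    simp only [mem_halfEdgesTouching, Finset.mem_union]
    tauto
  · rw [Finset.disjoint_left] at hdis ⊢
    intro h h1 h2
    rw [mem_halfEdgesTouching] at h1 h2
    have n1 := hno h
    have n2 := hno (M.opp h)
    rw [M.opp_opp] at n2
    rcases h1 with h1 | h1 <;> rcases h2 with h2 | h2
    · exact hdis h1 h2
    · exact n1 ⟨h1, h2⟩
    · exact n2 ⟨h1, h2⟩
    · exact hdis h1 h2

theorem card_touching_of_inner (hD : M.IsHexagonDissection) (hI : M.IsIrreducible)
    (W : Finset M.Vertex) (hin : ∀ w ∈ W, ¬ M.IsOuterVertex w) :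
    4 * W.card ≤ (M.halfEdgesTouching W).card := by
  induction W using Finset.strongInduction with
  | H W ih =>
    rcases W.eq_empty_or_nonempty with rfl | hne
    · simp
    by_cases hW : M.VertexConnected W
    · have := card_touching_of_connected hD hI hW hne hin
      omega
    obtain ⟨W₁, W₂, hn1, hn2, hdis, rfl, hno⟩ := exists_split hW
    have i1 := ih W₁ (Finset.ssubset_iff_subset_ne.mpr ⟨Finset.subset_union_left, fun h =>
      hn2.ne_empty (Finset.disjoint_self_iff_empty _ |>.mp
        (hdis.mono_left (h ▸ Finset.subset_union_right)))⟩)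
      (fun w hw => hin w (Finset.mem_union_left _ hw))
    have i2 := ih W₂ (Finset.ssubset_iff_subset_ne.mpr ⟨Finset.subset_union_right, fun h =>
      hn1.ne_empty (Finset.disjoint_self_iff_empty _ |>.mp
        (hdis.mono_right (h ▸ Finset.subset_union_left)))⟩)
      (fun w hw => hin w (Finset.mem_union_right _ hw))
    rw [card_touching_union hdis hno, Finset.card_union_of_disjoint hdis]
    omega

/-- The counting inequality behind the existence of balanced orientations. -/
theorem card_facesInside_le (hD : M.IsHexagonDissection) (hI : M.IsIrreducible)
    (W : Finset M.Vertex) (hin : ∀ w ∈ W, ¬ M.IsOuterVertex w) :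
    3 * W.card + (M.facesInside W).card ≤ (M.halfEdgesAt W).card := by
  induction W using Finset.strongInduction with
  | H W ih =>
    rcases W.eq_empty_or_nonempty with rfl | hne
    · have : M.facesInside ∅ = ∅ := by
        rw [Finset.eq_empty_iff_forall_notMem]
        intro f hf
        obtain ⟨h, hh⟩ := M.face_surjective f
        simpa using mem_facesInside.mp hf h hh
      simp [this]
    by_cases hW : M.VertexConnected W
    -- The surplus 2 of this bound cancels the 2 lost in `card_add_card_facesInside_le`.
    · have h1 := card_touching_of_connected hD hI hW hne hin
      have h2 := card_add_card_facesInside_le hW hne (fun h => by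
        obtain ⟨k, hk⟩ := M.face_surjective M.outer
        exact hin _ (mem_facesInside.mp h k hk) (isOuterVertex_of_face hk))
      have h3 := card_touching_add_card_inside W
      omega
    obtain ⟨W₁, W₂, hn1, hn2, hdis, rfl, hno⟩ := exists_split hW
    have i1 := ih W₁ (Finset.ssubset_iff_subset_ne.mpr ⟨Finset.subset_union_left, fun h =>
      hn2.ne_empty (Finset.disjoint_self_iff_empty _ |>.mp
        (hdis.mono_left (h ▸ Finset.subset_union_right)))⟩)
      (fun w hw => hin w (Finset.mem_union_left _ hw))
    have i2 := ih W₂ (Finset.ssubset_iff_subset_ne.mpr ⟨Finset.subset_union_right, fun h =>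
      hn1.ne_empty (Finset.disjoint_self_iff_empty _ |>.mp
        (hdis.mono_right (h ▸ Finset.subset_union_left)))⟩)
      (fun w hw => hin w (Finset.mem_union_right _ hw))
    -- A face with vertices in both parts would have a side joining them.
    have h1 : M.facesInside (W₁ ∪ W₂) ⊆ M.facesInside W₁ ∪ M.facesInside W₂ := by
      intro f hf
      rw [mem_facesInside] at hf
      rw [Finset.mem_union, mem_facesInside, mem_facesInside]
      by_contra hcon
      push Not at hcon
      obtain ⟨⟨a, ha, ha'⟩, b, hb, hb'⟩ := hcon
      have hb1 : M.origin b ∈ W₁ := (Finset.mem_union.mp (hf b hb)).resolve_right hb'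
      obtain ⟨c, hc1, hc2, hc3⟩ := M.exists_face_step (P := fun h => M.origin h ∈ W₁)
        (hb.trans ha.symm) hb1 ha'
      have h3 := hf (M.rot (M.opp c)) (by rw [M.face_rot_opp, hc1, hb])
      have h4 := (Finset.mem_union.mp h3).resolve_left hc3
      rw [M.origin_rot] at h4
      exact hno c ⟨hc2, h4⟩
    have h2 := (Finset.card_le_card h1).trans (Finset.card_union_le _ _)
    have h3 : (M.halfEdgesAt (W₁ ∪ W₂)).card =
        (M.halfEdgesAt W₁).card + (M.halfEdgesAt W₂).card := by
      rw [← Finset.card_union_of_disjoint]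
      · congr 1
        ext h
        simp only [mem_halfEdgesAt, Finset.mem_union]
      · rw [Finset.disjoint_left] at hdis ⊢
        intro h h1 h2
        exact hdis (mem_halfEdgesAt.mp h1) (mem_halfEdgesAt.mp h2)
    rw [Finset.card_union_of_disjoint hdis]
    omega

/-- If `W` is connected, the touching half-edges are among the at most `4f + 2` sides of the `f`
touching faces. If it splits, the hexagon lies entirely in one part, and the other part consists of
inner vertices. -/
theorem card_touching_of_outer (hD : M.IsHexagonDissection) (hI : M.IsIrreducible)
    (W : Finset M.Vertex) (hne : W ≠ Finset.univ) (hout : ∀ w, M.IsOuterVertex w → w ∈ W) :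
    4 * W.card ≤ (M.halfEdgesTouching W).card + 6 := by
  induction W using Finset.strongInduction with
  | H W ih =>
    obtain ⟨h₀, hh₀⟩ := M.face_surjective M.outer
    have hv₀ := isOuterVertex_of_face hh₀
    by_cases hW : M.VertexConnected W
    · have h1 := card_add_card_facesTouching_le hW ⟨_, hout _ hv₀⟩ hne
      have h2 := card_faces_mul hD (M.facesTouching W)
      have h3 : (M.halfEdgesTouching W).card ≤
          (Finset.univ.filter fun h => M.face h ∈ M.facesTouching W).card := by
        refine Finset.card_le_card fun h hh => ?_
        rw [Finset.mem_filter]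
        refine ⟨Finset.mem_univ _, ?_⟩
        rcases mem_halfEdgesTouching.mp hh with hh | hh
        · exact (face_mem_facesTouching hh).1
        · have := (face_mem_facesTouching hh).2
          rwa [M.opp_opp] at this
      split_ifs at h2 <;> omega
    have key : ∀ W₁ W₂ : Finset M.Vertex, W₂.Nonempty → Disjoint W₁ W₂ → W = W₁ ∪ W₂ →
        (∀ h, ¬ (M.origin h ∈ W₁ ∧ M.origin (M.opp h) ∈ W₂)) → M.origin h₀ ∈ W₁ →
        4 * W.card ≤ (M.halfEdgesTouching W).card + 6 := by
      rintro W₁ W₂ hn2 hdis rfl hno ho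
      have hall : ∀ w, M.IsOuterVertex w → w ∈ W₁ := by
        rintro w ⟨h, rfl, hh⟩
        by_contra hcon
        obtain ⟨c, hc1, hc2, hc3⟩ := M.exists_face_step (P := fun h => M.origin h ∈ W₁)
          (hh₀.trans hh.symm) ho hcon
        have h3 := hout (M.origin (M.rot (M.opp c)))
          (isOuterVertex_of_face (by rw [M.face_rot_opp, hc1, hh₀]))
        have h4 := (Finset.mem_union.mp h3).resolve_left hc3
        rw [M.origin_rot] at h4
        exact hno c ⟨hc2, h4⟩
      have hss : W₁ ⊂ W₁ ∪ W₂ := Finset.ssubset_iff_subset_ne.mpr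
        ⟨Finset.subset_union_left, fun h =>
          hn2.ne_empty (Finset.disjoint_self_iff_empty _ |>.mp
          (hdis.mono_left (h ▸ Finset.subset_union_right)))⟩
      have i1 := ih W₁ hss
        (fun h => hss.ne (Finset.Subset.antisymm hss.subset (h ▸ Finset.subset_univ _))) hall
      have i2 := card_touching_of_inner hD hI W₂ (fun w hw ho =>
        Finset.disjoint_left.mp hdis (hall w ho) hw)
      rw [card_touching_union hdis hno, Finset.card_union_of_disjoint hdis]
      omega
    obtain ⟨W₁, W₂, hn1, hn2, hdis, hWu, hno⟩ := exists_split hW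
    rcases Finset.mem_union.mp (hWu ▸ hout _ hv₀ : M.origin h₀ ∈ W₁ ∪ W₂) with ho | ho
    · exact key W₁ W₂ hn2 hdis hWu hno ho
    · refine key W₂ W₁ hn1 hdis.symm (by rw [hWu, Finset.union_comm]) (fun h hh => ?_) ho
      exact hno (M.opp h) ⟨hh.2, by rw [M.opp_opp]; exact hh.1⟩

/-- A nonempty set of `n` inner vertices spans at most `2 n - 2` edges. -/
theorem card_halfEdgesInside_le (hD : M.IsHexagonDissection) (hI : M.IsIrreducible)
    {Y : Finset M.Vertex} (hne : Y.Nonempty) (hin : ∀ w ∈ Y, ¬ M.IsOuterVertex w) :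
    (M.halfEdgesInside Y).card + 4 ≤ 4 * Y.card := by
  -- The edges that are not inside `Y` are those touching its complement.
  have h1 := card_touching_of_outer hD hI Yᶜ (fun h => by
    obtain ⟨y, hy⟩ := hne
    have : y ∈ Yᶜ := h ▸ Finset.mem_univ y
    exact Finset.mem_compl.mp this hy) (fun w hw => Finset.mem_compl.mpr fun h => hin w h hw)
  have h2 : M.halfEdgesInside Y = (M.halfEdgesTouching Yᶜ)ᶜ := by
    ext h
    simp only [mem_halfEdgesInside, Finset.mem_compl, mem_halfEdgesTouching]
    tauto
  have h3 := Finset.card_add_card_compl (M.halfEdgesTouching Yᶜ)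
  rw [← h2] at h3
  have h4 := Finset.card_add_card_compl Y
  have h5 := card_halfEdge hD
  have h6 := card_vertex hD
  omega

/-! ### Balanced sets and their existence by Hall's theorem -/

/-- A set of half-edges, considered as the outward ones, that contains three half-edges at each
inner vertex, none at the outer vertices, and all but one of the inner half-edges that have a given
inner face on their right. -/
structure Balanced (M : PlanarMap H) (S : Set H) : Prop where
  not_outer : ∀ h ∈ S, ¬ M.IsOuterVertex (M.origin h)
  vertex : ∀ v, ¬ M.IsOuterVertex v →
    (Finset.univ.filter fun h => M.origin h = v ∧ h ∈ S).card = 3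
  face : ∀ f, f ≠ M.outer →
    (Finset.univ.filter fun h => M.face h = f ∧ M.IsInner h ∧ h ∉ S).card = 1

/-- The number of inward half-edges at a vertex in a balanced set. -/
noncomputable def demand (M : PlanarMap H) (v : M.Vertex) : ℕ :=
  if M.IsOuterVertex v then (Finset.univ.filter fun h => M.origin h = v ∧ M.IsInner h).card
  else (Finset.univ.filter fun h => M.origin h = v).card - 3

theorem card_halfEdgesAt_eq_sum (W : Finset M.Vertex) : (M.halfEdgesAt W).card =
    ∑ v ∈ W, (Finset.univ.filter fun h => M.origin h = v).card := by
  rw [Finset.card_eq_sum_card_fiberwise (f := M.origin) (t := W)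
    (fun h hh => mem_halfEdgesAt.mp hh)]
  refine Finset.sum_congr rfl fun v hv => ?_
  congr 1
  ext h
  simp only [Finset.mem_filter, Finset.mem_univ, true_and, mem_halfEdgesAt]
  exact ⟨fun h => h.2, fun h => ⟨h ▸ hv, h⟩⟩

theorem three_le_degree (hD : M.IsHexagonDissection) (hI : M.IsIrreducible) {v : M.Vertex}
    (hv : ¬ M.IsOuterVertex v) : 3 ≤ (Finset.univ.filter fun h => M.origin h = v).card := by
  have h1 := card_facesInside_le hD hI {v} (by simpa using hv)
  rw [card_halfEdgesAt_eq_sum, Finset.sum_singleton, Finset.card_singleton] at h1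
  omega

/-- With `F` faces in all there are `4F - 10` inner half-edges, and `3(F - 3)` of them are to be
outward; the remaining `F - 1` match the inner faces. -/
theorem sum_demand (hD : M.IsHexagonDissection) (hI : M.IsIrreducible) :
    ∑ v, M.demand v + 1 = Fintype.card M.Face := by
  have h1 : ∀ v, M.demand v + (if M.IsOuterVertex v then 0 else 3) =
      (Finset.univ.filter fun h => M.origin h = v ∧ M.IsInner h).card := by
    intro v
    unfold demand
    split_ifs with hv
    · rfl
    · have h2 := three_le_degree hD hI hv
      have h3 : (Finset.univ.filter fun h => M.origin h = v ∧ M.IsInner h) =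
          Finset.univ.filter fun h => M.origin h = v := by
        ext h
        simp only [Finset.mem_filter, Finset.mem_univ, true_and, and_iff_left_iff_imp]
        rintro rfl
        exact isInner_of_not_isOuterVertex hv
      rw [h3]
      omega
  have h2 : ∑ v, (Finset.univ.filter fun h => M.origin h = v ∧ M.IsInner h).card =
      (Finset.univ.filter fun h => M.IsInner h).card := by
    rw [Finset.card_eq_sum_card_fiberwise (f := M.origin) (t := Finset.univ)
      (fun h hh => Finset.mem_univ _)]
    refine Finset.sum_congr rfl fun v _ => ?_
    rw [Finset.filter_filter]
    simp only [and_comm]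
  have h3 : ∑ v : M.Vertex, (if M.IsOuterVertex v then 0 else 3) + 18 =
      3 * Fintype.card M.Vertex := by
    have h4 := card_isOuterVertex hD
    have h5 := Finset.card_filter_add_card_filter_not (s := (Finset.univ : Finset M.Vertex))
      M.IsOuterVertex
    rw [h4, Finset.card_univ] at h5
    rw [Finset.sum_ite]
    simp only [Finset.sum_const_zero, zero_add, Finset.sum_const, smul_eq_mul]
    omega
  rw [← Finset.sum_congr rfl fun v _ => h1 v, Finset.sum_add_distrib] at h2
  have h4 := card_isInner hD
  have h5 := card_vertex hD
  have h6 := card_halfEdge hD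
  omega

/-- Hall's condition for assigning to each inner face one of its inner half-edges. -/
theorem card_le_sum_demand (hD : M.IsHexagonDissection) (hI : M.IsIrreducible)
    (s : Finset M.Face) (hs : M.outer ∉ s) :
    s.card ≤ ∑ v ∈ Finset.univ.filter fun v => ∃ h, M.face h ∈ s ∧ M.IsInner h ∧ M.origin h = v,
      M.demand v := by
  set N := Finset.univ.filter fun v => ∃ h, M.face h ∈ s ∧ M.IsInner h ∧ M.origin h = v with hN
  set P : M.Face → Prop := fun f => ∃ h, M.face h = f ∧ M.IsInner h ∧ M.IsOuterVertex (M.origin h)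
    with hP
  -- A face with an inner half-edge at an outer vertex is served there, since the demand of an outer
  -- vertex counts all its inner half-edges. The other faces of `s` have only inner vertices, where
  -- `card_facesInside_le` applies.
  rw [← Finset.sum_filter_add_sum_filter_not N M.IsOuterVertex,
    ← Finset.card_filter_add_card_filter_not (s := s) P]
  refine add_le_add ?_ ?_
  · have h1 : ∑ v ∈ N.filter M.IsOuterVertex, M.demand v =
        (Finset.univ.filter fun h => M.origin h ∈ N.filter M.IsOuterVertex ∧ M.IsInner h).card := by
      rw [Finset.card_eq_sum_card_fiberwise (f := M.origin) (t := N.filter M.IsOuterVertex)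
        (fun h hh => (Finset.mem_filter.mp hh).2.1)]
      refine Finset.sum_congr rfl fun v hv => ?_
      rw [demand, if_pos (Finset.mem_filter.mp hv).2, Finset.filter_filter]
      congr 1
      ext h
      simp only [Finset.mem_filter, Finset.mem_univ, true_and] at hv ⊢
      constructor
      · rintro ⟨rfl, h2⟩
        exact ⟨⟨hv, h2⟩, rfl⟩
      · rintro ⟨⟨_, h2⟩, h3⟩
        exact ⟨h3, h2⟩
    rw [h1]
    have := M.nonempty
    choose! k hk using fun (f : M.Face) (hf : P f) => hf
    refine Finset.card_le_card_of_injOn k (fun f hf => ?_) (fun f hf f' hf' hff' => ?_)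
    · obtain ⟨hf1, hf2⟩ := Finset.mem_filter.mp (Finset.mem_coe.mp hf)
      have := hk f hf2
      simp only [Finset.coe_filter, Finset.mem_univ, true_and, Set.mem_ofPred_eq,
        Finset.mem_filter, hN]
      exact ⟨⟨⟨k f, by rwa [this.1], this.2.1, rfl⟩, this.2.2⟩, this.2.1⟩
    · have h1 := hk f (Finset.mem_filter.mp (Finset.mem_coe.mp hf)).2
      have h2 := hk f' (Finset.mem_filter.mp (Finset.mem_coe.mp hf')).2
      rw [← h1.1, ← h2.1, hff']
  · set W := N.filter fun v => ¬ M.IsOuterVertex v with hW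
    have h1 := card_facesInside_le hD hI W (fun w hw => (Finset.mem_filter.mp hw).2)
    have h2 : (s.filter fun f => ¬ P f) ⊆ M.facesInside W := by
      intro f hf
      obtain ⟨hf1, hf2⟩ := Finset.mem_filter.mp hf
      rw [mem_facesInside]
      rintro h rfl
      have h3 : ¬ M.IsOuterVertex (M.origin h) := fun ho =>
        hf2 (exists_isInner_of_isOuterVertex hD (fun h' => hs (h' ▸ hf1)) ho)
      rw [hW, hN]
      simp only [Finset.mem_filter, Finset.mem_univ, true_and]
      exact ⟨⟨h, hf1, isInner_of_not_isOuterVertex h3, rfl⟩, h3⟩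
    have h3 := Finset.card_le_card h2
    have h4 : (M.halfEdgesAt W).card ≤ ∑ v ∈ W, M.demand v + 3 * W.card := by
      rw [card_halfEdgesAt_eq_sum, mul_comm, ← smul_eq_mul, ← Finset.sum_const,
        ← Finset.sum_add_distrib]
      refine Finset.sum_le_sum fun v hv => ?_
      rw [demand, if_neg (Finset.mem_filter.mp hv).2]
      omega
    omega

/-- Each vertex offers as many slots as its demand, and the inner faces are matched to slots at
their vertices; `z f` is then the inward half-edge of `f`. The totals agree, so every demand is met
exactly, and at outer vertices all inner half-edges become inward. -/
theorem exists_balanced (hD : M.IsHexagonDissection) (hI : M.IsIrreducible) :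
    ∃ S, M.Balanced S := by
  let t : {f : M.Face // f ≠ M.outer} → Finset (Σ v : M.Vertex, Fin (M.demand v)) := fun f =>
    Finset.univ.filter fun a => ∃ h, M.face h = f ∧ M.IsInner h ∧ M.origin h = a.1
  obtain ⟨e, he, het⟩ := (Finset.all_card_le_biUnion_card_iff_exists_injective t).mp (by
    intro s
    have h1 := card_le_sum_demand hD hI (s.image Subtype.val) (by
      intro h
      obtain ⟨f, _, hf⟩ := Finset.mem_image.mp h
      exact f.2 hf)
    rw [Finset.card_image_of_injective _ Subtype.val_injective] at h1
    refine h1.trans (le_of_eq ?_)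
    have h2 : s.biUnion t = (Finset.univ.filter fun v => ∃ h, M.face h ∈ s.image Subtype.val ∧
        M.IsInner h ∧ M.origin h = v).sigma fun v => (Finset.univ : Finset (Fin (M.demand v))) := by
      ext a
      simp only [Finset.mem_biUnion, t, Finset.mem_filter, Finset.mem_univ, true_and,
        Finset.mem_sigma, and_true, Finset.mem_image]
      constructor
      · rintro ⟨f, hf, h, h1, h2, h3⟩
        exact ⟨h, ⟨f, hf, h1.symm⟩, h2, h3⟩
      · rintro ⟨h, ⟨f, hf, h1⟩, h2, h3⟩
        exact ⟨f, hf, h, h1.symm, h2, h3⟩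
    rw [h2, Finset.card_sigma]
    simp)
  have hz : ∀ f : {f : M.Face // f ≠ M.outer}, ∃ h, M.face h = f ∧ M.IsInner h ∧
      M.origin h = (e f).1 := fun f => by simpa [t] using het f
  choose z hz1 hz2 hz3 using hz
  have hzinj : Function.Injective z := fun f f' h => Subtype.ext (by rw [← hz1, ← hz1, h])
  have hle : ∀ v, (Finset.univ.filter fun f => M.origin (z f) = v).card ≤ M.demand v := by
    intro v
    have h1 : ((Finset.univ.filter fun f => M.origin (z f) = v).image e) ⊆
        ({v} : Finset M.Vertex).sigma fun v => (Finset.univ : Finset (Fin (M.demand v))) := by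
      intro a ha
      obtain ⟨f, hf, rfl⟩ := Finset.mem_image.mp ha
      rw [Finset.mem_sigma]
      refine ⟨?_, Finset.mem_univ _⟩
      rw [← hz3, Finset.mem_singleton]
      exact (Finset.mem_filter.mp hf).2
    have h2 := Finset.card_le_card h1
    rw [Finset.card_image_of_injective _ he, Finset.card_sigma] at h2
    simpa using h2
  have heq : ∀ v, (Finset.univ.filter fun f => M.origin (z f) = v).card = M.demand v := by
    have h1 : ∑ v, (Finset.univ.filter fun f => M.origin (z f) = v).card = ∑ v, M.demand v := by
      rw [← Finset.card_eq_sum_card_fiberwise (f := fun f => M.origin (z f))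
        (fun _ _ => Finset.mem_univ _), Finset.card_univ, Fintype.card_subtype_compl,
        Fintype.card_subtype_eq]
      have := sum_demand hD hI
      omega
    exact fun v => (Finset.sum_eq_sum_iff_of_le fun v _ => hle v).mp h1 v (Finset.mem_univ v)
  have heq' : ∀ v, (Finset.univ.filter fun h => M.origin h = v ∧ h ∈ Set.range z).card =
      M.demand v := by
    intro v
    rw [← heq v, ← Finset.card_image_of_injective _ hzinj]
    congr 1
    ext h
    simp only [Finset.mem_filter, Finset.mem_univ, true_and, Finset.mem_image]
    constructor
    · rintro ⟨h1, f, rfl⟩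
      exact ⟨f, h1, rfl⟩
    · rintro ⟨f, h1, rfl⟩
      exact ⟨h1, f, rfl⟩
  have houter : ∀ h, M.IsInner h → M.IsOuterVertex (M.origin h) → h ∈ Set.range z := by
    intro h hin ho
    have h1 := heq' (M.origin h)
    rw [demand, if_pos ho] at h1
    have h2 := Finset.eq_of_subset_of_card_le (s := Finset.univ.filter fun k =>
      M.origin k = M.origin h ∧ k ∈ Set.range z) (t := Finset.univ.filter fun k =>
      M.origin k = M.origin h ∧ M.IsInner k) (by
        intro k hk
        simp only [Finset.mem_filter, Finset.mem_univ, true_and] at hk ⊢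
        obtain ⟨hk1, f, rfl⟩ := hk
        exact ⟨hk1, hz2 f⟩) h1.ge
    have h3 : h ∈ Finset.univ.filter fun k => M.origin k = M.origin h ∧ M.IsInner k := by
      simp [hin]
    rw [← h2] at h3
    exact (Finset.mem_filter.mp h3).2.2
  obtain ⟨S, hS⟩ : ∃ S : Set H, ∀ h, h ∈ S ↔ ¬ M.IsOuterVertex (M.origin h) ∧ h ∉ Set.range z :=
    ⟨{h | ¬ M.IsOuterVertex (M.origin h) ∧ h ∉ Set.range z}, fun _ => Iff.rfl⟩
  refine ⟨S, fun h hh => ((hS h).mp hh).1, ?_, ?_⟩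
  · intro v hv
    have h1 := heq' v
    rw [demand, if_neg hv] at h1
    have h2 := three_le_degree hD hI hv
    have h3 := Finset.card_filter_add_card_filter_not
      (s := Finset.univ.filter fun h => M.origin h = v) (fun h => h ∈ Set.range z)
    rw [Finset.filter_filter, Finset.filter_filter, h1] at h3
    have h4 : (Finset.univ.filter fun h => M.origin h = v ∧ h ∈ S) =
        Finset.univ.filter fun h => M.origin h = v ∧ h ∉ Set.range z := by
      refine Finset.filter_congr fun h _ => and_congr_right ?_
      rintro rfl
      rw [hS]
      exact ⟨fun h => h.2, fun h => ⟨hv, h⟩⟩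
    rw [h4]
    omega
  · intro f hf
    rw [Finset.card_eq_one]
    refine ⟨z ⟨f, hf⟩, Finset.ext fun h => ?_⟩
    rw [Finset.mem_filter, Finset.mem_singleton]
    constructor
    · rintro ⟨_, h1, h2, h3⟩
      have h4 : h ∈ Set.range z := by
        by_contra hcon
        exact h3 ((hS h).mpr ⟨fun ho => hcon (houter h h2 ho), hcon⟩)
      obtain ⟨f', rfl⟩ := h4
      congr 1
      exact Subtype.ext ((hz1 f').symm.trans h1)
    · rintro rfl
      exact ⟨Finset.mem_univ _, hz1 _, hz2 _, fun h => ((hS _).mp h).2 ⟨_, rfl⟩⟩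

/-! ### Clockwise sets of edges and the comparison of balanced sets -/

/-- A set of edges, avoiding the outer vertices, whose boundary is directed clockwise: around each
vertex, one enters it along an inward half-edge and leaves it before an outward one. -/
structure EdgeRegion (M : PlanarMap H) (S B : Set H) : Prop where
  nonempty : B.Nonempty
  opp_mem : ∀ h ∈ B, M.opp h ∈ B
  not_outer : ∀ h ∈ B, ¬ M.IsOuterVertex (M.origin h)
  enter : ∀ h ∈ B, M.rot.symm h ∉ B → h ∉ S
  leave : ∀ h, h ∉ B → M.rot.symm h ∈ B → h ∈ S

/-- A set of inner faces whose boundary is directed clockwise. -/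
structure FaceRegion (M : PlanarMap H) (S : Set H) (R : Set M.Face) : Prop where
  nonempty : R.Nonempty
  outer_notMem : M.outer ∉ R
  cut_subset : ∀ h ∈ M.cut R, h ∈ S

/-- The indicator function of a set of half-edges. -/
noncomputable def hind (S : Set H) (h : H) : ℚ := if h ∈ S then 1 else 0

theorem fiberSum_origin_hind (S : Set H) (v : M.Vertex) : fiberSum M.origin (hind S) v =
    (Finset.univ.filter fun h => M.origin h = v ∧ h ∈ S).card := by
  rw [fiberSum, Finset.card_filter, Nat.cast_sum]
  refine Finset.sum_congr rfl fun h _ => ?_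
  unfold hind
  split_ifs <;> simp_all

theorem fiberSum_face_hind (S : Set H) (f : M.Face) : fiberSum M.face (hind S) f =
    (Finset.univ.filter fun h => M.face h = f ∧ h ∈ S).card := by
  rw [fiberSum, Finset.card_filter, Nat.cast_sum]
  refine Finset.sum_congr rfl fun h _ => ?_
  unfold hind
  split_ifs <;> simp_all

theorem card_face_add {S : Set H} (hS : ∀ h ∈ S, ¬ M.IsOuterVertex (M.origin h)) (f : M.Face) :
    (Finset.univ.filter fun h => M.face h = f ∧ M.IsInner h ∧ h ∉ S).card +
      (Finset.univ.filter fun h => M.face h = f ∧ h ∈ S).card =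
      (Finset.univ.filter fun h => M.face h = f ∧ M.IsInner h).card := by
  rw [← Finset.card_filter_add_card_filter_not
    (s := Finset.univ.filter fun h => M.face h = f ∧ M.IsInner h) (fun h => h ∉ S),
    Finset.filter_filter, Finset.filter_filter]
  congr 2
  · exact Finset.filter_congr fun h _ => by rw [and_assoc]
  · refine Finset.filter_congr fun h _ => ?_
    rw [not_not]
    exact ⟨fun h' => ⟨⟨h'.1, isInner_of_not_isOuterVertex (hS h h'.2)⟩, h'.2⟩,
      fun h' => ⟨h'.1.1, h'.2⟩⟩

theorem Balanced.fiberSum_origin_sub {S S' : Set H} (hS : M.Balanced S) (hS' : M.Balanced S')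
    (v : M.Vertex) : fiberSum M.origin (fun h => hind S h - hind S' h) v = 0 := by
  rw [fiberSum_sub, fiberSum_origin_hind, fiberSum_origin_hind]
  by_cases hv : M.IsOuterVertex v
  · have key : ∀ S, M.Balanced S →
        (Finset.univ.filter fun h => M.origin h = v ∧ h ∈ S) = ∅ := by
      intro S hS
      refine Finset.filter_eq_empty_iff.mpr fun h _ => ?_
      rintro ⟨rfl, h2⟩
      exact hS.not_outer h h2 hv
    rw [key S hS, key S' hS', sub_self]
  · rw [hS.vertex v hv, hS'.vertex v hv, sub_self]

theorem Balanced.fiberSum_face_sub {S S' : Set H} (hS : M.Balanced S) (hS' : M.Balanced S')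
    (f : M.Face) : fiberSum M.face (fun h => hind S h - hind S' h) f = 0 := by
  rw [fiberSum_sub, fiberSum_face_hind, fiberSum_face_hind]
  by_cases hf : f = M.outer
  · have key : ∀ S, M.Balanced S →
        (Finset.univ.filter fun h => M.face h = f ∧ h ∈ S) = ∅ := by
      intro S hS
      refine Finset.filter_eq_empty_iff.mpr fun h _ => ?_
      rintro ⟨h1, h2⟩
      exact hS.not_outer h h2 (isOuterVertex_of_face (h1.trans hf))
    rw [key S hS, key S' hS', sub_self]
  · have h1 := card_face_add hS.not_outer f
    have h2 := card_face_add hS'.not_outer f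
    rw [hS.face f hf] at h1
    rw [hS'.face f hf] at h2
    rw [sub_eq_zero, Nat.cast_inj]
    omega

/-- A potential is constant on the edges that meet the outer face. -/
theorem potential_eq_of_isOuterVertex {p y : H → ℚ} (hp : ∀ h, p (M.opp h) = p h)
    (hy : ∀ h, y h = p h - p (M.rot.symm h)) (hy0 : ∀ h, M.IsOuterVertex (M.origin h) → y h = 0)
    {h k : H} (hh : M.IsOuterVertex (M.origin h)) (hk : M.IsOuterVertex (M.origin k)) :
    p h = p k := by
  have hrot : ∀ a, M.IsOuterVertex (M.origin a) → p (M.rot a) = p a := by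
    intro a ha
    have h1 := hy (M.rot a)
    rw [hy0 _ (by rwa [M.origin_rot]), Equiv.symm_apply_apply] at h1
    linarith
  have hvert : ∀ a b, M.origin a = M.origin b → M.IsOuterVertex (M.origin a) → p b = p a := by
    intro a b hab ha
    by_contra hcon
    obtain ⟨c, hc1, hc2, hc3⟩ := M.exists_rot_step (P := fun h => p h = p a) hab rfl hcon
    exact hc3 (by rw [hrot c (hc1 ▸ ha)]; exact hc2)
  have hface : ∀ a b, M.face a = M.outer → M.face b = M.outer → p b = p a := by
    intro a b ha hb
    by_contra hcon
    obtain ⟨c, hc1, hc2, hc3⟩ := M.exists_face_step (P := fun h => p h = p a) (ha.trans hb.symm)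
      rfl hcon
    refine hc3 ?_
    rw [hrot _ (isOuterVertex_of_face_opp (by rw [M.opp_opp, hc1, ha])), hp]
    exact hc2
  obtain ⟨a, ha1, ha2⟩ := hh
  obtain ⟨b, hb1, hb2⟩ := hk
  rw [hvert a h ha1 (isOuterVertex_of_face ha2), hvert b k hb1 (isOuterVertex_of_face hb2),
    hface b a hb2 ha2]

/-- The region is the set where `p` is maximal. Entering it `p` increases, so the half-edge is in
`S` and not in `S'`; leaving it, the opposite holds. The value `p h₁` exceeds the common value of
`p` at the outer vertices, which keeps the region away from them. -/
theorem Balanced.edgeRegion_of_potential {S S' : Set H} (hS : M.Balanced S) (hS' : M.Balanced S')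
    {p : H → ℚ} (hp : ∀ h, p (M.opp h) = p h)
    (hy : ∀ h, hind S h - hind S' h = p h - p (M.rot.symm h))
    {h₀ h₁ : H} (hh₀ : M.face h₀ = M.outer) (hlt : p h₀ < p h₁) :
    ∃ B, M.EdgeRegion S' B := by
  have := M.nonempty
  obtain ⟨m, hm⟩ := Finite.exists_max p
  have hy0 : ∀ h, M.IsOuterVertex (M.origin h) → hind S h - hind S' h = 0 := by
    intro h hh
    have h1 : h ∉ S := fun h' => hS.not_outer h h' hh
    have h2 : h ∉ S' := fun h' => hS'.not_outer h h' hh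
    simp [hind, h1, h2]
  refine ⟨{h | p h = p m}, ⟨m, rfl⟩, fun h hh => (hp h).trans hh, ?_, ?_, ?_⟩
  · intro h hh ho
    have h1 := potential_eq_of_isOuterVertex hp hy hy0 ho (isOuterVertex_of_face hh₀)
    have h2 : p h = p m := hh
    have h3 := hm h₁
    linarith
  · intro h hh hh' hS'
    have h1 := hy h
    have h2 : p h = p m := hh
    have h3 : p (M.rot.symm h) < p m := lt_of_le_of_ne (hm _) hh'
    have h4 : hind S' h = 1 := if_pos hS'
    have h5 : hind S h ≤ 1 := by unfold hind; split_ifs <;> norm_num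
    linarith
  · intro h hh hh'
    by_contra hS'
    have h1 := hy h
    have h2 : p (M.rot.symm h) = p m := hh'
    have h3 : p h < p m := lt_of_le_of_ne (hm _) hh
    have h4 : hind S' h = 0 := if_neg hS'
    have h5 : 0 ≤ hind S h := by unfold hind; split_ifs <;> norm_num
    linarith

/-- If two balanced sets differ, one of them has a clockwise set of edges. -/
theorem Balanced.exists_edgeRegion {S S' : Set H} (hS : M.Balanced S) (hS' : M.Balanced S')
    (hne : S ≠ S') : (∃ B, M.EdgeRegion S B) ∨ ∃ B, M.EdgeRegion S' B := by
  obtain ⟨p, hp, hy⟩ := M.exists_potential_of_sums_eq_zero _ (hS.fiberSum_origin_sub hS')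
    (hS.fiberSum_face_sub hS')
  obtain ⟨h₀, hh₀⟩ := M.face_surjective M.outer
  by_cases h1 : ∃ h₁, p h₀ < p h₁
  · obtain ⟨h₁, hlt⟩ := h1
    exact Or.inr (hS.edgeRegion_of_potential hS' hp hy hh₀ hlt)
  by_cases h2 : ∃ h₁, p h₁ < p h₀
  · obtain ⟨h₁, hlt⟩ := h2
    refine Or.inl (hS'.edgeRegion_of_potential hS (p := fun h => - p h) (h₁ := h₁)
      (fun h => by simp only [hp]) (fun h => ?_) hh₀ (neg_lt_neg hlt))
    have := hy h
    linarith
  exfalso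
  push Not at h1 h2
  have hconst : ∀ h, p h = p h₀ := fun h => le_antisymm (h1 h) (h2 h)
  refine hne (Set.ext fun h => ?_)
  have h3 := hy h
  rw [hconst h, hconst (M.rot.symm h), sub_self] at h3
  by_cases hs : h ∈ S <;> by_cases hs' : h ∈ S' <;> simp [hind, hs, hs'] at h3 ⊢

/-- Turning the boundary of a clockwise set of edges. -/
theorem EdgeRegion.exists_balanced {S B : Set H} (hS : M.Balanced S) (hB : M.EdgeRegion S B) :
    ∃ S', M.Balanced S' ∧ ∀ h, hind S' h = hind S h + (hind B h - hind B (M.rot.symm h)) := by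
  obtain ⟨S', hS'⟩ : ∃ S' : Set H, ∀ h, h ∈ S' ↔
      (h ∈ S ∧ ¬ (h ∉ B ∧ M.rot.symm h ∈ B)) ∨ (h ∈ B ∧ M.rot.symm h ∉ B) :=
    ⟨{h | (h ∈ S ∧ ¬ (h ∉ B ∧ M.rot.symm h ∈ B)) ∨ (h ∈ B ∧ M.rot.symm h ∉ B)}, fun _ => Iff.rfl⟩
  have hind' : ∀ h, hind S' h = hind S h + (hind B h - hind B (M.rot.symm h)) := by
    intro h
    have h1 := hB.enter h
    have h2 := hB.leave h
    by_cases a : h ∈ B <;> by_cases b : M.rot.symm h ∈ B <;> simp [hind, hS', a, b]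
    · simpa using h1 a b
    · simp [h2 a b]
  have hsym : ∀ h, hind B (M.opp h) = hind B h := by
    intro h
    have : M.opp h ∈ B ↔ h ∈ B :=
      ⟨fun h' => by have := hB.opp_mem _ h'; rwa [M.opp_opp] at this, hB.opp_mem h⟩
    simp only [hind, this]
  have hfun : hind S' = fun h => hind S h + (hind B h - hind B (M.rot.symm h)) := funext hind'
  have hnot : ∀ h ∈ S', ¬ M.IsOuterVertex (M.origin h) := by
    intro h hh
    rcases (hS' h).mp hh with h1 | h1
    · exact hS.not_outer h h1.1
    · exact hB.not_outer h h1.1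
  refine ⟨S', ⟨hnot, ?_, ?_⟩, hind'⟩
  · intro v hv
    have h1 : fiberSum M.origin (hind S') v = fiberSum M.origin (hind S) v := by
      rw [hfun, fiberSum_add, fiberSum_sub,
        fiberSum_comp_perm M.origin M.rot.symm M.origin_rot_symm (hind B)]
      ring
    rw [fiberSum_origin_hind, fiberSum_origin_hind, Nat.cast_inj] at h1
    rw [h1, hS.vertex v hv]
  · intro f hf
    have h1 : fiberSum M.face (hind S') f = fiberSum M.face (hind S) f := by
      rw [hfun, fiberSum_add, fiberSum_sub, M.fiberSum_face_rot_symm (hind B) hsym]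
      ring
    rw [fiberSum_face_hind, fiberSum_face_hind, Nat.cast_inj] at h1
    have h2 := card_face_add hnot f
    have h3 := card_face_add hS.not_outer f
    rw [hS.face f hf] at h3
    omega

/-- Potentials are taken relative to a fixed balanced set and normalised at an outer half-edge. A
balanced set with the largest total potential works, because turning an edge region would add its
indicator function. -/
theorem exists_balanced_without_edgeRegion (hD : M.IsHexagonDissection) (hI : M.IsIrreducible) :
    ∃ S, M.Balanced S ∧ ∀ B, ¬ M.EdgeRegion S B := by
  obtain ⟨S₀, hS₀⟩ := exists_balanced hD hI
  obtain ⟨h₀, hh₀⟩ := M.face_surjective M.outer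
  have hv₀ := isOuterVertex_of_face hh₀
  have hex : ∀ S, M.Balanced S → ∃ p : H → ℚ, (∀ h, p (M.opp h) = p h) ∧ p h₀ = 0 ∧
      ∀ h, hind S h - hind S₀ h = p h - p (M.rot.symm h) := by
    intro S hS
    obtain ⟨p, hp, hy⟩ := M.exists_potential_of_sums_eq_zero _ (hS.fiberSum_origin_sub hS₀)
      (hS.fiberSum_face_sub hS₀)
    exact ⟨fun h => p h - p h₀, fun h => by simp only [hp], sub_self _, fun h => by rw [hy]; ring⟩
  choose! p hp hp0 hy using hex
  obtain ⟨S, hS, hmax⟩ := Set.Finite.exists_maximalFor (fun S => ∑ h, p S h) {S | M.Balanced S}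
    (Set.toFinite _) ⟨S₀, hS₀⟩
  refine ⟨S, hS, fun B hB => ?_⟩
  obtain ⟨S', hS', hind'⟩ := hB.exists_balanced hS
  have hsym : ∀ h, hind B (M.opp h) = hind B h := by
    intro h
    have : M.opp h ∈ B ↔ h ∈ B :=
      ⟨fun h' => by have := hB.opp_mem _ h'; rwa [M.opp_opp] at this, hB.opp_mem h⟩
    simp only [hind, this]
  have hB0 : hind B h₀ = 0 := if_neg fun h => hB.not_outer h₀ h hv₀
  have hpS : ∀ h, p S' h = p S h + hind B h := by
    intro h
    have h1 := M.const_of_rot_of_opp (fun h => p S' h - (p S h + hind B h))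
      (fun h => by
        have e1 := hy S' hS' (M.rot h)
        have e2 := hy S hS (M.rot h)
        have e3 := hind' (M.rot h)
        rw [Equiv.symm_apply_apply] at e1 e2 e3
        linarith)
      (fun h => by simp only [hp S' hS', hp S hS, hsym]) h h₀
    simp only [hp0 S' hS', hp0 S hS, hB0] at h1
    linarith
  have hlt : ∑ h, p S h < ∑ h, p S' h := by
    obtain ⟨b, hb⟩ := hB.nonempty
    have h1 : 0 < ∑ h, hind B h := Finset.sum_pos'
      (fun h _ => by unfold hind; split_ifs <;> norm_num)
      ⟨b, Finset.mem_univ b, by rw [hind, if_pos hb]; norm_num⟩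
    rw [Finset.sum_congr rfl fun h _ => hpS h, Finset.sum_add_distrib]
    linarith
  exact absurd (hmax hS' hlt.le) (not_le.mpr hlt)

/-- In a balanced set, the inward half-edge of a face is unique. -/
theorem Balanced.eq_of_face_eq {S : Set H} (hS : M.Balanced S) {h k : H} (hhk : M.face h = M.face k)
    (hh : M.IsInner h) (hk : M.IsInner k) (hhS : h ∉ S) (hkS : k ∉ S) : h = k := by
  have h1 := hS.face (M.face k) hk.1
  rw [Finset.card_eq_one] at h1
  obtain ⟨a, ha⟩ := h1
  have h2 : h ∈ ({a} : Finset H) := by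
    rw [← ha, Finset.mem_filter]
    exact ⟨Finset.mem_univ _, hhk, hh, hhS⟩
  have h3 : k ∈ ({a} : Finset H) := by
    rw [← ha, Finset.mem_filter]
    exact ⟨Finset.mem_univ _, rfl, hk, hkS⟩
  rw [Finset.mem_singleton.mp h2, Finset.mem_singleton.mp h3]

theorem Balanced.exists_notMem {S : Set H} (hS : M.Balanced S) {f : M.Face} (hf : f ≠ M.outer) :
    ∃ h, M.face h = f ∧ M.IsInner h ∧ h ∉ S := by
  have h1 := hS.face f hf
  rw [Finset.card_eq_one] at h1
  obtain ⟨a, ha⟩ := h1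
  have h2 : a ∈ ({a} : Finset H) := Finset.mem_singleton_self a
  rw [← ha, Finset.mem_filter] at h2
  exact ⟨a, h2.2⟩

/-- The faces along a clockwise set of edges form a clockwise set of faces. -/
theorem EdgeRegion.faceRegion (hD : M.IsHexagonDissection) {S B : Set H} (hS : M.Balanced S)
    (hB : M.EdgeRegion S B) : M.FaceRegion S (M.face '' B) := by
  have hout : M.outer ∉ M.face '' B := by
    rintro ⟨b, hb, hb'⟩
    exact hB.not_outer b hb (isOuterVertex_of_face hb')
  refine ⟨hB.nonempty.image _, hout, fun h hh => ?_⟩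
  obtain ⟨⟨b, hb, hbf⟩, h2⟩ := mem_cut.mp hh
  have hhB : h ∉ B := fun h' => h2 ⟨_, hB.opp_mem h h', rfl⟩
  -- Where the contour of the face enters `B` there is an inward half-edge `g`. It is the only inner
  -- one of this face, so `h` must be outward.
  obtain ⟨c, hc1, hc2, hc3⟩ := M.exists_face_step (P := fun h => h ∉ B) hbf.symm hhB
    (not_not.mpr hb)
  rw [not_not] at hc3
  set g := M.rot (M.opp c) with hg
  have hgS : g ∉ S := hB.enter g hc3 (by
    rw [hg, Equiv.symm_apply_apply]
    exact fun h' => hc2 (by have := hB.opp_mem _ h'; rwa [M.opp_opp] at this))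
  have hgo := hB.not_outer g hc3
  have hgf : M.face g = M.face h := by rw [hg, M.face_rot_opp, hc1]
  have hhf : M.face h ≠ M.outer := fun h' => hout (h' ▸ (mem_cut.mp hh).1)
  have hho : ¬ M.IsOuterVertex (M.origin h) := by
    intro ho
    obtain ⟨k, hk1, hk2, hk3⟩ := exists_isInner_of_isOuterVertex hD hhf ho
    have := hS.eq_of_face_eq (hgf.trans hk1.symm) (isInner_of_not_isOuterVertex hgo) hk2 hgS
      (fun h' => hS.not_outer k h' hk3)
    exact hgo (this ▸ hk3)
  by_contra hhS
  have := hS.eq_of_face_eq hgf (isInner_of_not_isOuterVertex hgo)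
    (isInner_of_not_isOuterVertex hho) hgS hhS
  exact hhB (this ▸ hc3)

/-! ### Clockwise cycles and clockwise sets of faces -/

theorem passes_nonneg {n : ℕ} (c : Fin n → H) (h : H) : 0 ≤ passes c h :=
  Finset.sum_nonneg fun i _ => by split_ifs <;> norm_num

theorem passes_eq_zero {n : ℕ} {c : Fin n → H} {h : H} (hh : h ∉ Set.range c) : passes c h = 0 :=
  Finset.sum_eq_zero fun i _ => if_neg fun h' => hh ⟨i, h'.symm⟩

theorem fiberSum_passes {n : ℕ} {V : Type*} (o : H → V) (d : Fin n → H) (v : V) :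
    fiberSum o (fun h => passes d h) v = ∑ i, if o (d i) = v then 1 else 0 := by
  have h0 : ∀ h, (if o h = v then passes d h else 0) =
      ∑ i, if o h = v then (if h = d i then (1 : ℚ) else 0) else 0 := by
    intro h
    split_ifs
    · rfl
    · simp
  rw [fiberSum, Finset.sum_congr rfl fun h _ => h0 h, Finset.sum_comm]
  refine Finset.sum_congr rfl fun i _ => ?_
  rw [Finset.sum_eq_single (d i) (fun h _ hh => by simp [hh]) (by simp)]
  simp

/-- A closed walk has no boundary. -/
theorem fiberSum_passes_sub {n : ℕ} [NeZero n] {c : Fin n → H}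
    (hc : ∀ i, M.origin (M.opp (c i)) = M.origin (c (i + 1))) (v : M.Vertex) :
    fiberSum M.origin (fun h => passes c h - passes c (M.opp h)) v = 0 := by
  have h2 : (fun h => passes c (M.opp h)) = fun h => passes (fun i => M.opp (c i)) h := by
    funext h
    simp only [passes, M.opp_eq_iff]
  rw [fiberSum_sub, h2, fiberSum_passes, fiberSum_passes, sub_eq_zero]
  simp only [hc]
  convert (Equiv.sum_comp (Equiv.addRight (1 : Fin n))
    (fun i => if M.origin (c i) = v then (1 : ℚ) else 0)).symm
  rfl

theorem IsSimpleCycle.exists_potential {n : ℕ} [NeZero n] {c : Fin n → H}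
    (hc : M.IsSimpleCycle c) : ∃ g : M.Face → ℚ, g M.outer = 0 ∧
      ∀ h, passes c h - passes c (M.opp h) = g (M.face h) - g (M.face (M.opp h)) :=
  M.exists_potential_of_boundary_eq_zero (passes c) (fiberSum_passes_sub hc.chain)

theorem eq_of_adjacentOff {n : ℕ} {c : Fin n → H} {g : M.Face → ℚ}
    (hg : ∀ h, passes c h - passes c (M.opp h) = g (M.face h) - g (M.face (M.opp h)))
    {f f' : M.Face} (hff' : Relation.ReflTransGen (M.AdjacentOff c) f f') : g f' = g f := by
  induction hff' with
  | refl => rfl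
  | tail _ hbc ih =>
    obtain ⟨h, h1, h2, rfl, rfl⟩ := hbc
    have h3 := hg h
    rw [passes_eq_zero h1, passes_eq_zero h2] at h3
    rw [← ih]
    linarith

/-- A clockwise set of faces yields a clockwise simple cycle. -/
theorem FaceRegion.exists_cycle {S : Set H} {R : Set M.Face} (hR : M.FaceRegion S R) :
    ∃ (n : ℕ) (_ : NeZero n) (c : Fin n → H), M.IsSimpleCycle c ∧
      (∀ i, M.InInterior c (M.face (c i))) ∧ ∀ i, c i ∈ S := by
  obtain ⟨R₁, hR₁⟩ := (Set.toFinite {R : Set M.Face | M.FaceRegion S R}).exists_maximal ⟨R, hR⟩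
  clear hR R
  obtain ⟨hR, hmax⟩ := hR₁
  generalize R₁ = R at *
  replace hR : M.FaceRegion S R := hR
  have := M.nonempty
  have hex : ∀ v : M.Vertex, (∃ k ∈ M.cut R, M.origin k = v) → ∃ k, k ∈ M.cut R ∧ M.origin k = v :=
    fun v hv => hv
  choose! a ha1 ha2 using hex
  obtain ⟨k₀, hk₀⟩ := cut_nonempty hR.nonempty hR.outer_notMem
  let σ : M.Vertex → M.Vertex := fun v => M.origin (M.opp (a v))
  have hσ : ∀ n, ∃ k ∈ M.cut R, M.origin k = σ^[n] (M.origin k₀) := by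
    intro n
    induction n with
    | zero => exact ⟨k₀, hk₀, rfl⟩
    | succ n ih =>
      rw [Function.iterate_succ_apply']
      exact exists_cut_succ (ha1 _ ih)
  obtain ⟨m, l, hml, heq⟩ := Finite.exists_ne_map_eq_of_infinite
    (fun n : ℕ => σ^[n] (M.origin k₀))
  obtain ⟨u, hu, hper⟩ : ∃ u, (∀ n, ∃ k ∈ M.cut R, M.origin k = σ^[n] u) ∧
      u ∈ Function.periodicPts σ := by
    have key : ∀ m l : ℕ, m < l → σ^[m] (M.origin k₀) = σ^[l] (M.origin k₀) →
        ∃ u, (∀ n, ∃ k ∈ M.cut R, M.origin k = σ^[n] u) ∧ u ∈ Function.periodicPts σ := by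
      intro m l hml heq
      refine ⟨σ^[m] (M.origin k₀), fun n => ?_, l - m, by omega, ?_⟩
      · rw [← Function.iterate_add_apply]
        exact hσ _
      · rw [Function.IsPeriodicPt, Function.IsFixedPt, ← Function.iterate_add_apply,
          Nat.sub_add_cancel hml.le, heq]
    rcases lt_or_gt_of_ne hml with h | h
    · exact key m l h heq
    · exact key l m h heq.symm
  have hpos := Function.minimalPeriod_pos_of_mem_periodicPts hper
  set n := Function.minimalPeriod σ u with hn
  have : NeZero n := ⟨hpos.ne'⟩
  let c : Fin n → H := fun i => a (σ^[i.val] u)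
  have hcut : ∀ i, c i ∈ M.cut R := fun i => ha1 _ (hu i.val)
  have horg : ∀ i, M.origin (c i) = σ^[i.val] u := fun i => ha2 _ (hu i.val)
  have hsimple : M.IsSimpleCycle c := by
    refine ⟨fun i => ?_, fun i j hij => ?_, fun i j hij => ?_⟩
    · rw [horg, Fin.val_add, Fin.val_one', Nat.add_mod_mod, Function.iterate_mod_minimalPeriod_eq,
        Function.iterate_succ_apply']
    · simp only [horg] at hij
      exact Fin.ext (Function.iterate_injOn_Iio_minimalPeriod i.2 j.2 hij)
    · exact opp_notMem_cut (hcut i) (hij ▸ hcut j)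
  obtain ⟨g, hg0, hg⟩ := hsimple.exists_potential
  -- Adding the faces of negative potential keeps the set clockwise: outside `R`, an arc from
  -- negative to nonnegative potential is the reverse of an arc of `c`, and so would end up in `R`.
  -- By maximality nothing is added. Hence `g` is nonnegative on the left of `c` and positive on its
  -- right, out of reach of the outer face.
  have hneg : {f | g f < 0} ⊆ R := by
    refine Set.subset_union_right.trans (hmax (y := R ∪ {f | g f < 0}) ⟨?_, ?_, ?_⟩
      Set.subset_union_left)
    · exact hR.nonempty.mono Set.subset_union_left
    · rintro (h | h)
      · exact hR.outer_notMem h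
      · exact absurd h (by simp [hg0])
    · intro h hh
      obtain ⟨h1, h2⟩ := mem_cut.mp hh
      simp only [Set.mem_union, Set.mem_ofPred_eq, not_or, not_lt] at h1 h2
      by_cases h3 : M.face h ∈ R
      · exact hR.cut_subset h (mem_cut.mpr ⟨h3, h2.1⟩)
      · exfalso
        have h4 := h1.resolve_left h3
        have h5 : M.opp h ∉ Set.range c := by
          rintro ⟨i, hi⟩
          exact h2.1 (hi ▸ (mem_cut.mp (hcut i)).1)
        have h6 := hg h
        rw [passes_eq_zero h5] at h6
        have := passes_nonneg c h
        linarith [h2.2]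
  refine ⟨n, ‹_›, c, hsimple, fun i hreach => ?_, fun i => hR.cut_subset _ (hcut i)⟩
  have h1 := eq_of_adjacentOff hg hreach
  have h2 : 0 ≤ g (M.face (M.opp (c i))) := by
    by_contra hcon
    exact (mem_cut.mp (hcut i)).2 (hneg (not_le.mp hcon))
  have h3 := hg (c i)
  rw [passes_of_injective hsimple.injective, if_pos ⟨i, rfl⟩, passes_eq_zero (fun ⟨j, hj⟩ =>
    hsimple.edges_distinct i j hj)] at h3
  linarith

/-- A clockwise simple cycle yields a clockwise set of faces. -/
theorem IsSimpleCycle.exists_faceRegion {S : Set H} {n : ℕ} [NeZero n] {c : Fin n → H}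
    (hc : M.IsSimpleCycle c) (hright : ∀ i, M.InInterior c (M.face (c i))) (hS : ∀ i, c i ∈ S) :
    ∃ R, M.FaceRegion S R := by
  obtain ⟨g, hg0, hg⟩ := hc.exists_potential
  refine ⟨{f | 0 < g f}, ?_, by simp [hg0], ?_⟩
  · by_contra hcon
    rw [Set.not_nonempty_iff_eq_empty] at hcon
    have hle : ∀ f, g f ≤ 0 := fun f => not_lt.mp fun h =>
      (Set.eq_empty_iff_forall_notMem.mp hcon f) h
    -- Leaving the faces reachable from the outer one means crossing `c`, necessarily from its left
    -- to its right, where the potential rises from 0 to 1.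
    obtain ⟨h, h1, h2⟩ := M.exists_boundary
      (R := {f | Relation.ReflTransGen (M.AdjacentOff c) M.outer f}) (f := M.outer)
      (g := M.face (c 0)) Relation.ReflTransGen.refl (hright 0)
    by_cases h3 : h ∈ Set.range c
    · obtain ⟨i, rfl⟩ := h3
      exact hright i h1
    by_cases h4 : M.opp h ∈ Set.range c
    · obtain ⟨i, hi⟩ := h4
      have h5 := hg (c i)
      rw [passes_of_injective hc.injective, if_pos ⟨i, rfl⟩, passes_eq_zero (fun ⟨j, hj⟩ =>
        hc.edges_distinct i j hj), hi, M.opp_opp, eq_of_adjacentOff hg h1, hg0] at h5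
      linarith [hle (M.face (M.opp h))]
    · exact h2 (Relation.ReflTransGen.tail h1 ⟨h, h3, h4, rfl, rfl⟩)
  · intro h hh
    obtain ⟨h1, h2⟩ := mem_cut.mp hh
    simp only [Set.mem_ofPred_eq, not_lt] at h1 h2
    by_contra hcon
    have h3 : h ∉ Set.range c := by
      rintro ⟨i, rfl⟩
      exact hcon (hS i)
    have h4 := hg h
    rw [passes_eq_zero h3] at h4
    have := passes_nonneg c (M.opp h)
    linarith

/-! ### Minimal clockwise regions -/

/-- A set of faces together with the holes that it surrounds. -/
def fill (M : PlanarMap H) (R : Set M.Face) : Set M.Face :=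
  {f | ¬ Relation.ReflTransGen
    (fun f g => g ∉ R ∧ ∃ h, M.face h = f ∧ M.face (M.opp h) = g) M.outer f}

theorem outer_notMem_fill (R : Set M.Face) : M.outer ∉ M.fill R :=
  fun h => h Relation.ReflTransGen.refl

theorem subset_fill {R : Set M.Face} (hR : M.outer ∉ R) : R ⊆ M.fill R := by
  intro f hf hreach
  cases hreach with
  | refl => exact hR hf
  | tail _ hbc => exact hbc.1 hf

theorem fill_mono {P R : Set M.Face} (hPR : P ⊆ R) : M.fill P ⊆ M.fill R :=
  fun _ hf hreach => hf (Relation.ReflTransGen.mono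
    (fun _ _ hab => ⟨fun h => hab.1 (hPR h), hab.2⟩) _ _ hreach)

theorem mem_of_mem_cut_fill {R : Set M.Face} {h : H} (hh : h ∈ M.cut (M.fill R)) :
    M.face h ∈ R := by
  obtain ⟨h1, h2⟩ := mem_cut.mp hh
  by_contra hcon
  exact h1 ((not_not.mp h2).tail ⟨hcon, M.opp h, rfl, by rw [M.opp_opp]⟩)

theorem fill_fill (R : Set M.Face) : M.fill (M.fill R) = M.fill R := by
  refine Set.Subset.antisymm (fun f hf hreach => hf ?_) (subset_fill (outer_notMem_fill R))
  clear hf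
  induction hreach with
  | refl => exact Relation.ReflTransGen.refl
  | tail hab hbc ih =>
    exact ih.tail ⟨fun h => h (hab.tail hbc), hbc.2⟩

/-- The contour of the filled set is part of the contour of `R`. -/
theorem FaceRegion.fill {S : Set H} {R : Set M.Face} (hR : M.FaceRegion S R) :
    M.FaceRegion S (M.fill R) := by
  refine ⟨hR.nonempty.mono (subset_fill hR.outer_notMem), outer_notMem_fill R, fun h hh => ?_⟩
  exact hR.cut_subset h (mem_cut.mpr ⟨mem_of_mem_cut_fill hh,
    fun h' => (mem_cut.mp hh).2 (subset_fill hR.outer_notMem h')⟩)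

/-- A clockwise set of faces without holes, minimal as such. -/
structure MinimalRegion (M : PlanarMap H) (S : Set H) (R : Set M.Face) : Prop
    extends M.FaceRegion S R where
  fill_eq : M.fill R = R
  minimal : ∀ P, M.FaceRegion S P → M.fill P = P → P ⊆ R → R ⊆ P

theorem FaceRegion.exists_minimalRegion {S : Set H} {R : Set M.Face} (hR : M.FaceRegion S R) :
    ∃ P, M.MinimalRegion S P := by
  obtain ⟨P, hP⟩ := (Set.toFinite {P : Set M.Face | M.FaceRegion S P ∧ M.fill P = P}).exists_minimal
    ⟨M.fill R, hR.fill, fill_fill R⟩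
  exact ⟨P, { hP.prop.1 with
    fill_eq := hP.prop.2
    minimal := fun Q hQ hQ' hQP => hP.le_of_le ⟨hQ, hQ'⟩ hQP }⟩

/-- An outer vertex on `R` would be the start of an arc of the contour, hence of an outward
half-edge. -/
theorem FaceRegion.not_isOuterVertex {S : Set H} {R : Set M.Face} (hS : M.Balanced S)
    (hR : M.FaceRegion S R) {h : H} (hh : M.face h ∈ R) : ¬ M.IsOuterVertex (M.origin h) := by
  rintro ⟨k, hk1, hk2⟩
  obtain ⟨l, hl1, hl2⟩ := exists_mem_cut_of_origin_eq (R := R) hk1.symm hh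
    (hk2 ▸ hR.outer_notMem)
  refine hS.not_outer l (hR.cut_subset l hl1) ?_
  rw [hl2]
  exact ⟨k, hk1, hk2⟩

/-- The faces where `φ` is positive form a clockwise set inside `R`. Filled, it equals `R` by
minimality, so the faces along the contour of `R` are themselves positive. -/
theorem MinimalRegion.pos_of_mem_cut {S : Set H} {R : Set M.Face} (hR : M.MinimalRegion S R)
    {φ : M.Face → ℚ} (hφ : ∀ f ∉ R, φ f = 0)
    (hdir : ∀ h, φ (M.face (M.opp h)) < φ (M.face h) → h ∈ S) {f : M.Face} (hf : 0 < φ f)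
    {h : H} (hh : h ∈ M.cut R) : 0 < φ (M.face h) := by
  obtain ⟨P, hP⟩ : ∃ P : Set M.Face, ∀ f, f ∈ P ↔ 0 < φ f := ⟨{f | 0 < φ f}, fun _ => Iff.rfl⟩
  have hPR : P ⊆ R := fun f hf => by
    by_contra hcon
    exact ((hP f).mp hf).ne' (hφ f hcon)
  have hreg : M.FaceRegion S P := by
    refine ⟨⟨f, (hP f).mpr hf⟩, fun h' => hR.outer_notMem (hPR h'), fun k hk => hdir k ?_⟩
    obtain ⟨h1, h2⟩ := mem_cut.mp hk
    rw [hP] at h1 h2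
    exact lt_of_le_of_lt (not_lt.mp h2) h1
  have hsub : M.fill P ⊆ R := (fill_mono hPR).trans hR.fill_eq.subset
  have heq : M.fill P = R :=
    Set.Subset.antisymm hsub (hR.minimal _ hreg.fill (fill_fill P) hsub)
  rw [← heq] at hh
  exact (hP _).mp (mem_of_mem_cut_fill hh)

/-- Without holes, every face off `R` is joined to the outer face by a path of faces off `R`. -/
theorem MinimalRegion.eq_zero {S : Set H} {R : Set M.Face} (hR : M.MinimalRegion S R)
    {φ : M.Face → ℚ} (h0 : φ M.outer = 0) (hφ : ∀ h, M.face h ∉ R → M.face (M.opp h) ∉ R →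
      φ (M.face h) = φ (M.face (M.opp h))) {f : M.Face} (hf : f ∉ R) : φ f = 0 := by
  rw [← hR.fill_eq] at hf
  replace hf := not_not.mp hf
  induction hf with
  | refl => exact h0
  | tail hab hbc ih =>
    obtain ⟨hc, h, rfl, rfl⟩ := hbc
    have hb : M.face h ∉ R := by
      rw [← hR.fill_eq]
      exact not_not.mpr hab
    rw [← hφ h hb hc, ih]

/-- A clockwise circulation in a minimal region that avoids an edge of the boundary has a
nonpositive potential. -/
theorem MinimalRegion.exists_potential {S : Set H} {R : Set M.Face} (hR : M.MinimalRegion S R)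
    {z : H → ℚ} (hz : ∀ v, fiberSum M.origin (fun h => z h - z (M.opp h)) v = 0)
    (hsupp : ∀ h, M.face h ∉ R → z h = 0 ∧ z (M.opp h) = 0 ∨ M.face (M.opp h) ∈ R)
    (hdir : ∀ h, z (M.opp h) < z h → h ∈ S)
    (hcut : ∃ h ∈ M.cut R, z h = z (M.opp h)) :
    ∃ φ : M.Face → ℚ, (∀ f ∉ R, φ f = 0) ∧ (∀ f, φ f ≤ 0) ∧
      ∀ h, z h - z (M.opp h) = φ (M.face h) - φ (M.face (M.opp h)) := by
  obtain ⟨φ, h0, hφ⟩ := M.exists_potential_of_boundary_eq_zero z hz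
  have hoff : ∀ f ∉ R, φ f = 0 := fun f hf => hR.eq_zero h0 (fun h h1 h2 => by
    have h3 := hφ h
    rcases hsupp h h1 with h4 | h4
    · rw [h4.1, h4.2] at h3
      linarith
    · exact absurd h4 h2) hf
  refine ⟨φ, hoff, fun f => ?_, hφ⟩
  by_contra hcon
  obtain ⟨h, hh, hzh⟩ := hcut
  have h1 := hR.pos_of_mem_cut hoff (fun h hh => hdir h (by have := hφ h; linarith))
    (not_le.mp hcon) hh
  have h2 := hφ h
  rw [hzh, hoff _ (mem_cut.mp hh).2] at h2
  linarith

/-! ### Circulations inside a minimal region -/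

/-- One vertex follows another one along an arc of `T`. -/
def Step (M : PlanarMap H) (T : Set H) (u w : M.Vertex) : Prop :=
  ∃ k ∈ T, M.origin k = u ∧ M.origin (M.opp k) = w

/-- A walk carries a unit of flow. -/
theorem exists_flow {T : Set H} {s t : M.Vertex} (hst : Relation.ReflTransGen (M.Step T) s t) :
    ∃ a : H → ℚ, (∀ h, 0 ≤ a h) ∧ (∀ h ∉ T, a h = 0) ∧
      ∀ w, fiberSum M.origin (fun h => a h - a (M.opp h)) w =
        (if w = s then 1 else 0) - if w = t then 1 else 0 := by
  induction hst with
  | refl => exact ⟨fun _ => 0, fun _ => le_rfl, fun _ _ => rfl, fun w => by simp [fiberSum]⟩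
  | tail _ hbc ih =>
    obtain ⟨a, ha0, haT, ha⟩ := ih
    obtain ⟨k, hkT, rfl, rfl⟩ := hbc
    refine ⟨fun h => a h + if h = k then 1 else 0, fun h => ?_, fun h hh => ?_, fun w => ?_⟩
    · have := ha0 h
      dsimp only
      split_ifs <;> linarith
    · dsimp only
      rw [haT h hh, if_neg (by rintro rfl; exact hh hkT), add_zero]
    · have h1 : (fun h => (a h + if h = k then 1 else 0) -
          (a (M.opp h) + if M.opp h = k then 1 else 0)) = fun h => (a h - a (M.opp h)) +
          ((if h = k then 1 else 0) - (if h = M.opp k then 1 else 0)) := by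
        funext h
        simp only [M.opp_eq_iff]
        ring
      rw [h1, fiberSum_add, ha, fiberSum_sub, fiberSum_single, fiberSum_single]
      simp only [eq_comm (b := w)]
      split_ifs <;> simp_all

/-- The arcs of the boundary of `R` that start in a set of vertices closed under them form a
circulation. -/
theorem fiberSum_cut_of_closed {R : Set M.Face} {C : Set M.Vertex}
    (hC : ∀ k ∈ M.cut R, M.origin k ∈ C → M.origin (M.opp k) ∈ C) (v : M.Vertex) :
    fiberSum M.origin (fun h => hind {k | k ∈ M.cut R ∧ M.origin k ∈ C} h -
      hind {k | k ∈ M.cut R ∧ M.origin k ∈ C} (M.opp h)) v = 0 := by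
  set T : Set H := {k | k ∈ M.cut R ∧ M.origin k ∈ C} with hT
  have hmem : ∀ k, k ∈ T ↔ k ∈ M.cut R ∧ M.origin k ∈ C := fun _ => Iff.rfl
  -- At a vertex of `C` all outgoing arcs are kept while incoming ones may be lost, so the net
  -- outflow is at least that of the whole contour, which is zero. The outflows add up to zero, so
  -- each one vanishes.
  have hnonneg : ∀ v, 0 ≤ fiberSum M.origin (fun h => hind T h - hind T (M.opp h)) v := by
    intro v
    by_cases hv : v ∈ C
    · have h1 : fiberSum M.origin
          (fun h => ind R (M.face h) - ind R (M.face (M.opp h))) v = 0 := by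
        rw [fiberSum_sub, M.fiberSum_origin_face, sub_self]
      rw [← h1]
      refine Finset.sum_le_sum fun h _ => ?_
      split_ifs with hh
      · dsimp only
        rw [ind_sub_ind]
        have h2 : hind T h = if h ∈ M.cut R then 1 else 0 := by
          simp only [hind, hmem, hh, hv, and_true]
        have h3 : hind T (M.opp h) ≤ if M.opp h ∈ M.cut R then 1 else 0 := by
          unfold hind
          rw [hmem]
          split_ifs <;> simp_all
        linarith
      · exact le_rfl
    · refine (Finset.sum_eq_zero fun h _ => ?_).ge
      split_ifs with hh
      · have h1 : h ∉ T := fun h' => hv (hh ▸ h'.2)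
        have h2 : M.opp h ∉ T := fun h' => hv (by
          have := hC _ h'.1 h'.2
          rwa [M.opp_opp, hh] at this)
        simp [hind, h1, h2]
      · rfl
  have hsum : ∑ v, fiberSum M.origin (fun h => hind T h - hind T (M.opp h)) v = 0 := by
    rw [sum_fiberSum, Finset.sum_sub_distrib, Equiv.sum_comp M.opp (hind T), sub_self]
  exact (Finset.sum_eq_zero_iff_of_nonneg fun v _ => hnonneg v).mp hsum v (Finset.mem_univ v)

/-- The outward half-edges inside a minimal region that start at `h₀` or away from the boundary. -/
def innerArcs (M : PlanarMap H) (S : Set H) (R : Set M.Face) (h₀ : H) : Set H :=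
  {k | k ∈ S ∧ M.face k ∈ R ∧ M.face (M.opp k) ∈ R ∧
    (k = h₀ ∨ ∀ l, M.origin l = M.origin k → M.face l ∈ R)}

/-- A walk to another vertex `u` of the contour would be a shortcut through `R`. If the contour
leads back from `u` to the start, walk and return form a circulation; otherwise the arcs of the
contour reachable from `u` do. Either one avoids the arc `b₀` but uses an arc of the contour, on
whose right its potential is positive, against `MinimalRegion.exists_potential`. -/
theorem MinimalRegion.face_mem_of_reach {S : Set H} {R : Set M.Face} (hR : M.MinimalRegion S R)
    {h₀ k₀ : H} (hf : M.face h₀ ∈ R) (hk : M.origin k₀ = M.origin h₀) (hkf : M.face k₀ ∉ R)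
    {u : M.Vertex} (hu : Relation.ReflTransGen (M.Step (M.innerArcs S R h₀)) (M.origin h₀) u)
    (hne : u ≠ M.origin h₀) {l : H} (hl : M.origin l = u) : M.face l ∈ R := by
  by_contra hlR
  obtain ⟨b₀, hb₀, hb₀'⟩ := exists_mem_cut_of_origin_eq (R := R) hk.symm hf hkf
  obtain ⟨m, hm, hmu⟩ : ∃ m ∈ M.cut R, M.origin m = u := by
    cases hu with
    | refl => exact absurd rfl hne
    | tail _ hbc =>
      obtain ⟨k, hk, -, rfl⟩ := hbc
      obtain ⟨m, hm, hm'⟩ := exists_mem_cut_of_origin_eq (R := R)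
        ((M.origin_rot (M.opp k)).trans hl.symm) (by rw [M.face_rot_opp]; exact hk.2.1) hlR
      exact ⟨m, hm, hm'.trans (M.origin_rot _)⟩
  have hA : ∀ k ∈ M.innerArcs S R h₀, k ∉ M.cut R ∧ M.opp k ∉ M.cut R := fun k hk =>
    ⟨fun h => (mem_cut.mp h).2 hk.2.2.1, fun h => (mem_cut.mp h).2 (by
      rw [M.opp_opp]; exact hk.2.1)⟩
  have key : ∀ z : H → ℚ, (∀ v, fiberSum M.origin (fun h => z h - z (M.opp h)) v = 0) →
      (∀ h, 0 ≤ z h) → (∀ h, z h ≠ 0 → h ∈ M.innerArcs S R h₀ ∨ h ∈ M.cut R) → z b₀ = 0 →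
      (∃ k ∈ M.cut R, z k ≠ 0) → False := by
    intro z hz hz0 hzS hzb ⟨k, hk, hzk⟩
    have hopp : ∀ h ∈ M.cut R, z (M.opp h) = 0 := by
      intro h hh
      by_contra hcon
      rcases hzS _ hcon with h1 | h1
      · have := (hA _ h1).2
        rw [M.opp_opp] at this
        exact this hh
      · exact opp_notMem_cut hh h1
    have hzf : ∀ h, z h ≠ 0 → M.face h ∈ R := fun h hh =>
      (hzS h hh).elim (fun h1 => h1.2.1) fun h1 => (mem_cut.mp h1).1
    obtain ⟨φ, h1, h2, h3⟩ := hR.exists_potential hz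
      (fun h hh => by
        by_cases h1 : M.face (M.opp h) ∈ R
        · exact Or.inr h1
        · exact Or.inl ⟨by_contra fun h' => hh (hzf h h'), by_contra fun h' => h1 (hzf _ h')⟩)
      (fun h hh => (hzS h (by have := hz0 (M.opp h); linarith)).elim (fun h1 => h1.1)
        (hR.cut_subset h))
      ⟨b₀, hb₀, by rw [hzb, hopp b₀ hb₀]⟩
    have h4 := h3 k
    rw [hopp k hk, h1 _ (mem_cut.mp hk).2] at h4
    have h5 := lt_of_le_of_ne (hz0 k) (Ne.symm hzk)
    linarith [h2 (M.face k)]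
  -- Arcs starting at `M.origin h₀` are excluded so that `b₀` carries no flow.
  set T : Set H := {k | k ∈ M.cut R ∧ M.origin k ≠ M.origin h₀} with hT
  by_cases hret : Relation.ReflTransGen (M.Step T) u (M.origin h₀)
  · obtain ⟨a, ha0, haT, ha⟩ := exists_flow hu
    obtain ⟨b, hb0, hbT, hb⟩ := exists_flow hret
    have ha' : ∀ h ∈ M.cut R, a h = 0 := fun h hh => haT h fun h' => (hA h h').1 hh
    refine key (fun h => a h + b h) (fun v => ?_) (fun h => add_nonneg (ha0 h) (hb0 h))
      (fun h hh => ?_) ?_ ?_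
    · have h1 : (fun h => a h + b h - (a (M.opp h) + b (M.opp h))) =
          fun h => (a h - a (M.opp h)) + (b h - b (M.opp h)) := by
        funext h; ring
      rw [h1, fiberSum_add, ha, hb]
      ring
    · by_contra hcon
      push Not at hcon
      refine hh ?_
      rw [haT h hcon.1, hbT h fun h' => hcon.2 h'.1, add_zero]
    · rw [ha' b₀ hb₀, hbT b₀ fun h' => h'.2 hb₀', add_zero]
    · by_contra hcon
      push Not at hcon
      have hbz : ∀ h, b h = 0 := by
        intro h
        by_contra hbh
        have h1 : h ∈ T := by_contra fun h' => hbh (hbT h h')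
        have := hcon h h1.1
        rw [ha' h h1.1, zero_add] at this
        exact hbh this
      have h1 := hb u
      simp only [hbz, hne, if_true, if_false, sub_self, fiberSum] at h1
      simp at h1
  · have hCne : ∀ v, Relation.ReflTransGen (M.Step T) u v → v ≠ M.origin h₀ :=
      fun v hv hv' => hret (hv' ▸ hv)
    refine key (hind {k | k ∈ M.cut R ∧ M.origin k ∈ {v | Relation.ReflTransGen (M.Step T) u v}})
      (fiberSum_cut_of_closed fun k hk hk' => hk'.tail ⟨k, ⟨hk, hCne _ hk'⟩, rfl, rfl⟩)
      (fun h => by unfold hind; split_ifs <;> norm_num) (fun h hh => ?_) ?_ ⟨m, hm, ?_⟩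
    · right
      by_contra hcon
      exact hh (if_neg fun h' => hcon h'.1)
    · exact if_neg fun h' => hCne _ h'.2 hb₀'
    · rw [hind, if_pos ⟨hm, by rw [hmu]; exact Relation.ReflTransGen.refl⟩]
      exact one_ne_zero

/-- A graph with as many edges as vertices carries a nonzero cycle. -/
theorem exists_cycle_of_card_le {B : Set H} (hB : ∀ h ∈ B, M.opp h ∈ B) {Y : Finset M.Vertex}
    (hY : Y.Nonempty) (hBY : ∀ h ∈ B, M.origin h ∈ Y)
    (hcard : 2 * Y.card ≤ (Finset.univ.filter (· ∈ B)).card) :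
    ∃ z : H → ℚ, (∀ h, z h ≠ 0 → h ∈ B) ∧
      (∀ v, fiberSum M.origin (fun h => z h - z (M.opp h)) v = 0) ∧
      ∃ h, z h ≠ z (M.opp h) := by
  obtain ⟨v₀, hv₀⟩ := hY
  rw [M.card_chosen_inter B hB] at hcard
  let ext : ({h // h ∈ B ∧ h ∈ M.chosen} → ℚ) →ₗ[ℚ] (H → ℚ) :=
    Function.ExtendByZero.linearMap ℚ Subtype.val
  -- The vertex `v₀` can be left out because boundaries sum to zero; the target dimension is then
  -- smaller than the number of edges.
  let f : ({h // h ∈ B ∧ h ∈ M.chosen} → ℚ) →ₗ[ℚ] ({v // v ∈ Y.erase v₀} → ℚ) :=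
    (LinearMap.funLeft ℚ ℚ Subtype.val).comp ((fiberSumLinear M.origin).comp
      ((LinearMap.id - LinearMap.funLeft ℚ ℚ M.opp).comp ext))
  have hker := LinearMap.ker_ne_bot_of_finrank_lt (f := f) (by
    rw [Module.finrank_fintype_fun_eq_card, Module.finrank_fintype_fun_eq_card,
      Fintype.card_coe, Finset.card_erase_of_mem hv₀, Fintype.card_subtype]
    have := Finset.card_pos.mpr ⟨v₀, hv₀⟩
    omega)
  obtain ⟨x, hx, hx0⟩ := Submodule.exists_mem_ne_zero_of_ne_bot hker
  have hval : ∀ e, ext x (Subtype.val e) = x e := fun e =>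
    Subtype.val_injective.extend_apply x 0 e
  have hzero : ∀ h, ¬ (h ∈ B ∧ h ∈ M.chosen) → ext x h = 0 := fun h hh =>
    Function.extend_apply' (f := Subtype.val) x 0 h (by rintro ⟨e, rfl⟩; exact hh e.2)
  have hsupp : ∀ h, ext x h ≠ 0 → h ∈ B := fun h hh => by
    by_contra hcon
    exact hh (hzero h fun h' => hcon h'.1)
  have hbd : ∀ v, v ≠ v₀ → fiberSum M.origin (fun h => ext x h - ext x (M.opp h)) v = 0 := by
    intro v hv
    by_cases hvY : v ∈ Y
    · exact congrFun (LinearMap.mem_ker.mp hx) ⟨v, Finset.mem_erase.mpr ⟨hv, hvY⟩⟩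
    · refine Finset.sum_eq_zero fun h _ => ?_
      split_ifs with hh
      · have h1 : h ∉ B := fun h' => hvY (hh ▸ hBY h h')
        have h2 : M.opp h ∉ B := fun h' => h1 (by have := hB _ h'; rwa [M.opp_opp] at this)
        dsimp only
        rw [hzero h fun h' => h1 h'.1, hzero _ fun h' => h2 h'.1, sub_self]
      · rfl
  refine ⟨ext x, hsupp, fun v => ?_, ?_⟩
  · by_cases hv : v = v₀
    · have h1 := sum_fiberSum M.origin (fun h => ext x h - ext x (M.opp h))
      rw [Finset.sum_eq_single v₀ (fun v _ hv => hbd v hv) (fun h => absurd (Finset.mem_univ _) h),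
        Finset.sum_sub_distrib, Equiv.sum_comp M.opp (ext x), sub_self] at h1
      rw [hv, h1]
    · exact hbd v hv
  · obtain ⟨e, he⟩ := Function.ne_iff.mp hx0
    refine ⟨e, ?_⟩
    rw [hval, hzero (M.opp e) fun h' => (M.mem_chosen_iff _).mp e.2.2 h'.2]
    exact he

/-- An outward half-edge into `R` would reach a set `Y` with too many outward half-edges for the
number of edges it spans, and the excess produces a cycle of bi-oriented edges inside `R`. -/
theorem MinimalRegion.notMem_of_origin_eq (hD : M.IsHexagonDissection) (hI : M.IsIrreducible)
    {S : Set H} (hS : M.Balanced S) {R : Set M.Face} (hR : M.MinimalRegion S R) {h₀ k₀ : H}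
    (hf : M.face h₀ ∈ R) (hf' : M.face (M.opp h₀) ∈ R) (hk : M.origin k₀ = M.origin h₀)
    (hkf : M.face k₀ ∉ R) : h₀ ∉ S := by
  intro hh₀
  set A := M.innerArcs S R h₀ with hA
  obtain ⟨Y, hY⟩ : ∃ Y : Finset M.Vertex, ∀ v, v ∈ Y ↔
      Relation.ReflTransGen (M.Step A) (M.origin h₀) v :=
    ⟨Finset.univ.filter fun v => Relation.ReflTransGen (M.Step A) (M.origin h₀) v, by simp⟩
  have hv₀ : M.origin h₀ ∈ Y := (hY _).mpr Relation.ReflTransGen.refl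
  have hall : ∀ l, M.origin l ∈ Y → M.origin l ≠ M.origin h₀ → M.face l ∈ R := fun l hl hne =>
    hR.face_mem_of_reach hf hk hkf ((hY _).mp hl) hne rfl
  have hin : ∀ v ∈ Y, ¬ M.IsOuterVertex v := by
    intro v hv
    by_cases hne : v = M.origin h₀
    · rw [hne]
      exact hR.not_isOuterVertex hS hf
    · obtain ⟨l, rfl⟩ := M.origin_surjective v
      exact hR.not_isOuterVertex hS (hall l hv hne)
  have hstep : ∀ k ∈ A, M.origin k ∈ Y → M.origin (M.opp k) ∈ Y := fun k hk hkY =>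
    (hY _).mpr (((hY _).mp hkY).tail ⟨k, hk, rfl, rfl⟩)
  obtain ⟨T, hT⟩ : ∃ T : Finset H, ∀ h, h ∈ T ↔ h ∈ A ∧ M.origin h ∈ Y :=
    ⟨Finset.univ.filter fun h => h ∈ A ∧ M.origin h ∈ Y, by simp⟩
  -- Three half-edges at each vertex other than the start, and at least `h₀` at the start.
  have hTcard : 3 * Y.card ≤ T.card + 2 := by
    rw [Finset.card_eq_sum_card_fiberwise (f := M.origin) (t := Y) (fun h hh => ((hT h).mp hh).2),
      ← Finset.add_sum_erase Y _ hv₀]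
    have h1 : 1 ≤ (T.filter fun h => M.origin h = M.origin h₀).card :=
      Finset.card_pos.mpr ⟨h₀, Finset.mem_filter.mpr
        ⟨(hT h₀).mpr ⟨⟨hh₀, hf, hf', Or.inl rfl⟩, hv₀⟩, rfl⟩⟩
    have h2 : (Y.erase (M.origin h₀)).card * 3 ≤
        ∑ v ∈ Y.erase (M.origin h₀), (T.filter fun h => M.origin h = v).card := by
      refine Finset.card_nsmul_le_sum _ _ 3 fun v hv => ?_
      obtain ⟨hne, hvY⟩ := Finset.mem_erase.mp hv
      rw [← hS.vertex v (hin v hvY)]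
      refine Finset.card_le_card fun h hh => ?_
      obtain ⟨-, rfl, hhS⟩ := Finset.mem_filter.mp hh
      have hl : ∀ l, M.origin l = M.origin h → M.face l ∈ R := fun l hl =>
        hall l (hl ▸ hvY) (hl ▸ hne)
      refine Finset.mem_filter.mpr ⟨(hT h).mpr ⟨⟨hhS, hl h rfl, ?_, Or.inr hl⟩, hvY⟩, rfl⟩
      rw [← M.face_rot]
      exact hl _ (M.origin_rot h)
    rw [Finset.card_erase_of_mem hv₀] at h2
    omega
  obtain ⟨B, hB⟩ : ∃ B : Set H, ∀ h, h ∈ B ↔ h ∈ T ∧ M.opp h ∈ T :=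
    ⟨{h | h ∈ T ∧ M.opp h ∈ T}, fun _ => Iff.rfl⟩
  -- `T` and its reverse lie among the at most `4|Y| - 4` half-edges inside `Y`, so they share at
  -- least `2(3|Y| - 2) - (4|Y| - 4) = 2|Y|`.
  have hBcard : 2 * Y.card ≤ (Finset.univ.filter (· ∈ B)).card := by
    have h1 := Finset.card_union_add_card_inter T (T.image M.opp)
    rw [Finset.card_image_of_injective _ M.opp_injective] at h1
    have h2 : (T ∪ T.image M.opp).card ≤ (M.halfEdgesInside Y).card := by
      refine Finset.card_le_card (Finset.union_subset (fun h hh => ?_) (fun h hh => ?_))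
      · obtain ⟨h3, h4⟩ := (hT h).mp hh
        exact mem_halfEdgesInside.mpr ⟨h4, hstep h h3 h4⟩
      · obtain ⟨k, hk, rfl⟩ := Finset.mem_image.mp hh
        obtain ⟨h3, h4⟩ := (hT k).mp hk
        exact mem_halfEdgesInside.mpr ⟨hstep k h3 h4, by rwa [M.opp_opp]⟩
    have h3 := card_halfEdgesInside_le hD hI ⟨_, hv₀⟩ hin
    have h4 : (T ∩ T.image M.opp) = Finset.univ.filter (· ∈ B) := by
      ext h
      simp only [Finset.mem_inter, Finset.mem_image, Finset.mem_filter, Finset.mem_univ, true_and,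
        hB]
      refine and_congr_right fun _ => ⟨?_, fun h' => ⟨_, h', M.opp_opp h⟩⟩
      rintro ⟨k, hk, rfl⟩
      rwa [M.opp_opp]
    rw [h4] at h1
    omega
  obtain ⟨z, hzB, hz, h₁, hh₁⟩ := exists_cycle_of_card_le (M := M) (B := B)
    (fun h hh => (hB _).mpr ⟨((hB h).mp hh).2, by rw [M.opp_opp]; exact ((hB h).mp hh).1⟩)
    ⟨_, hv₀⟩ (fun h hh => ((hT h).mp ((hB h).mp hh).1).2) hBcard
  have hzA : ∀ h, z h ≠ 0 ∨ z (M.opp h) ≠ 0 → h ∈ A := by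
    rintro h (hh | hh)
    · exact ((hT h).mp ((hB h).mp (hzB h hh)).1).1
    · have := ((hB _).mp (hzB _ hh)).2
      rw [M.opp_opp] at this
      exact ((hT h).mp this).1
  have hzero : ∀ h, h ∉ A → z h = 0 ∧ z (M.opp h) = 0 := by
    intro h hh
    by_contra hcon
    exact hh (hzA h (by tauto))
  have hex : ∀ s : ℚ, ∃ φ : M.Face → ℚ, (∀ f ∉ R, φ f = 0) ∧ (∀ f, φ f ≤ 0) ∧
      ∀ h, s * z h - s * z (M.opp h) = φ (M.face h) - φ (M.face (M.opp h)) := by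
    intro s
    refine hR.exists_potential (z := fun h => s * z h) (fun v => ?_) (fun h hh => Or.inl ?_)
      (fun h hh => ?_) ?_
    · simp only [← mul_sub]
      rw [fiberSum_smul, hz, mul_zero]
    · have := hzero h fun h' => hh h'.2.1
      simp [this]
    · by_contra hcon
      have := hzero h fun h' => hcon h'.1
      simp [this] at hh
    · obtain ⟨b, hb⟩ := cut_nonempty hR.nonempty hR.outer_notMem
      have := hzero b fun h' => (mem_cut.mp hb).2 h'.2.2.1
      exact ⟨b, hb, by simp [this]⟩
  obtain ⟨ψ, hψ0, hψ, hψz⟩ := hex (-1)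
  obtain ⟨φ, hφ0, hφ, hφz⟩ := hex 1
  have hsum : ∀ f, φ f + ψ f = 0 := by
    intro f
    rw [M.face_const (fun f => φ f + ψ f) (fun h => by
      have h1 := hφz h
      have h2 := hψz h
      linarith) f M.outer, hφ0 _ hR.outer_notMem, hψ0 _ hR.outer_notMem, add_zero]
  have hφ1 : ∀ f, φ f = 0 := fun f => by linarith [hsum f, hφ f, hψ f]
  have h1 := hφz h₁
  rw [hφ1, hφ1] at h1
  exact hh₁ (by linarith)

/-- If no clockwise set of edges exists, neither does a clockwise set of faces. -/
theorem FaceRegion.exists_edgeRegion (hD : M.IsHexagonDissection) (hI : M.IsIrreducible)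
    {S : Set H} (hS : M.Balanced S) {R₀ : Set M.Face} (hR₀ : M.FaceRegion S R₀) :
    ∃ B, M.EdgeRegion S B := by
  obtain ⟨R, hR⟩ := hR₀.exists_minimalRegion
  -- The edges with `R` on both sides. Each face of `R` has an inward half-edge, which is not on the
  -- outward contour and so provides an element.
  refine ⟨{h | M.face h ∈ R ∧ M.face (M.opp h) ∈ R}, ?_, ?_, ?_, ?_, ?_⟩
  · obtain ⟨f, hf⟩ := hR.nonempty
    obtain ⟨h, rfl, -, hhS⟩ := hS.exists_notMem (f := f) fun h => hR.outer_notMem (h ▸ hf)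
    exact ⟨h, hf, by_contra fun h' => hhS (hR.cut_subset h (mem_cut.mpr ⟨hf, h'⟩))⟩
  · exact fun h hh => ⟨hh.2, by rw [M.opp_opp]; exact hh.1⟩
  · exact fun h hh => hR.not_isOuterVertex hS hh.1
  · intro h hh hk
    refine hR.notMem_of_origin_eq hD hI hS hh.1 hh.2 (M.origin_rot_symm h) fun h' => hk ⟨h', ?_⟩
    rw [M.face_opp_rot_symm]
    exact hh.1
  · intro h hh hk
    have h1 := hk.2
    rw [M.face_opp_rot_symm] at h1
    exact hR.cut_subset h (mem_cut.mpr ⟨h1, fun h' => hh ⟨h1, h'⟩⟩)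

/-- If no clockwise set of edges exists, the two halves of an inner edge are not both inward. -/
theorem Balanced.mem_or_opp_mem (hD : M.IsHexagonDissection) (hI : M.IsIrreducible) {S : Set H}
    (hS : M.Balanced S) (hB : ∀ B, ¬ M.EdgeRegion S B) {h : H} (hin : M.IsInner h) :
    h ∈ S ∨ M.opp h ∈ S := by
  by_contra! hcon
  obtain ⟨h1, h2⟩ := hcon
  have key : ∀ h, M.IsInner h → h ∉ S → M.opp h ∉ S → ¬ M.IsOuterVertex (M.origin h) := by
    intro h hin h1 h2 ho
    have h3 := not_isOuterVertex_opp hD hI hin ho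
    obtain ⟨k, hk1, hk2, hk3⟩ := exists_isInner_of_isOuterVertex hD (h := M.rot h)
      (by rw [M.face_rot]; exact hin.2) (by rwa [M.origin_rot])
    have := hS.eq_of_face_eq (hk1.trans (M.face_rot h)) hk2 hin.opp
      (fun h' => hS.not_outer k h' hk3) h2
    exact h3 (this ▸ hk3)
  have ho := key h hin h1 h2
  have ho' := key (M.opp h) hin.opp h2 (by rwa [M.opp_opp])
  have hne := hD.origin_opp_ne h
  -- The face on the right of `M.rot h` already has `M.opp h` as its inward half-edge.
  have leave : ∀ h, h ∉ S → M.opp h ∉ S → ¬ M.IsOuterVertex (M.origin h) →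
      ¬ M.IsOuterVertex (M.origin (M.opp h)) → M.rot h ≠ M.opp h → M.rot h ∈ S := by
    intro h h1 h2 ho ho' hne
    by_contra hcon
    exact hne (hS.eq_of_face_eq (M.face_rot h)
      (isInner_of_not_isOuterVertex (by rwa [M.origin_rot])) (isInner_of_not_isOuterVertex ho')
      hcon h2)
  refine hB {k | k = h ∨ k = M.opp h} ⟨⟨h, Or.inl rfl⟩, ?_, ?_, ?_, ?_⟩
  · rintro k (rfl | rfl)
    · exact Or.inr rfl
    · exact Or.inl (M.opp_opp h)
  · rintro k (rfl | rfl)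
    · exact ho
    · exact ho'
  · rintro k (rfl | rfl) -
    · exact h1
    · exact h2
  · intro k hk hk'
    have e : k = M.rot (M.rot.symm k) := (Equiv.apply_symm_apply _ _).symm
    rcases hk' with hk' | hk'
    · rw [hk'] at e
      rw [e]
      exact leave h h1 h2 ho ho' fun h' => hk (Or.inr (e.trans h'))
    · rw [hk'] at e
      rw [e]
      exact leave (M.opp h) h2 (by rwa [M.opp_opp]) ho' (by rwa [M.opp_opp])
        fun h' => hk (Or.inl ((e.trans h').trans (M.opp_opp h)))

/-! ### Tri-orientations as balanced sets -/

namespace InnerOrientation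

/-- The outward half-edges of an orientation. -/
def outwardSet (X : M.InnerOrientation) : Set H := {h | ∃ hi, X ⟨h, hi⟩ = Direction.outward}

theorem mem_outwardSet {X : M.InnerOrientation} {h : H} (hi : M.IsInner h) :
    h ∈ outwardSet X ↔ X ⟨h, hi⟩ = Direction.outward :=
  ⟨fun ⟨_, h'⟩ => h', fun h' => ⟨hi, h'⟩⟩

theorem outwardSet_injective :
    Function.Injective (outwardSet : M.InnerOrientation → Set H) := by
  intro X Y hXY
  funext h
  have h1 : X h = Direction.outward ↔ Y h = Direction.outward := by
    rw [← mem_outwardSet h.2, ← mem_outwardSet h.2, hXY]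
  cases hX : X h <;> cases hY : Y h <;> simp_all

theorem outdegree_eq_card (X : M.InnerOrientation) (v : M.Vertex) :
    outdegree X v = (Finset.univ.filter fun h => M.origin h = v ∧ h ∈ outwardSet X).card := by
  rw [outdegree, ← Fintype.card_subtype, ← Nat.card_eq_fintype_card]
  exact Nat.card_congr
    { toFun := fun h => ⟨h.1.1, h.2.1, h.1.2, h.2.2⟩
      invFun := fun h => ⟨⟨h.1, h.2.2.1⟩, h.2.1, h.2.2.2⟩
      left_inv := fun _ => rfl
      right_inv := fun _ => rfl }

theorem biOriented_or_simplyOriented_iff {X : M.InnerOrientation} {h : M.InnerHalfEdge} :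
    BiOriented X h ∨ SimplyOriented X h ↔ X h = Direction.outward := by
  unfold BiOriented SimplyOriented
  cases X (M.innerOpp h) <;> simp

/-- Being bi-oriented or simply oriented along the traversal just means that the half-edge is
outward, so the correspondence between clockwise cycles and clockwise sets of faces applies. -/
theorem noClockwiseCircuit_iff (X : M.InnerOrientation) :
    NoClockwiseCircuit X ↔ ∀ R, ¬ M.FaceRegion (outwardSet X) R := by
  constructor
  · intro hX R hR
    obtain ⟨n, hn, c, hc, hright, hS⟩ := hR.exists_cycle
    refine hX n c ⟨hc, hright, fun i => ?_⟩
    obtain ⟨hi, hXi⟩ := hS i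
    exact ⟨hi, biOriented_or_simplyOriented_iff.mpr hXi⟩
  · intro hX n _ c hc
    obtain ⟨R, hR⟩ := hc.simple.exists_faceRegion hc.interior_right (S := outwardSet X)
      fun i => by
        obtain ⟨hi, hXi⟩ := hc.oriented i
        exact ⟨hi, biOriented_or_simplyOriented_iff.mp hXi⟩
    exact hX R hR

theorem IsTriOrientation.not_isOuterVertex {X : M.InnerOrientation} (hX : IsTriOrientation X)
    {h : H} (hh : h ∈ outwardSet X) : ¬ M.IsOuterVertex (M.origin h) := by
  intro ho
  have h1 := hX.outer_vertex _ ho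
  rw [outdegree_eq_card, Finset.card_eq_zero, Finset.filter_eq_empty_iff] at h1
  exact h1 (Finset.mem_univ h) ⟨rfl, hh⟩

/-- A face without inward half-edge has no outer vertex, for this would supply one; it is then a
clockwise set by itself. -/
theorem IsTriOrientation.exists_inward {X : M.InnerOrientation} (hD : M.IsHexagonDissection)
    (hX : IsTriOrientation X) (hR : ∀ R, ¬ M.FaceRegion (outwardSet X) R) {f : M.Face}
    (hf : f ≠ M.outer) : ∃ h, M.face h = f ∧ M.IsInner h ∧ h ∉ outwardSet X := by
  by_contra! hcon
  have hout : ∀ h, M.face h = f → ¬ M.IsOuterVertex (M.origin h) := by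
    rintro h rfl ho
    obtain ⟨k, hk1, hk2, hk3⟩ := exists_isInner_of_isOuterVertex hD hf ho
    exact hX.not_isOuterVertex (hcon k hk1 hk2) hk3
  refine hR {f} ⟨⟨f, rfl⟩, fun h => hf h.symm, fun h hh => ?_⟩
  have h1 : M.face h = f := (mem_cut.mp hh).1
  exact hcon h h1 (isInner_of_not_isOuterVertex (hout h h1))

theorem IsTriOrientation.card_inward {X : M.InnerOrientation} (hD : M.IsHexagonDissection)
    (hX : IsTriOrientation X) :
    (Finset.univ.filter fun h => M.IsInner h ∧ h ∉ outwardSet X).card + 1 =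
      Fintype.card M.Face := by
  have h1 := Finset.card_filter_add_card_filter_not
    (s := Finset.univ.filter fun h => M.IsInner h) (fun h => h ∈ outwardSet X)
  rw [Finset.filter_filter, Finset.filter_filter] at h1
  have h2 : (Finset.univ.filter fun h => M.IsInner h ∧ h ∈ outwardSet X).card =
      ∑ v : M.Vertex, if M.IsOuterVertex v then 0 else 3 := by
    rw [Finset.card_eq_sum_card_fiberwise (f := M.origin) (t := Finset.univ)
      (fun _ _ => Finset.mem_univ _)]
    refine Finset.sum_congr rfl fun v _ => ?_
    have h3 : outdegree X v = if M.IsOuterVertex v then 0 else 3 := by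
      split_ifs with hv
      · exact hX.outer_vertex v hv
      · exact hX.inner_vertex v hv
    rw [← h3, outdegree_eq_card, Finset.filter_filter]
    refine congrArg Finset.card (Finset.filter_congr fun h _ => ?_)
    exact ⟨fun h => ⟨h.2, h.1.2⟩, fun h => ⟨⟨h.2.1, h.2⟩, h.1⟩⟩
  have h3 := Finset.card_filter_add_card_filter_not (s := Finset.univ)
    (fun v => M.IsOuterVertex v)
  rw [Finset.sum_ite, Finset.sum_const_zero, Finset.sum_const, smul_eq_mul] at h2
  rw [card_isOuterVertex hD, Finset.card_univ] at h3
  have h4 := card_isInner hD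
  have h5 := card_halfEdge hD
  have h6 := card_vertex hD
  omega

/-- Each inner face has at least one inward half-edge, and by `IsTriOrientation.card_inward` their
total equals the number of inner faces. -/
theorem IsTriOrientation.balanced {X : M.InnerOrientation} (hD : M.IsHexagonDissection)
    (hX : IsTriOrientation X) (hR : ∀ R, ¬ M.FaceRegion (outwardSet X) R) :
    M.Balanced (outwardSet X) := by
  refine ⟨fun h hh => hX.not_isOuterVertex hh, fun v hv => ?_, fun f hf => ?_⟩
  · rw [← outdegree_eq_card]
    exact hX.inner_vertex v hv
  · have hle : ∀ f ∈ Finset.univ.erase M.outer, 1 ≤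
        (Finset.univ.filter fun h => M.face h = f ∧ M.IsInner h ∧ h ∉ outwardSet X).card := by
      intro f hf
      obtain ⟨h, hh⟩ := hX.exists_inward hD hR (Finset.ne_of_mem_erase hf)
      exact Finset.card_pos.mpr ⟨h, Finset.mem_filter.mpr ⟨Finset.mem_univ h, hh⟩⟩
    refine ((Finset.sum_eq_sum_iff_of_le hle).mp ?_ f
      (Finset.mem_erase.mpr ⟨hf, Finset.mem_univ f⟩)).symm
    have h1 := hX.card_inward hD
    rw [Finset.card_eq_sum_card_fiberwise (f := M.face) (t := Finset.univ.erase M.outer)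
      (fun h hh => Finset.mem_erase.mpr
        ⟨(Finset.mem_filter.mp hh).2.1.1, Finset.mem_univ _⟩)] at h1
    rw [Finset.sum_const, Finset.card_erase_of_mem (Finset.mem_univ _), Finset.card_univ, ← h1,
      smul_eq_mul, mul_one, Nat.add_sub_cancel]
    refine Finset.sum_congr rfl fun g _ => ?_
    rw [Finset.filter_filter]
    exact congrArg Finset.card (Finset.filter_congr fun h _ => and_comm)

theorem exists_outwardSet_eq {S : Set H} (hS : ∀ h ∈ S, M.IsInner h) :
    ∃ X : M.InnerOrientation, outwardSet X = S := by
  refine ⟨fun h => if h.1 ∈ S then Direction.outward else Direction.inward, Set.ext fun h => ?_⟩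
  constructor
  · rintro ⟨hi, h1⟩
    by_contra hcon
    simp [hcon] at h1
  · exact fun hh => ⟨hS h hh, if_pos hh⟩

theorem isTriOrientation_of_balanced {X : M.InnerOrientation} (hS : M.Balanced (outwardSet X))
    (hX : ∀ h, M.IsInner h → h ∈ outwardSet X ∨ M.opp h ∈ outwardSet X) :
    IsTriOrientation X := by
  refine ⟨fun v hv => ?_, fun v hv => ?_, fun h hh => ?_⟩
  · rw [outdegree_eq_card, Finset.card_eq_zero, Finset.filter_eq_empty_iff]
    rintro h - ⟨rfl, hh⟩
    exact hS.not_outer h hh hv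
  · rw [outdegree_eq_card]
    exact hS.vertex v hv
  · rcases hX h.1 h.2 with h1 | h1
    · have := (mem_outwardSet h.2).mp h1
      simp [hh.1] at this
    · have : X (M.innerOpp h) = Direction.outward := (mem_outwardSet h.2.opp).mp h1
      simp [hh.2] at this

end InnerOrientation

end Development

end PlanarMap

/-! ### Existence and uniqueness -/

theorem mainTheorem2 {H : Type*} (D : PlanarMap H)
    (hD : D.IsHexagonDissection) (hirr : D.IsIrreducible) :
    ∃! X : D.InnerOrientation,
      PlanarMap.InnerOrientation.IsTriOrientation X ∧
        PlanarMap.InnerOrientation.NoClockwiseCircuit X := by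
  have := D.finite
  let _ : Fintype H := Fintype.ofFinite H
  obtain ⟨S, hS, hB⟩ := PlanarMap.exists_balanced_without_edgeRegion hD hirr
  obtain ⟨X, rfl⟩ := PlanarMap.InnerOrientation.exists_outwardSet_eq
    fun h hh => PlanarMap.isInner_of_not_isOuterVertex (hS.not_outer h hh)
  refine ⟨X, ⟨PlanarMap.InnerOrientation.isTriOrientation_of_balanced hS
    fun h hh => hS.mem_or_opp_mem hD hirr hB hh, ?_⟩, ?_⟩
  · rw [PlanarMap.InnerOrientation.noClockwiseCircuit_iff]
    intro R hR
    obtain ⟨B, hB'⟩ := hR.exists_edgeRegion hD hirr hS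
    exact hB B hB'
  · rintro Y ⟨hY, hYc⟩
    rw [PlanarMap.InnerOrientation.noClockwiseCircuit_iff] at hYc
    have hYS := hY.balanced hD hYc
    by_contra hne
    rcases hYS.exists_edgeRegion hS
      (fun h => hne (PlanarMap.InnerOrientation.outwardSet_injective h)) with ⟨B, hB'⟩ | ⟨B, hB'⟩
    · exact hYc _ (hB'.faceRegion hD hYS)
    · exact hB B hB'
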